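/- Let $\mathbb F$ be a non-archimedean local field of characteristic $0$ with ring of integers $\mathfrak o$ and module $|\cdot|$ (so $d(ax)=|a|\,dx$), and let $\chi$ be a continuous unitary character of the additive group $\mathbb F$ that is trivial on $\mathfrak o$ and on no larger fractional ideal. Let $\mathsf W$ be a finite-dimensional symplectic space over $\mathbb F$ with form $\langle\cdot,\cdot\rangle$, let $\mathcal L\subseteq\mathsf W$ be a self-dual lattice (i.e. $w\in\mathcal L$ if and only if $\langle w,w'\rangle\in\mathfrak o$ for all $w'\in\mathcal L$), and let $\mathsf W=\mathsf X\oplus\mathsf Y$ be a complete polarization with $n=\dim\mathsf X\ge 1$. An endomorphism $x\in\mathrm{End}(\mathsf X)$ acts on $\mathsf W$ as the element of $\mathfrak{sp}(\mathsf W)$ that preserves $\mathsf X$ and $\mathsf Y$ and restricts to $x$ on $\mathsf X$. Normalize the Haar measures so that $\mathfrak o\subseteq\mathbb F$, $\mathcal L\subseteq \mathsf W$ and $\{x\in\mathrm{End}(\mathsf X): x\mathcal L\subseteq\mathcal L\}$ have volume $1$. For a finite-dimensional $\mathbb F$-space $V$ let $\mathcal S(V)$ be the space of locally constant, compactly supported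 functions $V\to\mathbb C$; a distribution on $V$ is a linear functional on $\mathcal S(V)$, and $\mathcal S^*(V)$ is the space of these. Put $\hat\psi(y)=\int_{\mathrm{End}(\mathsf X)}\chi(-\mathrm{tr}(xy))\psi(x)\,dx$ for $\psi\in\mathcal S(\mathrm{End}(\mathsf X))$, which is again in $\mathcal S(\mathrm{End}(\mathsf X))$, and $\hat T(\psi)=T(\hat\psi)$ for $T\in\mathcal S^*(\mathrm{End}(\mathsf X))$. The group $\mathbb F^\times$ acts on $\mathsf W$ by $a(x+y)=ax+a^{-1}y$ ($x\in\mathsf X$, $y\in\mathsf Y$). Let $\mathsf W_{\mathbb F^\times}=(\mathsf X\setminus\{0\})\oplus(\mathsf Y\setminus\{0\})$. There is a unique positive measure $d(\mathbb F^\times w)$ on $\mathbb F^\times\backslash\mathsf W_{\mathbb F^\times}$ such that, with absolutely convergent integrals, $$\int_{\mathsf W_{\mathbb F^\times}}\phi(w)\,dw=\int_{\mathbb F^\times\backslash\mathsf W_{\mathbb F^\times}}\int_{\mathbb F^\times}\phi(a(w))\,\frac{da}{|a|}\,d(\mathbb F^\times w)\qquad(\phi\in\mathcal S(\mathsf W)).$$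 Let $\mathcal O_k\subseteq\mathrm{End}(\mathsf X)$ be the set of endomorphisms of rank $k$. For $g,h\in\mathrm{GL}(\mathsf X)$ and a function $\psi$ put $((L\otimes R)(g,h)\psi)(x)=\psi(g^{-1}xh)$. Consider nonzero positive Radon measures $\mu_{\mathcal O_k}$ on $\mathcal O_k$ with $$\mu_{\mathcal O_k}\big((L\otimes R)(g,h)\psi\big)=|\det g|^{k}|\det h|^{-k}\mu_{\mathcal O_k}(\psi)\qquad(g,h\in \mathrm{GL}(\mathsf X),\ \psi\in C_c(\mathcal O_k)).\qquad(*)$$ (i) For $k=1$ and for $k=n-1$ such a measure exists and is unique up to a positive constant. Every such measure, extended by zero to $\mathrm{End}(\mathsf X)$, integrates every $\psi\in\mathcal S(\mathrm{End}(\mathsf X))$ absolutely, and so defines a distribution $\mu_{\mathcal O_k}\in\mathcal S^*(\mathrm{End}(\mathsf X))$; this distribution satisfies $(*)$ for all $\psi\in\mathcal S(\mathrm{End}(\mathsf X))$. (ii) For every $\psi\in\mathcal S(\mathrm{End}(\mathsf X))$ the iterated integral $$\mathrm{chc}(\psi)=\int_{\mathbb F^\times\backslash\mathsf W_{\mathbb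 F^\times}}\int_{\mathrm{End}(\mathsf X)}\chi(\langle xw,w\rangle)\psi(x)\,dx\,d(\mathbb F^\times w)$$ is well defined, each of the two consecutive integrals being absolutely convergent, and $\mathrm{chc}$ is a distribution on $\mathrm{End}(\mathsf X)$. With suitable normalizations of $\mu_{\mathcal O_1}$ and $\mu_{\mathcal O_{n-1}}$, $$\mu_{\mathcal O_{n-1}}(\psi)=\hat\mu_{\mathcal O_1}(\psi)=\mathrm{chc}(\psi)\qquad(\psi\in\mathcal S(\mathrm{End}(\mathsf X))).$$ If $n=2$ and $\mathcal L=(\mathcal L\cap\mathsf X)\oplus(\mathcal L\cap\mathsf Y)$, the two normalizations of the measure on $\mathcal O_1=\mathcal O_{n-1}$ coincide. -/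

import Mathlib

open MeasureTheory Module
open scoped NNReal ENNReal

noncomputable section

/-! ### Schwartz-Bruhat functions and distributions -/

/-- The Schwartz-Bruhat space `S(V)`: the locally constant functions `V → ℂ` of compact support. -/
def SchwartzBruhat (V : Type*) [TopologicalSpace V] : Submodule ℂ (V → ℂ) where
  carrier := {φ | IsLocallyConstant φ ∧ HasCompactSupport φ}
  add_mem' ha hb := ⟨ha.1.add hb.1, ha.2.add hb.2⟩
  zero_mem' := ⟨IsLocallyConstant.const 0, HasCompactSupport.zero⟩
  smul_mem' c _ h := ⟨h.1.comp (fun z => c • z), h.2.smul_left (f := fun _ => c)⟩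

/-- The space `S*(V)` of distributions: all linear functionals on the Schwartz-Bruhat space. -/
abbrev SBDistribution (V : Type*) [TopologicalSpace V] : Type _ :=
  SchwartzBruhat V →ₗ[ℂ] ℂ

/-- Precomposition with a homeomorphism, as a linear map of Schwartz-Bruhat spaces. -/
def SchwartzBruhat.compHomeo {V : Type*} [TopologicalSpace V] (e : V ≃ₜ V) :
    SchwartzBruhat V →ₗ[ℂ] SchwartzBruhat V where
  toFun φ := ⟨fun v => (φ : V → ℂ) (e v), φ.2.1.comp_continuous e.continuous,
    φ.2.2.comp_homeomorph e⟩
  map_add' _ _ := rfl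
  map_smul' _ _ := rfl

/-! ### The base field -/

section Field

variable {F : Type*} [NontriviallyNormedField F] [LocallyCompactSpace F]

/-- The module `|a|` of `a ∈ F`: the factor by which multiplication by `a` scales Haar measure. -/
def modulus (a : F) : ℝ≥0 :=
  open Classical in if h : a ≠ 0 then distribHaarChar F (Units.mk0 a h) else 0

/-- The measure `da / |a|` on `Fˣ`, where `da` is a given measure on `F`. -/
def multMeasure [MeasurableSpace F] (da : Measure F) : Measure Fˣ :=
  (da.comap Units.val).withDensity fun a => ((modulus (a : F))⁻¹ : ℝ≥0)

end Field

/-! ### Endomorphisms, rank orbits and orbital measures -/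

section Endo

variable {F : Type*} [NontriviallyNormedField F]
  {X : Type*} [NormedAddCommGroup X] [NormedSpace F X]

/-- The action of `(g, h) ∈ GL(X) × GL(X)` on `End(X)`, `x ↦ g x h⁻¹`. -/
def actHomeo (g h : (X →L[F] X)ˣ) : (X →L[F] X) ≃ₜ (X →L[F] X) where
  toFun x := g * x * ↑h⁻¹
  invFun x := ↑g⁻¹ * x * h
  left_inv x := by simp [mul_assoc]
  right_inv x := by simp [mul_assoc]
  continuous_toFun := by fun_prop
  continuous_invFun := by fun_prop

/-- The action `(L ⊗ R)(g, h) ψ (x) = ψ (g⁻¹ x h)` on Schwartz-Bruhat functions. -/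
def leftRight (g h : (X →L[F] X)ˣ) :
    SchwartzBruhat (X →L[F] X) →ₗ[ℂ] SchwartzBruhat (X →L[F] X) :=
  SchwartzBruhat.compHomeo (actHomeo g h).symm

variable (F X) in
/-- The set `O_k` of endomorphisms of `X` of rank `k`. -/
def rankSet (k : ℕ) : Set (X →L[F] X) :=
  {x | finrank F (LinearMap.range (x : X →ₗ[F] X)) = k}

lemma finrank_range_mul_units (g h : (X →L[F] X)ˣ) (x : X →L[F] X) :
    finrank F (LinearMap.range ((g * x * h : X →L[F] X) : X →ₗ[F] X)) =
      finrank F (LinearMap.range (x : X →ₗ[F] X)) := by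
  let eg : X ≃ₗ[F] X := (ContinuousLinearEquiv.ofUnit g).toLinearEquiv
  let eh : X ≃ₗ[F] X := (ContinuousLinearEquiv.ofUnit h).toLinearEquiv
  have : ((g * x * h : X →L[F] X) : X →ₗ[F] X) =
      (eg : X →ₗ[F] X) ∘ₗ (x : X →ₗ[F] X) ∘ₗ (eh : X →ₗ[F] X) := rfl
  rw [this, LinearMap.range_comp, LinearMap.range_comp_of_range_eq_top _ eh.range]
  exact LinearEquiv.finrank_map_eq eg _

/-- The map `x ↦ g⁻¹ x h` of `O_k` to itself. -/
def rankSetAct {k : ℕ} (g h : (X →L[F] X)ˣ) (x : rankSet F X k) : rankSet F X k :=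
  ⟨(↑g⁻¹ : X →L[F] X) * x.1 * (h : X →L[F] X), by
    have h1 := finrank_range_mul_units g⁻¹ h x.1
    have h2 : finrank F (LinearMap.range (x.1 : X →ₗ[F] X)) = k := x.2
    rw [h2] at h1
    exact h1⟩

/-- The factor `|det g|^k |det h|^{-k}`. -/
def transformFactor [LocallyCompactSpace F] (k : ℕ) (g h : (X →L[F] X)ˣ) : ℂ :=
  (((modulus (g : X →L[F] X).det) ^ k * ((modulus (h : X →L[F] X).det) ^ k)⁻¹ : ℝ≥0) : ℂ)

/-- `μ` is a nonzero positive Radon measure on `O_k` such that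
`μ ((L ⊗ R)(g, h) ψ) = |det g|^k |det h|^{-k} μ(ψ)` for all `ψ ∈ C_c(O_k)`. -/
structure IsOrbitMeasure [LocallyCompactSpace F] (k : ℕ) (μ : Measure (rankSet F X k)) : Prop where
  ne_zero : μ ≠ 0
  finite_on_compacts : ∀ K : Set (rankSet F X k), IsCompact K → μ K < ∞
  transform : ∀ (g h : (X →L[F] X)ˣ) (ψ : rankSet F X k → ℂ), Continuous ψ → HasCompactSupport ψ →
    ∫ x, ψ (rankSetAct g h x) ∂μ = transformFactor k g h * ∫ x, ψ x ∂μ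

/-- The extension by zero of a measure on `O_k` to `End(X)`. -/
def extendByZero {k : ℕ} (μ : Measure (rankSet F X k)) : Measure (X →L[F] X) :=
  μ.map Subtype.val

/-- The extension by zero of the measure `μ` on `O_k` integrates all Schwartz-Bruhat functions
absolutely, and `T` is the distribution so defined. -/
def ExtendsToDistribution {k : ℕ} (μ : Measure (rankSet F X k)) (T : SBDistribution (X →L[F] X)) :
    Prop :=
  ∀ ψ : SchwartzBruhat (X →L[F] X),
    Integrable (ψ : (X →L[F] X) → ℂ) (extendByZero μ) ∧
      T ψ = ∫ x, (ψ : (X →L[F] X) → ℂ) x ∂(extendByZero μ)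

/-- The Fourier transform `ψ̂(y) = ∫ χ(-tr(z y)) ψ(z) dz` on `End(X)`. -/
def endFourier (χ : AddChar F Circle) (dz : Measure (X →L[F] X)) (ψ : (X →L[F] X) → ℂ)
    (y : X →L[F] X) : ℂ :=
  ∫ z, (χ (-(LinearMap.trace F X ((z * y : X →L[F] X) : X →ₗ[F] X))) : ℂ) * ψ z ∂dz

/-- `T'` is the Fourier transform of the distribution `T`: for every Schwartz-Bruhat function `ψ`,
`ψ̂` is again a Schwartz-Bruhat function and `T'(ψ) = T(ψ̂)`. -/
def IsFourierTransform (χ : AddChar F Circle) (dz : Measure (X →L[F] X))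
    (T T' : SBDistribution (X →L[F] X)) : Prop :=
  ∀ ψ : SchwartzBruhat (X →L[F] X), ∃ φ : SchwartzBruhat (X →L[F] X),
    (φ : (X →L[F] X) → ℂ) = endFourier χ dz ψ ∧ T' ψ = T φ

end Endo

/-! ### Symplectic spaces with a complete polarization -/

/-- A symplectic form on `W` together with a complete polarization `W = X ⊕ Y`. -/
structure PolarizedSymplectic (F W : Type*) [Field F] [AddCommGroup W] [Module F W] where
  form : LinearMap.BilinForm F W
  alt : form.IsAlt
  nondeg : form.Nondegenerate
  X : Submodule F W
  Y : Submodule F W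
  compl : IsCompl X Y
  isotropic_X : ∀ x ∈ X, ∀ x' ∈ X, form x x' = 0
  isotropic_Y : ∀ y ∈ Y, ∀ y' ∈ Y, form y y' = 0

namespace PolarizedSymplectic

section Algebra

variable {F W : Type*} [Field F] [AddCommGroup W] [Module F W] (P : PolarizedSymplectic F W)

/-- The projection of `W` onto `X` along `Y`, as an endomorphism of `W`. -/
def prX : W →ₗ[F] W := P.X.projection P.Y P.compl

/-- The projection of `W` onto `Y` along `X`, as an endomorphism of `W`. -/
def prY : W →ₗ[F] W := P.Y.projection P.X P.compl.symm

lemma prX_mem (w : W) : P.prX w ∈ P.X := Submodule.projection_apply_mem _ _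

lemma prY_mem (w : W) : P.prY w ∈ P.Y := Submodule.projection_apply_mem _ _

lemma prX_of_mem {w : W} (h : w ∈ P.X) : P.prX w = w :=
  Submodule.projection_apply_left P.compl ⟨w, h⟩

lemma prX_of_mem_Y {w : W} (h : w ∈ P.Y) : P.prX w = 0 :=
  (Submodule.projection_apply_eq_zero_iff P.compl).2 h

lemma prY_of_mem {w : W} (h : w ∈ P.Y) : P.prY w = w :=
  Submodule.projection_apply_left P.compl.symm ⟨w, h⟩

lemma prY_of_mem_X {w : W} (h : w ∈ P.X) : P.prY w = 0 :=
  (Submodule.projection_apply_eq_zero_iff P.compl.symm).2 h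

lemma prX_add_prY (w : W) : P.prX w + P.prY w = w :=
  Submodule.projection_add_projection_eq_self P.compl w

/-- The action of `a ∈ Fˣ` on `W`: `a(x + y) = a x + a⁻¹ y` for `x ∈ X`, `y ∈ Y`. -/
def scale (a : Fˣ) (w : W) : W := (a : F) • P.prX w + (a : F)⁻¹ • P.prY w

lemma prX_scale (a : Fˣ) (w : W) : P.prX (P.scale a w) = (a : F) • P.prX w := by
  simp [scale, P.prX_of_mem (P.prX_mem w), P.prX_of_mem_Y (P.prY_mem w)]

lemma prY_scale (a : Fˣ) (w : W) : P.prY (P.scale a w) = (a : F)⁻¹ • P.prY w := by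
  simp [scale, P.prY_of_mem (P.prY_mem w), P.prY_of_mem_X (P.prX_mem w)]

lemma scale_one (w : W) : P.scale 1 w = w := by
  simp [scale, P.prX_add_prY]

lemma scale_scale (a b : Fˣ) (w : W) : P.scale a (P.scale b w) = P.scale (a * b) w := by
  rw [scale, prX_scale, prY_scale, scale, smul_smul, smul_smul]
  simp [mul_comm]

/-- The set `W_{Fˣ} = (X \ {0}) ⊕ (Y \ {0})`. -/
def punctured : Set W := {w | P.prX w ≠ 0 ∧ P.prY w ≠ 0}

lemma scale_mem_punctured (a : Fˣ) {w : W} (h : w ∈ P.punctured) : P.scale a w ∈ P.punctured := by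
  refine ⟨?_, ?_⟩
  · rw [prX_scale]; exact smul_ne_zero a.ne_zero h.1
  · rw [prY_scale]; exact smul_ne_zero (inv_ne_zero a.ne_zero) h.2

/-- The orbit relation of `Fˣ` on `W_{Fˣ}`. -/
def orbitSetoid : Setoid P.punctured where
  r w w' := ∃ a : Fˣ, P.scale a w = w'
  iseqv :=
    { refl := fun w => ⟨1, P.scale_one w⟩
      symm := by
        rintro w w' ⟨a, ha⟩
        exact ⟨a⁻¹, by rw [← ha, scale_scale, inv_mul_cancel, scale_one]⟩
      trans := by
        rintro w w' w'' ⟨a, ha⟩ ⟨b, hb⟩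
        exact ⟨b * a, by rw [← hb, ← ha, scale_scale]⟩ }

/-- The orbit space `Fˣ \ W_{Fˣ}`; as a quotient it carries the σ-algebra of the sets with
measurable preimage in `W_{Fˣ}`. -/
def OrbitSpace : Type _ := Quotient P.orbitSetoid

instance [MeasurableSpace W] : MeasurableSpace P.OrbitSpace :=
  MeasurableSpace.map (Quotient.mk P.orbitSetoid) Subtype.instMeasurableSpace

/-- The orbit `Fˣ w` of `w ∈ W_{Fˣ}`. -/
def orbit (w : P.punctured) : P.OrbitSpace := Quotient.mk P.orbitSetoid w

/-- The extension of `z ∈ End(X)` by zero on `Y`. -/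
def inflate (z : P.X →ₗ[F] P.X) : W →ₗ[F] W :=
  P.X.subtype ∘ₗ z ∘ₗ P.X.projectionOnto P.Y P.compl

lemma inflate_mem (z : P.X →ₗ[F] P.X) (w : W) : P.inflate z w ∈ P.X := (z _).2

lemma inflate_eq_inflate_prX (z : P.X →ₗ[F] P.X) (w : W) :
    P.inflate z w = P.inflate z (P.prX w) := by
  have : P.X.projectionOnto P.Y P.compl (P.prX w) = P.X.projectionOnto P.Y P.compl w :=
    Submodule.projectionOnto_projection _ _
  simp [inflate, this]

lemma form_neg (w w' : W) : P.form w w' = - P.form w' w := (P.alt.neg_eq w' w).symm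

variable [FiniteDimensional F W]

/-- The element of `sp(W)` by which `z ∈ End(X)` acts on `W`. It preserves `X` and `Y`, and it is
`z` on `X` and minus the transpose of `z` on `Y`; see `toSp_skew`, `toSp_of_mem_X` and
`toSp_mem_Y`. -/
def toSp (z : P.X →ₗ[F] P.X) : W →ₗ[F] W :=
  P.inflate z - P.form.leftAdjointOfNondegenerate P.nondeg (P.inflate z)

lemma form_adjoint (z : P.X →ₗ[F] P.X) (w w' : W) :
    P.form (P.form.leftAdjointOfNondegenerate P.nondeg (P.inflate z) w) w' =
      P.form w (P.inflate z w') :=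
  LinearMap.BilinForm.isAdjointPairLeftAdjointOfNondegenerate P.form P.nondeg (P.inflate z) w w'

lemma form_toSp (z : P.X →ₗ[F] P.X) (w w' : W) :
    P.form (P.toSp z w) w' = P.form (P.inflate z w) w' - P.form w (P.inflate z w') := by
  simp [toSp, P.form_adjoint]

lemma toSp_skew (z : P.X →ₗ[F] P.X) (w w' : W) :
    P.form (P.toSp z w) w' + P.form w (P.toSp z w') = 0 := by
  rw [P.form_neg w (P.toSp z w'), P.form_toSp, P.form_toSp, P.form_neg w (P.inflate z w'),
    P.form_neg w' (P.inflate z w)]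
  ring

lemma toSp_of_mem_X (z : P.X →ₗ[F] P.X) (x : P.X) : P.toSp z x = z x := by
  have h1 : P.inflate z x = z x := by simp [inflate]
  have h2 : P.form.leftAdjointOfNondegenerate P.nondeg (P.inflate z) x = 0 := by
    refine P.nondeg.1 _ fun w => ?_
    rw [P.form_adjoint]
    exact P.isotropic_X _ x.2 _ (P.inflate_mem z w)
  rw [toSp, LinearMap.sub_apply, h1, h2, sub_zero]

lemma toSp_mem_Y (z : P.X →ₗ[F] P.X) {y : W} (hy : y ∈ P.Y) : P.toSp z y ∈ P.Y := by
  have hY : ∀ y' ∈ P.Y, P.form (P.prX (P.toSp z y)) y' = 0 := by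
    intro y' hy'
    have h0 : ∀ v ∈ P.Y, P.inflate z v = 0 := fun v hv => by
      rw [P.inflate_eq_inflate_prX, P.prX_of_mem_Y hv, map_zero]
    have h1 : P.form (P.toSp z y) y' = 0 := by
      rw [P.form_toSp, h0 y hy, h0 y' hy']; simp
    rw [← P.prX_add_prY (P.toSp z y), map_add, LinearMap.add_apply,
      P.isotropic_Y _ (P.prY_mem _) _ hy', add_zero] at h1
    exact h1
  have h0 : P.prX (P.toSp z y) = 0 := by
    refine P.nondeg.1 _ fun w => ?_
    rw [← P.prX_add_prY w, map_add, P.isotropic_X _ (P.prX_mem _) _ (P.prX_mem _),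
      hY _ (P.prY_mem w), add_zero]
  exact (Submodule.projection_apply_eq_zero_iff P.compl).1 h0

/-- The quadratic form `w ↦ ⟨z w, w⟩` attached to `z ∈ End(X)`. -/
def quad (z : P.X →ₗ[F] P.X) (w : W) : F := P.form (P.toSp z w) w

lemma quad_eq (z : P.X →ₗ[F] P.X) (w : W) :
    P.quad z w = 2 * P.form (P.inflate z (P.prX w)) (P.prY w) := by
  have h : P.form (P.inflate z w) w = P.form (P.inflate z (P.prX w)) (P.prY w) := by
    have h' : ∀ u, P.form u w = P.form u (P.prX w) + P.form u (P.prY w) := fun u => by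
      rw [← map_add, P.prX_add_prY]
    rw [P.inflate_eq_inflate_prX, h', P.isotropic_X _ (P.inflate_mem z _) _ (P.prX_mem w), zero_add]
  rw [quad, P.form_toSp, P.form_neg w, h]
  ring

lemma quad_scale (z : P.X →ₗ[F] P.X) (a : Fˣ) (w : W) : P.quad z (P.scale a w) = P.quad z w := by
  rw [quad_eq, quad_eq, prX_scale, prY_scale]
  simp

end Algebra

section Analysis

variable {F W : Type*} [NontriviallyNormedField F] [NormedAddCommGroup W] [NormedSpace F W]
  (P : PolarizedSymplectic F W)

/-- `m` is the measure `d(Fˣ w)` on `Fˣ \ W_{Fˣ}`, that is, for all Schwartz-Bruhat `φ` on `W`,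
`∫_{W_{Fˣ}} φ(w) dw = ∫_{Fˣ \ W_{Fˣ}} ∫_{Fˣ} φ(a(w)) da/|a| d(Fˣ w)`, with absolutely convergent
integrals. Here `Φ` is the inner integral as a function on the orbit space. -/
def IsOrbitSpaceMeasure [LocallyCompactSpace F] [MeasurableSpace F] [MeasurableSpace W]
    (da : Measure F) (dw : Measure W) (m : Measure P.OrbitSpace) : Prop :=
  ∀ φ : SchwartzBruhat W, ∃ Φ : P.OrbitSpace → ℂ,
    (∀ w : P.punctured,
      Integrable (fun a : Fˣ => (φ : W → ℂ) (P.scale a w)) (multMeasure da) ∧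
      Φ (P.orbit w) = ∫ a : Fˣ, (φ : W → ℂ) (P.scale a w) ∂(multMeasure da)) ∧
    Integrable Φ m ∧
    ∫ w in P.punctured, (φ : W → ℂ) w ∂dw = ∫ q, Φ q ∂m

variable [FiniteDimensional F W]

/-- The inner integrand `z ↦ χ(⟨z w, w⟩) ψ(z)` on `End(X)`. -/
def chcIntegrand (χ : AddChar F Circle) (ψ : SchwartzBruhat (P.X →L[F] P.X)) (w : W)
    (z : P.X →L[F] P.X) : ℂ :=
  (χ (P.quad (z : P.X →ₗ[F] P.X) w) : ℂ) * (ψ : (P.X →L[F] P.X) → ℂ) z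

/-- The inner integral `∫_{End(X)} χ(⟨z w, w⟩) ψ(z) dz` as a function of the orbit `Fˣ w`. -/
def chcInner (χ : AddChar F Circle) (dz : Measure (P.X →L[F] P.X))
    (ψ : SchwartzBruhat (P.X →L[F] P.X)) : P.OrbitSpace → ℂ :=
  Quotient.lift (fun w : P.punctured => ∫ z, P.chcIntegrand χ ψ w z ∂dz) (by
    rintro w w' ⟨a, ha⟩
    simp only [chcIntegrand, ← ha, quad_scale])

/-- The iterated integral
`∫_{Fˣ \ W_{Fˣ}} ∫_{End(X)} χ(⟨z w, w⟩) ψ(z) dz d(Fˣ w)`. -/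
def chc [MeasurableSpace W] (χ : AddChar F Circle) (dz : Measure (P.X →L[F] P.X)) (m : Measure P.OrbitSpace)
    (ψ : SchwartzBruhat (P.X →L[F] P.X)) : ℂ :=
  ∫ q, P.chcInner χ dz ψ q ∂m

/-- `L` is a lattice in `W` (a compact open subgroup stable under the ring of integers
`{a | ‖a‖ ≤ 1}`) that is self-dual with respect to the symplectic form. -/
structure IsSelfDualLattice (L : AddSubgroup W) : Prop where
  isCompact : IsCompact (L : Set W)
  isOpen : IsOpen (L : Set W)
  smul_mem : ∀ a : F, ‖a‖ ≤ 1 → ∀ w ∈ L, a • w ∈ L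
  self_dual : ∀ w : W, (∀ w' ∈ L, ‖P.form w w'‖ ≤ 1) ↔ w ∈ L

/-- The endomorphisms of `X` whose action on `W` preserves `L`. -/
def endLattice (L : AddSubgroup W) : Set (P.X →L[F] P.X) :=
  {z | ∀ w ∈ L, P.toSp (z : P.X →ₗ[F] P.X) w ∈ L}

end Analysis

end PolarizedSymplectic

end

set_option linter.unusedSectionVars false

noncomputable section

/-! ### Totally disconnected locally compact spaces -/

section TotallyDisconnected

variable {V : Type*} [TopologicalSpace V] [T2Space V] [LocallyCompactSpace V]
  [TotallyDisconnectedSpace V]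

/-! Write n = dim X and B(x, y) = 2⟨x, y⟩, a perfect pairing of X and Y because the characteristic
is 0. For w = x + y one has ⟨zw, w⟩ = B(zx, y) = -tr(zR), where R = R(x, y) is the endomorphism v ↦
-B(v, y)x. So the inner integral of chc is ψ̂(R(x, y)). As R is constant on the orbits of Fˣ, chc(ψ)
is the integral of ψ̂ against the image M₁ of d(Fˣw) under R (`chcInner_orbit`,
`chc_sectionMeasure`).

To describe M₁, split X as F × X'. Almost every orbit meets the section (1, x') + y exactly once.
The scaling (x', y) ↦ (ax', a⁻¹y) has module |a|^(n-1)|a|^(-n) = |a|⁻¹, so dw unfolds into da/|a|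
along the orbits and dx' dy across them (`exists_map_chartMap_eq`), and M₁ is the image of dx' dy.
With a weight ρ on X whose integral over each orbit is one, integration of G against M₁ becomes ∫
ρ(x) G(R(x, y)) dw (`lintegral_weight_mul`), where no chart appears. This formula shows that M₁ is
finite on compact sets, since ‖x‖‖y‖ is at most a multiple of ‖R(x, y)‖, and that M₁ satisfies (*)
for k = 1, since g⁻¹R(x, y)h = R(g⁻¹x, hᵗy).

The Fourier transform of M₁ is computed for each x' separately. The phase B(z(1, x'), y) sees only u
= z(1, x'), so y ↦ ψ̂(R((1, x'), y)) is the Fourier transform of a partial integral of ψ, as a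
function of u. Fourier inversion at 0 (`exists_integral_pairFourier`) turns its integral over y into
the integral of ψ over the z that kill (1, x'). Letting x' vary gives a positive measure M₂, carried
by corank one because almost all linear maps X' → X are injective (`exists_corankMeasure`). Its
transformation rule follows from that of M₁ by Fourier transform.

Uniqueness holds because O_k is one orbit of GL(X) × GL(X): the Radon-Nikodym derivative of two
measures with the same factor is invariant, hence constant (`exists_smul_eq_of_transitive`). If n =
2, this makes M₂ a multiple of M₁. For a lattice adapted to the polarization, the indicator function
of the endomorphisms preserving it is its own Fourier transform, and the multiple is 1
(`endFourier_indicator`). -/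

lemma isTopologicalBasis_isCompact_isOpen :
    TopologicalSpace.IsTopologicalBasis {s : Set V | IsCompact s ∧ IsOpen s} := by
  refine TopologicalSpace.isTopologicalBasis_of_isOpen_of_nhds (fun u hu => hu.2)
    fun x U hx hU => ?_
  obtain ⟨s, hs, hxs, hsU⟩ := exists_compact_subset hU hx
  obtain ⟨v, hv, hxv, hvs⟩ := loc_compact_Haus_tot_disc_of_zero_dim.exists_subset_of_mem_open
    hxs isOpen_interior
  exact ⟨v, ⟨hs.of_isClosed_subset hv.1 (hvs.trans interior_subset), hv.2⟩, hxv,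
    hvs.trans (interior_subset.trans hsU)⟩

/-- Two measures that are finite and equal on compact open sets are equal. -/
lemma MeasureTheory.Measure.ext_of_isCompact_isOpen [SecondCountableTopology V]
    [MeasurableSpace V] [BorelSpace V] {μ ν : Measure V}
    (hfin : ∀ K, IsCompact K → IsOpen K → μ K ≠ ∞)
    (h : ∀ K, IsCompact K → IsOpen K → μ K = ν K) : μ = ν := by
  have hb := isTopologicalBasis_isCompact_isOpen (V := V)
  -- Compact open sets form a π-system generating the Borel sets. By the Lindelöf property countably
  -- many of them, each of finite measure, cover the space.
  obtain ⟨T, hT, hTc, hTU⟩ := TopologicalSpace.isOpen_sUnion_countable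
    {s : Set V | IsCompact s ∧ IsOpen s} (fun s hs => hs.2)
  refine Measure.ext_of_generateFrom_of_cover_subset (S := {s : Set V | IsCompact s ∧ IsOpen s})
    (T := T) ?_ ?_ hTc hT ?_ (fun s hs => hfin s (hTc hs).1 (hTc hs).2)
    (fun s hs => h s hs.1 hs.2)
  · rw [BorelSpace.measurable_eq (α := V)]
    exact hb.borel_eq_generateFrom
  · rintro s hs t ht -
    exact ⟨hs.1.inter ht.1, hs.2.inter ht.2⟩
  · rw [hTU, hb.sUnion_eq]

end TotallyDisconnected

/-- The indicator function of a compact open set as a Schwartz-Bruhat function. -/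
def SchwartzBruhat.indicator {V : Type*} [TopologicalSpace V] [T2Space V] {K : Set V}
    (hK : IsCompact K) (hK' : IsOpen K) : SchwartzBruhat V :=
  ⟨K.indicator 1, by
    have := (LocallyConstant.charFn ℂ (U := K) ⟨hK.isClosed, hK'⟩).isLocallyConstant
    exact this,
   HasCompactSupport.intro hK fun x hx => by simp [hx]⟩

lemma SchwartzBruhat.integrable {V : Type*} [TopologicalSpace V] [MeasurableSpace V]
    [OpensMeasurableSpace V] {μ : Measure V} [IsFiniteMeasureOnCompacts μ]
    (ψ : SchwartzBruhat V) : Integrable (ψ : V → ℂ) μ :=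
  ψ.2.1.continuous.integrable_of_hasCompactSupport ψ.2.2

/-- Measures that are finite on compact sets and have the same integrals of Schwartz-Bruhat
functions are equal. -/
lemma MeasureTheory.Measure.ext_of_integral_schwartzBruhat {V : Type*} [TopologicalSpace V]
    [T2Space V] [LocallyCompactSpace V] [TotallyDisconnectedSpace V] [SecondCountableTopology V]
    [MeasurableSpace V] [BorelSpace V] {μ ν : Measure V} [IsFiniteMeasureOnCompacts μ]
    [IsFiniteMeasureOnCompacts ν]
    (h : ∀ ψ : SchwartzBruhat V, ∫ x, (ψ : V → ℂ) x ∂μ = ∫ x, (ψ : V → ℂ) x ∂ν) : μ = ν := by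
  refine Measure.ext_of_isCompact_isOpen (fun K hK _ => hK.measure_lt_top.ne) fun K hK hK' => ?_
  have h1 := h (SchwartzBruhat.indicator hK hK')
  have h2 : ∀ μ : Measure V,
      ∫ x, (SchwartzBruhat.indicator hK hK' : V → ℂ) x ∂μ = (μ.real K : ℂ) := fun μ => by
    have := integral_indicator_one (μ := μ) hK.measurableSet
    rw [← this, ← integral_complex_ofReal]
    congr 1
    ext x
    by_cases hx : x ∈ K <;> simp [SchwartzBruhat.indicator, hx]
  rw [h2, h2] at h1
  exact (measureReal_eq_measureReal_iff hK.measure_lt_top.ne hK.measure_lt_top.ne).1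
    (by exact_mod_cast h1)

/-! ### The module of a local field -/

section Modulus

variable {F : Type*} [NontriviallyNormedField F] [ProperSpace F]

lemma modulus_units (a : Fˣ) : modulus (a : F) = distribHaarChar F a := by
  simp [modulus]

lemma modulus_ne_zero {a : F} (ha : a ≠ 0) : modulus a ≠ 0 := by
  rw [← Units.val_mk0 ha, modulus_units]
  exact distribHaarChar_pos.ne'

lemma modulus_mul (a b : F) : modulus (a * b) = modulus a * modulus b := by
  by_cases ha : a = 0
  · simp [modulus, ha]
  by_cases hb : b = 0
  · simp [modulus, hb]
  rw [← Units.val_mk0 ha, ← Units.val_mk0 hb, ← Units.val_mul, modulus_units, modulus_units,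
    modulus_units, map_mul]

lemma modulus_one : modulus (1 : F) = 1 := by
  rw [← Units.val_one, modulus_units, map_one]

lemma modulus_inv (a : F) : modulus a⁻¹ = (modulus a)⁻¹ := by
  by_cases ha : a = 0
  · simp [modulus, ha]
  refine eq_inv_of_mul_eq_one_left ?_
  rw [← modulus_mul, inv_mul_cancel₀ ha, modulus_one]

/-- The module as a monoid homomorphism. -/
def modulusHom : F →* ℝ≥0 where
  toFun := modulus
  map_one' := modulus_one
  map_mul' := modulus_mul

lemma modulus_pow (a : F) (k : ℕ) : modulus (a ^ k) = modulus a ^ k :=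
  map_pow modulusHom a k

lemma modulus_prod {ι : Type*} (s : Finset ι) (a : ι → F) :
    modulus (∏ i ∈ s, a i) = ∏ i ∈ s, modulus (a i) :=
  map_prod modulusHom a s

variable [MeasurableSpace F] [BorelSpace F] (da : Measure F) [da.IsAddHaarMeasure]

lemma measure_smul_set (a : Fˣ) (s : Set F) :
    da ((fun x => (a : F) * x) '' s) = modulus (a : F) * da s := by
  rw [modulus_units, distribHaarChar_mul]
  rfl

lemma measure_preimage_mul {a : F} (ha : a ≠ 0) (s : Set F) :
    da ((fun x => a * x) ⁻¹' s) = ((modulus a)⁻¹ : ℝ≥0) * da s := by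
  have h := measure_smul_set da (Units.mk0 a ha)⁻¹ s
  have h2 : (fun x => (((Units.mk0 a ha)⁻¹ : Fˣ) : F) * x) '' s = (fun x => a * x) ⁻¹' s := by
    ext x
    simp only [Set.mem_image, Set.mem_preimage, Units.val_inv_eq_inv_val, Units.val_mk0]
    constructor
    · rintro ⟨y, hy, rfl⟩
      rwa [mul_inv_cancel_left₀ ha]
    · intro hx
      exact ⟨_, hx, by rw [inv_mul_cancel_left₀ ha]⟩
  rw [h2] at h
  rw [h, Units.val_inv_eq_inv_val, Units.val_mk0, modulus_inv]

/-- The norm of F need not be the normalized absolute value. It is compared with the module through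
the fact that multiplication by a carries the unit ball onto the ball of radius ‖a‖. -/
lemma modulus_mul_measure_closedBall {a : F} (ha : a ≠ 0) :
    modulus a * da (Metric.closedBall 0 1) = da (Metric.closedBall 0 ‖a‖) := by
  have h := measure_smul_set da (Units.mk0 a ha) (Metric.closedBall 0 1)
  rw [Units.val_mk0] at h
  rw [← h]
  congr 1
  ext x
  simp only [Set.mem_image, mem_closedBall_zero_iff]
  constructor
  · rintro ⟨y, hy, rfl⟩
    rw [norm_mul]
    exact mul_le_of_le_one_right (norm_nonneg _) hy
  · intro hx
    refine ⟨a⁻¹ * x, ?_, by rw [mul_inv_cancel_left₀ ha]⟩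
    rw [norm_mul, norm_inv, inv_mul_le_iff₀ (norm_pos_iff.2 ha), mul_one]
    exact hx

/-- The module is a monotone function of the norm. -/
lemma exists_monotone_modulus : ∃ f : ℝ → ℝ≥0, Monotone f ∧ ∀ a : F, a ≠ 0 →
    modulus a = f ‖a‖ := by
  let da : Measure F := Measure.addHaar
  have h0 : da (Metric.closedBall 0 1) ≠ 0 :=
    (Metric.measure_closedBall_pos da 0 one_pos).ne'
  have h1 : ∀ r, da (Metric.closedBall 0 r) ≠ ∞ := fun r => measure_closedBall_lt_top.ne
  refine ⟨fun r => (da (Metric.closedBall 0 r)).toNNReal / (da (Metric.closedBall 0 1)).toNNReal,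
    fun r s hrs => ?_, fun a ha => ?_⟩
  · simp only
    gcongr
    · exact h1 s
  · beta_reduce
    rw [← modulus_mul_measure_closedBall da ha, ENNReal.toNNReal_mul, ENNReal.toNNReal_coe,
      mul_div_cancel_right₀]
    exact (ENNReal.toNNReal_ne_zero).2 ⟨h0, h1 1⟩

/-- A monotone function of the norm is measurable, and the σ-algebra of Fˣ is the one pulled back
from F. -/
lemma measurable_modulus_units : Measurable fun a : Fˣ => modulus (a : F) := by
  obtain ⟨f, hf, h⟩ := exists_monotone_modulus (F := F)
  have : (fun a : Fˣ => modulus (a : F)) = fun a : Fˣ => f ‖(a : F)‖ :=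
    funext fun a => h _ a.ne_zero
  rw [this]
  exact hf.measurable.comp (comap_measurable (Units.val : Fˣ → F)).norm

/-! ### Scaling of Haar measure by linear maps -/

open Matrix in
lemma map_diagonal_pi {ι : Type*} [Fintype ι] [DecidableEq ι] {D : ι → F}
    (h : det (diagonal D) ≠ 0) :
    (Measure.pi fun _ : ι => da).map (toLin' (diagonal D)) =
      (modulus (det (diagonal D)))⁻¹ • Measure.pi fun _ : ι => da := by
  have h' : ∀ i, D i ≠ 0 := fun i => by
    rw [det_diagonal] at h
    exact Finset.prod_ne_zero_iff.1 h i (Finset.mem_univ i)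
  rw [← smul_right_injective _ (modulus_ne_zero h) |>.eq_iff]
  simp only [smul_inv_smul₀ (modulus_ne_zero h)]
  refine (Measure.pi_eq fun s hs => ?_).symm
  simp only [det_diagonal, Measure.smul_apply]
  rw [Measure.map_apply _ (MeasurableSet.univ_pi hs)]
  swap; · exact Continuous.measurable (LinearMap.continuous_on_pi _)
  have : (Matrix.toLin' (diagonal D) ⁻¹' Set.pi Set.univ fun i : ι => s i) =
      Set.pi Set.univ fun i : ι => (D i * ·) ⁻¹' s i := by
    ext f
    simp [mulVec_diagonal]
  rw [this, Measure.pi_pi, modulus_prod, ENNReal.smul_def, smul_eq_mul, ENNReal.ofNNReal_finsetProd,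
    ← Finset.prod_mul_distrib]
  refine Finset.prod_congr rfl fun i _ => ?_
  rw [measure_preimage_mul da (h' i), ← mul_assoc, ← ENNReal.coe_mul,
    mul_inv_cancel₀ (modulus_ne_zero (h' i)), ENNReal.coe_one, one_mul]

open Matrix in
-- With the other coordinates fixed, a transvection translates the single coordinate t.i, so already
-- the integral over that coordinate is unchanged.
lemma map_transvectionStruct_pi {ι : Type*} [Fintype ι] [DecidableEq ι]
    (t : TransvectionStruct ι F) :
    (Measure.pi fun _ : ι => da).map (toLin' t.toMatrix) = Measure.pi fun _ : ι => da := by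
  have ht : Measurable (toLin' t.toMatrix) :=
    (toLin' t.toMatrix).continuous_of_finiteDimensional.measurable
  refine (Measure.pi_eq fun s hs ↦ ?_).symm
  have h2s : MeasurableSet (Set.univ.pi s) := .pi Set.countable_univ fun i _ ↦ hs i
  simp_rw [← Measure.pi_pi, ← lintegral_indicator_one h2s]
  rw [lintegral_map (measurable_one.indicator h2s) ht]
  refine lintegral_eq_of_lmarginal_eq {t.i} ((measurable_one.indicator h2s).comp ht)
    (measurable_one.indicator h2s) ?_
  simp_rw [lmarginal_singleton]
  ext x
  cases t with | mk t_i t_j t_hij t_c =>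
  simp [transvection, single_mulVec, t_hij.symm, ← Function.update_add,
    lintegral_add_right_eq_self fun xᵢ ↦ Set.indicator (Set.univ.pi s) 1 (Function.update x t_i xᵢ)]

open Matrix in
-- Diagonal matrices and transvections generate the invertible matrices, and both sides are
-- compatible with products.
lemma map_matrix_pi {ι : Type*} [Fintype ι] [DecidableEq ι] {M : Matrix ι ι F} (hM : det M ≠ 0) :
    (Measure.pi fun _ : ι => da).map (toLin' M) =
      (modulus (det M))⁻¹ • Measure.pi fun _ : ι => da := by
  apply diagonal_transvection_induction_of_det_ne_zero _ M hM
  · intro D hD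
    exact map_diagonal_pi da hD
  · intro t
    rw [TransvectionStruct.det, modulus_one, inv_one, one_smul, map_transvectionStruct_pi]
  · intro A B _ _ IHA IHB
    rw [toLin'_mul, det_mul, LinearMap.coe_comp, ← Measure.map_map, IHB, Measure.map_smul, IHA,
      smul_smul, modulus_mul, mul_inv, mul_comm]
    · exact (LinearMap.continuous_on_pi _).measurable
    · exact (LinearMap.continuous_on_pi _).measurable

variable {V : Type*} [NormedAddCommGroup V] [NormedSpace F V] [FiniteDimensional F V]
  [MeasurableSpace V] [BorelSpace V] (μ : Measure V) [μ.IsAddHaarMeasure]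

include da in
lemma map_linearMap_addHaar_aux {A : V →ₗ[F] V} (hA : LinearMap.det A ≠ 0) :
    μ.map A = (modulus (LinearMap.det A))⁻¹ • μ := by
  have := FiniteDimensional.proper F V
  let b := Module.finBasis F V
  let e : V ≃L[F] (Fin (finrank F V) → F) := b.equivFun.toContinuousLinearEquiv
  let ν : Measure (Fin (finrank F V) → F) := Measure.pi fun _ => da
  have : (ν.map e.symm).IsAddHaarMeasure := e.symm.isAddHaarMeasure_map ν
  obtain ⟨c, -, -, hc⟩ : ∃ c : ℝ≥0∞, c ≠ 0 ∧ c ≠ ∞ ∧ μ = c • ν.map e.symm :=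
    ⟨_, by simpa using (Measure.addHaarScalarFactor_pos_of_isAddHaarMeasure μ (ν.map e.symm)).ne',
      ENNReal.coe_ne_top, Measure.isAddLeftInvariant_eq_smul μ (ν.map e.symm)⟩
  have hdet : LinearMap.det A = Matrix.det (LinearMap.toMatrix b b A) :=
    (LinearMap.det_toMatrix b A).symm
  have key : (A : V → V) ∘ e.symm = e.symm ∘ Matrix.toLin' (LinearMap.toMatrix b b A) := by
    ext x
    have : b.equivFun (A (b.equivFun.symm x)) = Matrix.toLin' (LinearMap.toMatrix b b A) x := by
      rw [Matrix.toLin'_apply]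
      have := LinearMap.toMatrix_mulVec_repr b b A (b.equivFun.symm x)
      rw [← Basis.equivFun_apply, ← Basis.equivFun_apply] at this
      rw [← this, LinearEquiv.apply_symm_apply]
    simp only [Function.comp_apply]
    rw [← this]
    exact (b.equivFun.symm_apply_apply _).symm
  have hAm : Measurable A := A.continuous_of_finiteDimensional.measurable
  rw [hc, Measure.map_smul, Measure.map_map hAm e.symm.continuous.measurable, key,
    ← Measure.map_map e.symm.continuous.measurable (LinearMap.continuous_on_pi _).measurable,
    map_matrix_pi da (by rwa [← hdet]), Measure.map_smul, ← hdet, smul_comm]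

/-- An invertible linear map scales Haar measure by the module of its determinant. -/
lemma map_linearMap_addHaar {F : Type*} [NontriviallyNormedField F] [ProperSpace F]
    {V : Type*} [NormedAddCommGroup V] [NormedSpace F V] [FiniteDimensional F V]
    [MeasurableSpace V] [BorelSpace V] (μ : Measure V) [μ.IsAddHaarMeasure]
    {A : V →ₗ[F] V} (hA : LinearMap.det A ≠ 0) :
    μ.map A = (modulus (LinearMap.det A))⁻¹ • μ := by
  borelize F
  exact map_linearMap_addHaar_aux Measure.addHaar μ hA

/-- Haar measures on a locally compact second countable group are multiples of each other. -/
lemma exists_eq_smul_addHaar {V : Type*} [AddGroup V] [TopologicalSpace V]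
    [IsTopologicalAddGroup V] [LocallyCompactSpace V] [SecondCountableTopology V]
    [MeasurableSpace V] [BorelSpace V] (μ ν : Measure V)
    [μ.IsAddHaarMeasure] [ν.IsAddHaarMeasure] : ∃ c : ℝ≥0, c ≠ 0 ∧ μ = c • ν :=
  ⟨_, (Measure.addHaarScalarFactor_pos_of_isAddHaarMeasure μ ν).ne',
    Measure.isAddLeftInvariant_eq_smul μ ν⟩

lemma map_smul_addHaar {F : Type*} [NontriviallyNormedField F] [ProperSpace F]
    {V : Type*} [NormedAddCommGroup V] [NormedSpace F V] [FiniteDimensional F V]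
    [MeasurableSpace V] [BorelSpace V] (μ : Measure V) [μ.IsAddHaarMeasure]
    {a : F} (ha : a ≠ 0) :
    μ.map (fun v => a • v) = (modulus a ^ finrank F V)⁻¹ • μ := by
  have h : LinearMap.det (a • (LinearMap.id : V →ₗ[F] V)) = a ^ finrank F V := by
    rw [LinearMap.det_smul, LinearMap.det_id, mul_one]
  have := map_linearMap_addHaar μ (A := a • (LinearMap.id : V →ₗ[F] V))
    (by rw [h]; exact pow_ne_zero _ ha)
  rw [h, modulus_pow] at this
  exact this

lemma totallyDisconnectedSpace_of_finiteDimensional (F V : Type*) [NontriviallyNormedField F]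
    [CompleteSpace F] [IsUltrametricDist F] [NormedAddCommGroup V] [NormedSpace F V]
    [FiniteDimensional F V] : TotallyDisconnectedSpace V := by
  let e : V ≃L[F] (Fin (finrank F V) → F) :=
    (Module.finBasis F V).equivFun.toContinuousLinearEquiv
  exact e.toHomeomorph.isEmbedding.isTotallyDisconnected_range.1
    (isTotallyDisconnected_of_totallyDisconnectedSpace _)

/-- A set that meets every line in a given direction in a countable set is a null set. -/
lemma measure_eq_zero_of_countable_lines {F : Type*} [NontriviallyNormedField F] [ProperSpace F]
    {V : Type*} [NormedAddCommGroup V] [NormedSpace F V] [FiniteDimensional F V]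
    [MeasurableSpace V] [BorelSpace V] (μ : Measure V) [μ.IsAddHaarMeasure]
    {N : Set V} (hN : MeasurableSet N) (v : V) (h : ∀ w, {t : F | w + t • v ∈ N}.Countable) :
    μ N = 0 := by
  borelize F
  have := FiniteDimensional.proper F V
  let da : Measure F := Measure.addHaar
  have hmeas : MeasurableSet {p : F × V | p.2 + p.1 • v ∈ N} :=
    (Continuous.measurable (f := fun p : F × V => p.2 + p.1 • v) (by fun_prop)) hN
  have h1 : (da.prod μ) {p : F × V | p.2 + p.1 • v ∈ N} = 0 := by
    -- Fubini in both orders: the slices at fixed w are countable, hence null, while the slices at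
    -- fixed t are translates of N and all have measure μ N.
    rw [Measure.prod_apply_symm hmeas]
    exact lintegral_eq_zero_of_ae_eq_zero (.of_forall fun w => (h w).measure_zero da)
  rw [Measure.measure_prod_null hmeas] at h1
  have h2 : ∀ t : F, μ (Prod.mk t ⁻¹' {p : F × V | p.2 + p.1 • v ∈ N}) = μ N := fun t =>
    measure_preimage_add_right μ (t • v) N
  simp only [h2] at h1
  obtain ⟨t, ht⟩ := h1.exists
  exact ht

end Modulus

/-! ### Local constancy -/

/-- The radius is a Lebesgue number for the cover of the compact support by the open fibres of ψ. A
point outside the support is either close to a point of the support, where the roles are exchanged,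
or both values vanish. -/
lemma SchwartzBruhat.exists_forall_add_eq {V : Type*} [NormedAddCommGroup V]
    (ψ : SchwartzBruhat V) :
    ∃ ε > 0, ∀ v w : V, ‖w‖ < ε → (ψ : V → ℂ) (v + w) = (ψ : V → ℂ) v := by
  obtain ⟨ε, hε, h⟩ := lebesgue_number_lemma_of_metric (c := fun z : ℂ => (ψ : V → ℂ) ⁻¹' {z})
    ψ.2.2.isCompact (fun z => ψ.2.1.isOpen_fiber z) (fun x _ => Set.mem_iUnion.2 ⟨_, rfl⟩)
  have key : ∀ x ∈ tsupport (ψ : V → ℂ), ∀ y, ‖y - x‖ < ε → (ψ : V → ℂ) y = (ψ : V → ℂ) x := by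
    intro x hx y hy
    obtain ⟨z, hz⟩ := h x hx
    have h1 : (ψ : V → ℂ) y = z := hz (by rwa [Metric.mem_ball, dist_eq_norm])
    have h2 : (ψ : V → ℂ) x = z := hz (Metric.mem_ball_self hε)
    rw [h1, h2]
  refine ⟨ε, hε, fun v w hw => ?_⟩
  by_cases hv : v ∈ tsupport (ψ : V → ℂ)
  · exact key v hv _ (by simpa using hw)
  by_cases hv' : v + w ∈ tsupport (ψ : V → ℂ)
  · exact (key _ hv' v (by simpa using hw)).symm
  · rw [image_eq_zero_of_notMem_tsupport hv, image_eq_zero_of_notMem_tsupport hv']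

end

noncomputable section

/-! ### The Fourier transform attached to a pairing -/

section Pairing

variable {F : Type*} [NontriviallyNormedField F] [ProperSpace F]
  {V V' : Type*} [NormedAddCommGroup V] [NormedSpace F V] [FiniteDimensional F V]
  [NormedAddCommGroup V'] [NormedSpace F V'] [FiniteDimensional F V']

/-- Coordinates in which a nondegenerate pairing is the standard one. -/
lemma exists_coordinates_of_pairing (B : V →ₗ[F] V' →ₗ[F] F)
    (hB : ∀ y, (∀ v, B v y = 0) → y = 0) (hd : finrank F V = finrank F V') :
    ∃ (e : V ≃L[F] (Fin (finrank F V) → F)) (e' : V' ≃L[F] (Fin (finrank F V) → F)),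
      ∀ v y, B v y = ∑ i, e v i * e' y i := by
  let b := Module.finBasis F V
  -- The coordinates of y are its pairings with the chosen basis of V; equality of dimensions makes
  -- this injective map an isomorphism.
  let f : V' →ₗ[F] (Fin (finrank F V) → F) := LinearMap.pi fun i => B (b i)
  have hf : Function.Injective f := by
    refine (injective_iff_map_eq_zero f).2 fun y hy => hB y fun v => ?_
    have : B.flip y = 0 := b.ext fun i => congrFun hy i
    exact LinearMap.congr_fun this v
  refine ⟨b.equivFun.toContinuousLinearEquiv,
    (f.linearEquivOfInjective hf (by simp [hd])).toContinuousLinearEquiv, fun v y => ?_⟩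
  conv_lhs => rw [← b.sum_equivFun v, map_sum, LinearMap.sum_apply]
  simp [f]

lemma continuous_pairing (B : V →ₗ[F] V' →ₗ[F] F) : Continuous fun p : V × V' => B p.1 p.2 := by
  let B' : V →L[F] V' →L[F] F :=
    LinearMap.toContinuousLinearMap (LinearMap.toContinuousLinearMap.toLinearMap ∘ₗ B)
  have : (fun p : V × V' => B p.1 p.2) = fun p : V × V' => B' p.1 p.2 := rfl
  rw [this]
  fun_prop

variable [MeasurableSpace V] [BorelSpace V] [MeasurableSpace V'] [BorelSpace V']

/-- The Fourier transform of a function on `V` with respect to a pairing `V × V' → F`. -/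
def pairFourier (χ : AddChar F Circle) (B : V →ₗ[F] V' →ₗ[F] F) (μ : Measure V) (ψ : V → ℂ)
    (y : V') : ℂ :=
  ∫ v, (χ (B v y) : ℂ) * ψ v ∂μ

lemma integrable_addChar_mul {α : Type*} [TopologicalSpace α] [MeasurableSpace α] [BorelSpace α]
    {χ : AddChar F Circle} (hχ : Continuous χ)
    {μ : Measure α} {ψ : α → ℂ} (hψ : Integrable ψ μ) {f : α → F} (hf : Continuous f) :
    Integrable (fun v => (χ (f v) : ℂ) * ψ v) μ := by
  refine hψ.bdd_mul (c := 1) ?_ (.of_forall fun v => (Circle.norm_coe _).le)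
  exact (continuous_subtype_val.comp (hχ.comp hf)).aestronglyMeasurable

lemma SchwartzBruhat.exists_scale (e : V ≃L[F] (Fin (finrank F V) → F)) (ψ : SchwartzBruhat V) :
    ∃ t : F, t ≠ 0 ∧ ∀ v w : V, ‖e w‖ ≤ ‖t‖ → (ψ : V → ℂ) (v + w) = (ψ : V → ℂ) v := by
  obtain ⟨ε, hε, h⟩ := SchwartzBruhat.exists_forall_add_eq ψ
  obtain ⟨δ, hδ, hδ'⟩ := Metric.continuousAt_iff.1 (e.symm.continuous.continuousAt (x := 0)) ε hε
  obtain ⟨t, ht0, ht⟩ := NormedField.exists_norm_lt F hδ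
  refine ⟨t, norm_pos_iff.1 ht0, fun v w hw => h v w ?_⟩
  have := hδ' (x := e w) (by simpa using hw.trans_lt ht)
  simpa using this

variable {χ : AddChar F Circle}
  (hχc : ∀ x : F, (∀ a : F, ‖a‖ ≤ 1 → χ (a * x) = 1) ↔ ‖x‖ ≤ 1)

include hχc in
lemma addChar_eq_one {x : F} (hx : ‖x‖ ≤ 1) : χ x = 1 := by
  have := (hχc x).2 hx 1 (by simp)
  rwa [one_mul] at this

variable {B : V →ₗ[F] V' →ₗ[F] F} (μ : Measure V) [μ.IsAddHaarMeasure]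
  {e : V ≃L[F] (Fin (finrank F V) → F)} {e' : V' ≃L[F] (Fin (finrank F V) → F)}
  (he : ∀ v y, B v y = ∑ i, e v i * e' y i)

include he in
lemma norm_pairing_le [IsUltrametricDist F] {v : V} {y : V'} {r : ℝ} (hr : 0 < r)
    (hv : ‖e v‖ ≤ r) (hy : ‖e' y‖ ≤ r⁻¹) : ‖B v y‖ ≤ 1 := by
  rw [he]
  refine IsUltrametricDist.norm_sum_le_of_forall_le_of_nonneg zero_le_one fun i _ => ?_
  rw [norm_mul]
  calc ‖e v i‖ * ‖e' y i‖ ≤ r * r⁻¹ :=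
        mul_le_mul ((norm_le_pi_norm _ i).trans hv) ((norm_le_pi_norm _ i).trans hy)
          (norm_nonneg _) hr.le
    _ = 1 := mul_inv_cancel₀ hr.ne'

include he in
lemma pairing_single_right (v : V) (i : Fin (finrank F V)) (s : F) :
    B v (e'.symm (Pi.single i s)) = e v i * s := by
  rw [he, Finset.sum_eq_single i]
  · simp
  · intro j _ hj; simp [hj]
  · simp

include he in
lemma pairing_single_left (y : V') (i : Fin (finrank F V)) (s : F) :
    B (e.symm (Pi.single i s)) y = s * e' y i := by
  rw [he, Finset.sum_eq_single i]
  · simp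
  · intro j _ hj; simp [hj]
  · simp

/-- Translation by the period v₀ pulls the value of the character out of the integral. Hence the
transform can be nonzero at y only if the character attached to y is trivial on all periods of ψ. -/
lemma integral_addChar_translate (ψ : V → ℂ) (v₀ : V) (y : V') (hψ : ∀ v, ψ (v + v₀) = ψ v) :
    pairFourier χ B μ ψ y = (χ (B v₀ y) : ℂ) * pairFourier χ B μ ψ y := by
  conv_lhs => rw [pairFourier, ← integral_add_right_eq_self _ v₀]
  rw [pairFourier, ← integral_const_mul]
  congr 1
  ext v
  rw [hψ, map_add, LinearMap.add_apply, AddChar.map_add_eq_mul, Circle.coe_mul]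
  ring

include he hχc in
-- If the transform did not vanish at y, the character of y would be trivial on the ball of periods
-- of radius ‖t‖. Testing it on the o-multiples of t times each coordinate vector, the conductor
-- condition would bound every coordinate of y by ‖t‖⁻¹.
lemma pairFourier_eq_zero {ψ : V → ℂ} {t : F} (ht : t ≠ 0)
    (hψ : ∀ v w : V, ‖e w‖ ≤ ‖t‖ → ψ (v + w) = ψ v) {y : V'} (hy : ‖t‖⁻¹ < ‖e' y‖) :
    pairFourier χ B μ ψ y = 0 := by
  by_contra h0
  have h1 : ∀ v₀, ‖e v₀‖ ≤ ‖t‖ → χ (B v₀ y) = 1 := by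
    intro v₀ hv₀
    have := integral_addChar_translate (χ := χ) (B := B) μ ψ v₀ y fun v => hψ v v₀ hv₀
    have h2 : (χ (B v₀ y) : ℂ) = 1 := by
      rwa [eq_comm, mul_eq_right₀ h0] at this
    exact Circle.ext (h2.trans Circle.coe_one.symm)
  refine hy.not_ge ((pi_norm_le_iff_of_nonneg (by positivity)).2 fun i => ?_)
  have h3 : ‖t * e' y i‖ ≤ 1 := by
    refine (hχc _).1 fun a ha => ?_
    rw [← mul_assoc, ← pairing_single_left he]
    refine h1 _ ?_
    rw [ContinuousLinearEquiv.apply_symm_apply, Pi.norm_single, norm_mul]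
    exact mul_le_of_le_one_left (norm_nonneg _) ha
  rw [norm_mul] at h3
  rwa [← one_div, le_div_iff₀' (norm_pos_iff.2 ht)]

include hχc he in
/-- The Fourier transform of a Schwartz-Bruhat function is a Schwartz-Bruhat function. -/
lemma pairFourier_mem (ψ : SchwartzBruhat V) :
    pairFourier χ B μ (ψ : V → ℂ) ∈ SchwartzBruhat V' := by
  have := FiniteDimensional.proper F V
  have := FiniteDimensional.proper F V'
  constructor
  · refine (IsLocallyConstant.iff_eventually_eq _).2 fun y => ?_
    -- Uniformly over the compact support of ψ, the pairing with y' - y is integral for y' near y,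
    -- so the integrands at y and y' coincide.
    have h1 : ∀ᶠ y' in nhds y, ∀ v ∈ tsupport (ψ : V → ℂ), ‖B v (y' - y)‖ ≤ 1 := by
      refine ψ.2.2.isCompact.eventually_forall_of_forall_eventually fun v _ => ?_
      have hc : Continuous fun p : V' × V => B p.2 (p.1 - y) :=
        (continuous_pairing B).comp (f := fun p : V' × V => (p.2, p.1 - y)) (by fun_prop)
      have h0 : Filter.Tendsto (fun p : V' × V => ‖B p.2 (p.1 - y)‖) (nhds (y, v)) (nhds 0) := by
        simpa using hc.norm.tendsto (y, v)
      exact h0.eventually_le_const one_pos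
    filter_upwards [h1] with y' hy'
    simp only [pairFourier]
    congr 1
    ext v
    by_cases hv : v ∈ tsupport (ψ : V → ℂ)
    · have : B v y' = B v (y' - y) + B v y := by rw [← map_add, sub_add_cancel]
      rw [this, AddChar.map_add_eq_mul, addChar_eq_one hχc (hy' v hv), one_mul]
    · rw [image_eq_zero_of_notMem_tsupport hv]; simp
  · obtain ⟨t, ht, h⟩ := SchwartzBruhat.exists_scale e ψ
    refine HasCompactSupport.intro (K := e' ⁻¹' Metric.closedBall 0 ‖t‖⁻¹)
      (e'.toHomeomorph.isCompact_preimage.2 (isCompact_closedBall _ _)) fun y hy => ?_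
    refine pairFourier_eq_zero hχc μ he ht h ?_
    simpa using hy

include hχc he in
-- Orthogonality of characters: the ball in V' is a compact group, on which the character of v is
-- trivial exactly when v lies in the dual ball. A nontrivial character integrates to zero, by
-- translation with an element y₀ where it is not 1.
lemma integral_addChar_closedBall [IsUltrametricDist F] (μ' : Measure V') [μ'.IsAddHaarMeasure]
    {t : F} (ht : t ≠ 0) (v : V) :
    ∫ y in e' ⁻¹' Metric.closedBall 0 ‖t‖⁻¹, (χ (B v y) : ℂ) ∂μ' =
      (e ⁻¹' Metric.closedBall 0 ‖t‖).indicator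
        (fun _ => (μ'.real (e' ⁻¹' Metric.closedBall 0 ‖t‖⁻¹) : ℂ)) v := by
  have ht' : 0 < ‖t‖ := norm_pos_iff.2 ht
  have hm : MeasurableSet (e' ⁻¹' Metric.closedBall 0 ‖t‖⁻¹) :=
    (Metric.isClosed_closedBall.preimage e'.continuous).measurableSet
  by_cases hv : ‖e v‖ ≤ ‖t‖
  · rw [Set.indicator_of_mem (by simpa using hv)]
    have : ∀ y ∈ e' ⁻¹' Metric.closedBall 0 ‖t‖⁻¹, (χ (B v y) : ℂ) = 1 := fun y hy => by
      rw [addChar_eq_one hχc (norm_pairing_le he ht' hv (by simpa using hy)), Circle.coe_one]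
    rw [setIntegral_congr_fun hm this]
    simp
  · rw [Set.indicator_of_notMem (by simpa using hv)]
    obtain ⟨i, hi⟩ : ∃ i, ‖t‖ < ‖e v i‖ := by
      by_contra! h
      exact hv ((pi_norm_le_iff_of_nonneg ht'.le).2 h)
    obtain ⟨a, ha, hχa⟩ : ∃ a : F, ‖a‖ ≤ 1 ∧ χ (a * (e v i * t⁻¹)) ≠ 1 := by
      by_contra! h
      have := (hχc _).1 h
      rw [norm_mul, norm_inv, ← div_eq_mul_inv, div_le_one ht'] at this
      exact this.not_gt hi
    set y₀ := e'.symm (Pi.single i (a * t⁻¹)) with hy₀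
    have hB : B v y₀ = a * (e v i * t⁻¹) := by
      rw [hy₀, pairing_single_right he]; ring
    have hy₀' : ‖e' y₀‖ ≤ ‖t‖⁻¹ := by
      rw [hy₀, ContinuousLinearEquiv.apply_symm_apply, Pi.norm_single, norm_mul, norm_inv]
      exact mul_le_of_le_one_left (by positivity) ha
    rw [← hB] at hχa
    rw [← integral_indicator hm]
    set g := (e' ⁻¹' Metric.closedBall 0 ‖t‖⁻¹).indicator fun y => (χ (B v y) : ℂ) with hg
    have hball : ∀ y, y + y₀ ∈ e' ⁻¹' Metric.closedBall 0 ‖t‖⁻¹ ↔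
        y ∈ e' ⁻¹' Metric.closedBall 0 ‖t‖⁻¹ := by
      have key : ∀ y z, ‖e' y‖ ≤ ‖t‖⁻¹ → ‖e' z‖ ≤ ‖t‖⁻¹ → ‖e' (y + z)‖ ≤ ‖t‖⁻¹ :=
        fun y z hy hz => by
          rw [map_add]
          exact (IsUltrametricDist.norm_add_le_max _ _).trans (max_le hy hz)
      intro y
      simp only [Set.mem_preimage, mem_closedBall_zero_iff]
      refine ⟨fun h => ?_, fun h => key _ _ h hy₀'⟩
      have := key (y + y₀) (-y₀) h (by rwa [map_neg, norm_neg])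
      rwa [add_neg_cancel_right] at this
    have h1 : ∫ y, g y ∂μ' = (χ (B v y₀) : ℂ) * ∫ y, g y ∂μ' := by
      conv_lhs => rw [← integral_add_right_eq_self g y₀]
      rw [← integral_const_mul]
      congr 1
      ext y
      by_cases hy : y ∈ e' ⁻¹' Metric.closedBall 0 ‖t‖⁻¹
      · rw [hg, Set.indicator_of_mem hy, Set.indicator_of_mem ((hball y).2 hy), map_add,
          AddChar.map_add_eq_mul, Circle.coe_mul, mul_comm]
      · rw [hg, Set.indicator_of_notMem hy, Set.indicator_of_notMem (fun h => hy ((hball y).1 h)),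
          mul_zero]
    by_contra h0
    rw [eq_comm, mul_eq_right₀ h0] at h1
    exact hχa (Circle.ext (h1.trans Circle.coe_one.symm))

include hχc he in
-- The transform is supported in the ball of radius ‖t‖⁻¹, so Fubini applies. Integrating the
-- character over that ball cuts the v-integral down to the ball of radius ‖t‖, on which ψ equals
-- ψ(0).
lemma integral_pairFourier_of_scale [IsUltrametricDist F] (hχ : Continuous χ) (μ' : Measure V')
    [μ'.IsAddHaarMeasure] (ψ : SchwartzBruhat V) {t : F} (ht : t ≠ 0)
    (hψ : ∀ v w : V, ‖e w‖ ≤ ‖t‖ → (ψ : V → ℂ) (v + w) = (ψ : V → ℂ) v) :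
    ∫ y, pairFourier χ B μ (ψ : V → ℂ) y ∂μ' =
      (μ.real (e ⁻¹' Metric.closedBall 0 ‖t‖) *
        μ'.real (e' ⁻¹' Metric.closedBall 0 ‖t‖⁻¹) : ℝ) * (ψ : V → ℂ) 0 := by
  have := FiniteDimensional.proper F V
  have := FiniteDimensional.proper F V'
  set S := e' ⁻¹' Metric.closedBall 0 ‖t‖⁻¹ with hS
  set T := e ⁻¹' Metric.closedBall 0 ‖t‖ with hT
  have hSc : IsCompact S := e'.toHomeomorph.isCompact_preimage.2 (isCompact_closedBall _ _)
  have hTm : MeasurableSet T := (Metric.isClosed_closedBall.preimage e.continuous).measurableSet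
  have : IsFiniteMeasure (μ'.restrict S) := ⟨by simpa using hSc.measure_lt_top⟩
  have h1 : ∫ y, pairFourier χ B μ (ψ : V → ℂ) y ∂μ' =
      ∫ y in S, pairFourier χ B μ (ψ : V → ℂ) y ∂μ' := by
    refine (setIntegral_eq_integral_of_forall_compl_eq_zero fun y hy => ?_).symm
    refine pairFourier_eq_zero hχc μ he ht hψ ?_
    simpa [hS] using hy
  rw [h1]
  simp only [pairFourier]
  rw [integral_integral_swap]
  · have h2 : ∀ v, ∫ y in S, (χ (B v y) : ℂ) * (ψ : V → ℂ) v ∂μ' =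
        T.indicator (fun _ => (μ'.real S : ℂ) * (ψ : V → ℂ) 0) v := by
      intro v
      rw [integral_mul_const, integral_addChar_closedBall hχc he μ' ht]
      by_cases hv : v ∈ T
      · rw [Set.indicator_of_mem hv, Set.indicator_of_mem hv]
        have := hψ 0 v (by simpa [hT] using hv)
        rw [zero_add] at this
        rw [this]
      · rw [Set.indicator_of_notMem hv, Set.indicator_of_notMem hv, zero_mul]
    simp only [h2]
    rw [integral_indicator hTm, setIntegral_const]
    simp [mul_assoc]
  · have h3 : Integrable (fun p : V' × V => (ψ : V → ℂ) p.2) ((μ'.restrict S).prod μ) :=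
      (SchwartzBruhat.integrable ψ).comp_snd _
    exact integrable_addChar_mul hχ h3 ((continuous_pairing B).comp continuous_swap)

/-- Fourier inversion at the origin, up to the normalization of the measures. -/
theorem exists_integral_pairFourier [IsUltrametricDist F]
    (hχc : ∀ x : F, (∀ a : F, ‖a‖ ≤ 1 → χ (a * x) = 1) ↔ ‖x‖ ≤ 1) (hχ : Continuous χ)
    (hB : ∀ y, (∀ v, B v y = 0) → y = 0) (hd : finrank F V = finrank F V')
    (μ' : Measure V') [μ'.IsAddHaarMeasure] :
    ∃ c : ℝ≥0, c ≠ 0 ∧ ∀ ψ : SchwartzBruhat V,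
      ∫ y, pairFourier χ B μ (ψ : V → ℂ) y ∂μ' = (c : ℂ) * (ψ : V → ℂ) 0 := by
  have := FiniteDimensional.proper F V
  have := FiniteDimensional.proper F V'
  obtain ⟨e, e', he⟩ := exists_coordinates_of_pairing B hB hd
  let T : Set V := e ⁻¹' Metric.closedBall 0 1
  let S : Set V' := e' ⁻¹' Metric.closedBall 0 1
  have hTc : IsCompact T := e.toHomeomorph.isCompact_preimage.2 (isCompact_closedBall _ _)
  have hTo : IsOpen T :=
    (IsUltrametricDist.isOpen_closedBall 0 one_ne_zero).preimage e.continuous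
  have hSc : IsCompact S := e'.toHomeomorph.isCompact_preimage.2 (isCompact_closedBall _ _)
  have hSo : IsOpen S :=
    (IsUltrametricDist.isOpen_closedBall 0 one_ne_zero).preimage e'.continuous
  -- The constant obtained at scale t is a product of volumes of dual balls and must be shown not to
  -- depend on t. The indicator φ of the unit ball has φ(0) = 1 and is constant at every scale ‖t‖ ≤
  -- 1, so evaluating its integral at scale t and at scale 1 compares the constants.
  let φ := SchwartzBruhat.indicator hTc hTo
  have hφ : ∀ v w : V, ‖e w‖ ≤ 1 → (φ : V → ℂ) (v + w) = (φ : V → ℂ) v := by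
    have key : ∀ v w, ‖e w‖ ≤ 1 → v ∈ T → v + w ∈ T := fun v w hw hv => by
      simp only [T, Set.mem_preimage, mem_closedBall_zero_iff, map_add] at hv ⊢
      exact (IsUltrametricDist.norm_add_le_max _ _).trans (max_le hv hw)
    intro v w hw
    have h2 : v + w ∈ T ↔ v ∈ T := ⟨fun h => by
      have := key _ (-w) (by rwa [map_neg, norm_neg]) h
      rwa [add_neg_cancel_right] at this, key v w hw⟩
    change T.indicator 1 (v + w) = T.indicator 1 v
    by_cases hv : v ∈ T
    · rw [Set.indicator_of_mem hv, Set.indicator_of_mem (h2.2 hv)]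
      rfl
    · rw [Set.indicator_of_notMem hv, Set.indicator_of_notMem (fun h => hv (h2.1 h))]
  have hφ0 : (φ : V → ℂ) 0 = 1 := by simp [φ, SchwartzBruhat.indicator, T]
  have h1 := integral_pairFourier_of_scale hχc μ he hχ μ' φ one_ne_zero
    (fun v w hw => hφ v w (by simpa using hw))
  rw [hφ0, mul_one] at h1
  have hT0 : 0 < μ.real T :=
    ENNReal.toReal_pos (hTo.measure_pos μ ⟨0, by simp [T]⟩).ne' hTc.measure_lt_top.ne
  have hS0 : 0 < μ'.real S :=
    ENNReal.toReal_pos (hSo.measure_pos μ' ⟨0, by simp [S]⟩).ne' hSc.measure_lt_top.ne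
  have hTS : 0 < μ.real T * μ'.real S := by positivity
  refine ⟨(μ.real T * μ'.real S).toNNReal, (Real.toNNReal_pos.2 hTS).ne', fun ψ => ?_⟩
  rw [Real.coe_toNNReal _ hTS.le]
  · obtain ⟨s, hs, hs'⟩ := SchwartzBruhat.exists_scale e ψ
    obtain ⟨t, ht, hts, ht1⟩ : ∃ t : F, t ≠ 0 ∧ ‖t‖ ≤ ‖s‖ ∧ ‖t‖ ≤ 1 := by
      by_cases h : ‖s‖ ≤ 1
      · exact ⟨s, hs, le_rfl, h⟩
      · exact ⟨1, one_ne_zero, by simpa using (not_le.1 h).le, by simp⟩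
    have h2 := integral_pairFourier_of_scale hχc μ he hχ μ' φ ht
      (fun v w hw => hφ v w (hw.trans ht1))
    have h3 := integral_pairFourier_of_scale hχc μ he hχ μ' ψ ht
      (fun v w hw => hs' v w (hw.trans hts))
    rw [hφ0, mul_one, h1] at h2
    rw [h3, ← h2]
    simp [T, S]

end Pairing
end

noncomputable section

/-! ### Uniqueness of relatively invariant measures -/

section RelativelyInvariant

variable {G O : Type*} [Group G] [MeasurableSpace G] [MeasurableSpace O]
  {lam : Measure G} [SFinite lam] {act : G → O → O}

/-- Fubini for the set of (g, x) with gx in E. Its slice at g has measure δ g * μ E, and its slices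
at different x are right translates of one another, hence null together. So the null sets of μ are
determined by lam and the action alone. -/
lemma measure_eq_zero_iff_of_transitive (hlam : lam ≠ 0)
    (hright : ∀ (k : G) (N : Set G), lam N = 0 → lam ((fun g => g * k) ⁻¹' N) = 0)
    (hact : Measurable (Function.uncurry act)) (act_mul : ∀ g h x, act (g * h) x = act g (act h x))
    (trans : ∀ x y, ∃ g, act g x = y) {δ : G → ℝ≥0} (hδ : ∀ g, δ g ≠ 0) {μ : Measure O}
    [SFinite μ] (hμ : ∀ g, μ.map (act g) = δ g • μ) (hμ0 : μ ≠ 0) {E : Set O}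
    (hE : MeasurableSet E) (x₀ : O) : lam {g | act g x₀ ∈ E} = 0 ↔ μ E = 0 := by
  have hm : MeasurableSet (Function.uncurry act ⁻¹' E) := hact hE
  have hmg : ∀ g, Measurable (act g) := fun g => hact.comp measurable_prodMk_left
  have hpt : ∀ x, lam {g | act g x₀ ∈ E} = 0 → lam {g | act g x ∈ E} = 0 := by
    intro x h
    obtain ⟨k, rfl⟩ := trans x₀ x
    have := hright k _ h
    simpa only [Set.preimage_ofPred_eq, act_mul] using this
  have hpt' : ∀ x, lam {g | act g x ∈ E} = 0 → lam {g | act g x₀ ∈ E} = 0 := by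
    intro x h
    obtain ⟨k, rfl⟩ := trans x x₀
    have := hright k _ h
    simpa only [Set.preimage_ofPred_eq, act_mul] using this
  have hg : ∀ g, μ (Prod.mk g ⁻¹' (Function.uncurry act ⁻¹' E)) = δ g * μ E := fun g => by
    have := congrArg (fun ν : Measure O => ν E) (hμ g)
    simp only [Measure.map_apply (hmg g) hE, Measure.smul_apply] at this
    exact this
  have h1 : (lam.prod μ) (Function.uncurry act ⁻¹' E) = ∫⁻ g, δ g * μ E ∂lam := by
    rw [Measure.prod_apply hm]
    simp only [hg]
  have h2 : (lam.prod μ) (Function.uncurry act ⁻¹' E) = ∫⁻ x, lam {g | act g x ∈ E} ∂μ := by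
    rw [Measure.prod_apply_symm hm]
    rfl
  constructor
  · intro h
    have h3 : (lam.prod μ) (Function.uncurry act ⁻¹' E) = 0 := by
      rw [h2]
      exact lintegral_eq_zero_of_ae_eq_zero (.of_forall fun x => hpt x h)
    rw [Measure.measure_prod_null hm] at h3
    have : NeZero lam := ⟨hlam⟩
    obtain ⟨g, hg'⟩ := h3.exists
    beta_reduce at hg'
    rw [hg, Pi.zero_apply, mul_eq_zero] at hg'
    exact hg'.resolve_left (by exact_mod_cast hδ g)
  · intro h
    rw [h2] at h1
    simp only [h, mul_zero, lintegral_zero] at h1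
    replace h1 := (lintegral_eq_zero_iff (measurable_measure_prodMk_right hm)).1 h1
    have : NeZero μ := ⟨hμ0⟩
    obtain ⟨x, hx⟩ := h1.exists
    exact hpt' x hx

/-- Relatively invariant measures on a homogeneous space are unique up to a constant. -/
theorem exists_smul_eq_of_transitive (hlam : lam ≠ 0)
    (hright : ∀ (k : G) (N : Set G), lam N = 0 → lam ((fun g => g * k) ⁻¹' N) = 0)
    (hact : Measurable (Function.uncurry act)) (act_one : ∀ x, act 1 x = x)
    (act_mul : ∀ g h x, act (g * h) x = act g (act h x))
    (trans : ∀ x y, ∃ g, act g x = y) {δ : G → ℝ≥0} (hδ : ∀ g, δ g ≠ 0) {μ μ' : Measure O}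
    [SigmaFinite μ] [SigmaFinite μ'] (hμ : ∀ g, μ.map (act g) = δ g • μ) (hμ0 : μ ≠ 0)
    (hμ' : ∀ g, μ'.map (act g) = δ g • μ') (hμ0' : μ' ≠ 0) : ∃ c : ℝ≥0, c ≠ 0 ∧ μ' = c • μ := by
  have hmg : ∀ g, Measurable (act g) := fun g => hact.comp measurable_prodMk_left
  have : NeZero μ := ⟨hμ0⟩
  obtain ⟨y₀⟩ : Nonempty O := μ.nonempty_of_neZero
  have hac : μ' ≪ μ := by
    refine Measure.AbsolutelyContinuous.mk fun E hE h => ?_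
    rw [← measure_eq_zero_iff_of_transitive hlam hright hact act_mul trans hδ hμ hμ0 hE y₀] at h
    rwa [measure_eq_zero_iff_of_transitive hlam hright hact act_mul trans hδ hμ' hμ0' hE y₀] at h
  set h := μ'.rnDeriv μ with hh
  have hmh : Measurable h := Measure.measurable_rnDeriv _ _
  have hd : μ.withDensity h = μ' := Measure.withDensity_rnDeriv_eq _ _ hac
  have hinv : ∀ g, ∀ᵐ x ∂μ, h (act g x) = h x := by
    intro g
    -- For fixed g the density is invariant almost everywhere: changing variables in μ produces the
    -- factor δ g, which the same factor for μ' absorbs.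
    refine ae_eq_of_forall_setLIntegral_eq_of_sigmaFinite (hmh.comp (hmg g)) hmh fun A hA _ => ?_
    have e1 : ∀ f : O → ℝ≥0∞, Measurable f → ∫⁻ x, f (act g x) ∂μ = δ g * ∫⁻ x, f x ∂μ := by
      intro f hf
      rw [← lintegral_map hf (hmg g), hμ g, lintegral_smul_measure]
      rfl
    have hinvact : ∀ x, act g⁻¹ (act g x) = x := fun x => by
      rw [← act_mul, inv_mul_cancel, act_one]
    have hA' : MeasurableSet (act g⁻¹ ⁻¹' A) := hmg _ hA
    have e2 : ∫⁻ x in A, h (act g x) ∂μ = δ g * μ' (act g⁻¹ ⁻¹' A) := by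
      rw [← hd, withDensity_apply _ hA', ← lintegral_indicator hA', ← lintegral_indicator hA,
        ← e1 _ (hmh.indicator hA')]
      congr 1
      ext x
      have hx : act g x ∈ act g⁻¹ ⁻¹' A ↔ x ∈ A := by rw [Set.mem_preimage, hinvact]
      by_cases hxA : x ∈ A
      · rw [Set.indicator_of_mem hxA, Set.indicator_of_mem (hx.2 hxA)]
      · rw [Set.indicator_of_notMem hxA, Set.indicator_of_notMem (fun h => hxA (hx.1 h))]
    have e3 : δ g * μ' (act g⁻¹ ⁻¹' A) = μ' A := by
      have := congrArg (fun ν : Measure O => ν (act g⁻¹ ⁻¹' A)) (hμ' g)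
      simp only [Measure.map_apply (hmg g) hA', Measure.smul_apply] at this
      rw [← smul_eq_mul]
      refine this.symm.trans ?_
      congr 1
      ext x
      simp only [Set.mem_preimage, hinvact]
    rw [e2, e3, ← hd, withDensity_apply _ hA]
  have hDm : MeasurableSet {p : G × O | h (act p.1 p.2) = h p.2} :=
    measurableSet_eq_fun (hmh.comp hact) (hmh.comp measurable_snd)
  -- The exceptional null set depends on g. Exchanging the quantifiers gives one x₀ with h(gx₀) =
  -- h(x₀) for almost all g, and the null set criterion then makes h constant.
  have hD : ∀ᵐ x ∂μ, ∀ᵐ g ∂lam, h (act g x) = h x :=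
    Measure.ae_ae_comm hDm |>.1 (.of_forall hinv)
  obtain ⟨x₀, hx₀, hx₀'⟩ := (hD.and (Measure.rnDeriv_lt_top μ' μ)).exists
  have hE : MeasurableSet {x | h x ≠ h x₀} := (measurableSet_eq_fun hmh measurable_const).compl
  have hconst : ∀ᵐ x ∂μ, h x = h x₀ :=
    (measure_eq_zero_iff_of_transitive hlam hright hact act_mul trans hδ hμ hμ0 hE x₀).1 hx₀
  have hfin : μ' = (h x₀).toNNReal • μ := by
    rw [← hd, withDensity_congr_ae hconst, withDensity_const, ENNReal.smul_def,
      ENNReal.coe_toNNReal hx₀'.ne]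
  refine ⟨_, fun h0 => hμ0' ?_, hfin⟩
  rw [hfin, h0, zero_smul]

end RelativelyInvariant

/-! ### Equivalence of endomorphisms of equal rank -/

section Rank

variable {K V : Type*} [Field K] [AddCommGroup V] [Module K V] [FiniteDimensional K V]

lemma LinearEquiv.exists_extension {p q : Submodule K V} (e : p ≃ₗ[K] q) :
    ∃ E : V ≃ₗ[K] V, ∀ x : p, E x = e x := by
  obtain ⟨p', hp'⟩ := p.exists_isCompl
  obtain ⟨q', hq'⟩ := q.exists_isCompl
  have h1 := Submodule.finrank_add_eq_of_isCompl hp'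
  have h2 := Submodule.finrank_add_eq_of_isCompl hq'
  have h3 := e.finrank_eq
  let e' : p' ≃ₗ[K] q' := LinearEquiv.ofFinrankEq _ _ (by omega)
  refine ⟨(p.prodEquivOfIsCompl p' hp').symm ≪≫ₗ (e.prodCongr e') ≪≫ₗ
    q.prodEquivOfIsCompl q' hq', fun x => ?_⟩
  simp

/-- Endomorphisms of equal rank are equivalent. -/
lemma LinearMap.exists_equiv_comp_of_finrank_range_eq {f f' : V →ₗ[K] V}
    (h : finrank K (LinearMap.range f) = finrank K (LinearMap.range f')) :
    ∃ g k : V ≃ₗ[K] V, ∀ x, f' x = g (f (k x)) := by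
  have h1 := f.finrank_range_add_finrank_ker
  have h2 := f'.finrank_range_add_finrank_ker
  -- The automorphism k carries the kernel of f' to that of f, so f ∘ k and f' have the same kernel.
  -- The isomorphism which they induce between their ranges is then extended to g.
  obtain ⟨k, hk⟩ := LinearEquiv.exists_extension
    (LinearEquiv.ofFinrankEq (LinearMap.ker f') (LinearMap.ker f) (by omega))
  have hker : LinearMap.ker f' ≤ LinearMap.ker (f ∘ₗ k.toLinearMap) := by
    intro x hx
    have := hk ⟨x, hx⟩
    simp only [LinearMap.mem_ker, LinearMap.comp_apply, LinearEquiv.coe_coe]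
    rw [this]
    exact LinearMap.mem_ker.1 (Subtype.prop _)
  have hr : LinearMap.range (f ∘ₗ k.toLinearMap) = LinearMap.range f :=
    LinearMap.range_comp_of_range_eq_top _ k.range
  have h4 := (f ∘ₗ k.toLinearMap).finrank_range_add_finrank_ker
  rw [hr] at h4
  have hker' : LinearMap.ker (f ∘ₗ k.toLinearMap) = LinearMap.ker f' :=
    (Submodule.eq_of_le_of_finrank_eq hker (by omega)).symm
  obtain ⟨g, hg⟩ := LinearEquiv.exists_extension
    ((f ∘ₗ k.toLinearMap).quotKerEquivRange.symm ≪≫ₗ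
      Submodule.quotEquivOfEq _ _ hker' ≪≫ₗ f'.quotKerEquivRange)
  refine ⟨g, k, fun x => ?_⟩
  have := hg ⟨(f ∘ₗ k.toLinearMap) x, LinearMap.mem_range_self _ x⟩
  simp only [LinearMap.comp_apply, LinearEquiv.coe_coe] at this
  rw [this, LinearEquiv.trans_apply, LinearEquiv.trans_apply]
  have h5 : (f ∘ₗ k.toLinearMap).quotKerEquivRange.symm
      ⟨f (k x), LinearMap.mem_range_self (f ∘ₗ k.toLinearMap) x⟩ = Submodule.Quotient.mk x := by
    rw [LinearEquiv.symm_apply_eq]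
    rfl
  rw [h5]
  rfl

end Rank

/-! ### Orbital measures -/

section OrbitMeasure

variable {F : Type*} [NontriviallyNormedField F] [ProperSpace F] [IsUltrametricDist F]
  {X : Type*} [NormedAddCommGroup X] [NormedSpace F X] [FiniteDimensional F X] {k : ℕ}

lemma isOpen_le_finrank_range (k : ℕ) :
    IsOpen {x : X →L[F] X | k ≤ finrank F (LinearMap.range (x : X →ₗ[F] X))} := by
  have h := isOpen_setOfPred_nat_le_rank (𝕜 := F) (E := X) (F := X) k
  convert h using 2
  ext x
  rw [LinearMap.rank, ← finrank_eq_rank]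
  norm_cast

/-- By lower semicontinuity of the rank, rank at least k is an open condition and rank at most k a
closed one. -/
lemma isLocallyClosed_rankSet (k : ℕ) : IsLocallyClosed (rankSet F X k) := by
  have : rankSet F X k = {x : X →L[F] X | k ≤ finrank F (LinearMap.range (x : X →ₗ[F] X))} ∩
      {x : X →L[F] X | k + 1 ≤ finrank F (LinearMap.range (x : X →ₗ[F] X))}ᶜ := by
    ext x
    simp only [rankSet, Set.mem_ofPred_eq, Set.mem_inter_iff, Set.mem_compl_iff]
    omega
  rw [this]
  exact ((isOpen_le_finrank_range k).isLocallyClosed).inter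
    (isOpen_le_finrank_range (k + 1)).isClosed_compl.isLocallyClosed

lemma measurableSet_rankSet (k : ℕ) : MeasurableSet (rankSet F X k) := by
  obtain ⟨U, Z, hU, hZ, h⟩ := isLocallyClosed_rankSet (F := F) (X := X) k
  rw [h]
  exact hU.measurableSet.inter hZ.measurableSet

lemma locallyCompactSpace_rankSet (k : ℕ) : LocallyCompactSpace (rankSet F X k) := by
  have := FiniteDimensional.proper F (X →L[F] X)
  exact (isLocallyClosed_rankSet k).locallyCompactSpace

lemma totallyDisconnectedSpace_rankSet (k : ℕ) : TotallyDisconnectedSpace (rankSet F X k) := by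
  have := totallyDisconnectedSpace_of_finiteDimensional F (X →L[F] X)
  infer_instance

/-- The left action of `GL(X) × GL(X)` on endomorphisms of rank `k`. -/
def rankSetSMul (p : (X →L[F] X)ˣ × (X →L[F] X)ˣ) (x : rankSet F X k) : rankSet F X k :=
  rankSetAct p.1⁻¹ p.2⁻¹ x

lemma rankSetSMul_val (p : (X →L[F] X)ˣ × (X →L[F] X)ˣ) (x : rankSet F X k) :
    (rankSetSMul p x : X →L[F] X) = p.1 * x.1 * (p.2⁻¹ : (X →L[F] X)ˣ) := by
  simp [rankSetSMul, rankSetAct]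

lemma continuous_rankSetSMul :
    Continuous (Function.uncurry (rankSetSMul (F := F) (X := X) (k := k))) := by
  refine Continuous.subtype_mk ?_ _
  have h : Continuous fun p : ((X →L[F] X)ˣ × (X →L[F] X)ˣ) × rankSet F X k =>
      (p.1.1 : X →L[F] X) * p.2.1 * ((p.1.2⁻¹ : (X →L[F] X)ˣ) : X →L[F] X) := by fun_prop
  refine h.congr fun p => ?_
  simp

lemma rankSetSMul_transitive (x y : rankSet F X k) : ∃ p, rankSetSMul p x = y := by
  have := FiniteDimensional.complete F X
  obtain ⟨g, h, hgh⟩ := LinearMap.exists_equiv_comp_of_finrank_range_eq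
    ((show _ = k from x.2).trans (show _ = k from y.2).symm)
  -- The second factor acts by right multiplication with its inverse, hence the inverse of h.
  refine ⟨(ContinuousLinearEquiv.toUnit g.toContinuousLinearEquiv,
    ContinuousLinearEquiv.toUnit h.symm.toContinuousLinearEquiv), ?_⟩
  ext v
  rw [rankSetSMul_val]
  exact (hgh v).symm

lemma IsOrbitMeasure.isFiniteMeasureOnCompacts {μ : Measure (rankSet F X k)}
    (hμ : IsOrbitMeasure k μ) : IsFiniteMeasureOnCompacts μ :=
  ⟨fun _ hK => hμ.finite_on_compacts _ hK⟩

/-- The factor `|det g|^k |det h|^{-k}` as a nonnegative real. -/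
def transformFactorNN (k : ℕ) (g h : (X →L[F] X)ˣ) : ℝ≥0 :=
  modulus (g : X →L[F] X).det ^ k * (modulus (h : X →L[F] X).det ^ k)⁻¹

lemma det_units_mul_det_inv (g : (X →L[F] X)ˣ) :
    (g : X →L[F] X).det * ((g⁻¹ : (X →L[F] X)ˣ) : X →L[F] X).det = 1 := by
  change LinearMap.det _ * LinearMap.det _ = 1
  rw [← map_mul, ← LinearMap.det_id (A := F) (M := X)]
  congr 1
  ext v
  change ((g : X →L[F] X) * ((g⁻¹ : (X →L[F] X)ˣ) : X →L[F] X)) v = v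
  simp

lemma det_units_ne_zero (g : (X →L[F] X)ˣ) : (g : X →L[F] X).det ≠ 0 :=
  left_ne_zero_of_mul_eq_one (det_units_mul_det_inv g)

lemma det_units_inv (g : (X →L[F] X)ˣ) :
    ((g⁻¹ : (X →L[F] X)ˣ) : X →L[F] X).det = ((g : X →L[F] X).det)⁻¹ :=
  eq_inv_of_mul_eq_one_right (det_units_mul_det_inv g)

lemma transformFactorNN_ne_zero (k : ℕ) (g h : (X →L[F] X)ˣ) : transformFactorNN k g h ≠ 0 :=
  mul_ne_zero (pow_ne_zero _ (modulus_ne_zero (det_units_ne_zero g)))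
    (inv_ne_zero (pow_ne_zero _ (modulus_ne_zero (det_units_ne_zero h))))

lemma continuous_rankSetAct (g h : (X →L[F] X)ˣ) :
    Continuous (rankSetAct g h : rankSet F X k → rankSet F X k) := by
  refine Continuous.subtype_mk ?_ _
  fun_prop

/-- Relative invariance of an orbital measure as an identity of measures. -/
lemma IsOrbitMeasure.map_rankSetAct {μ : Measure (rankSet F X k)}
    (hμ : IsOrbitMeasure k μ) (g h : (X →L[F] X)ˣ) :
    μ.map (rankSetAct g h) = transformFactorNN k g h • μ := by
  have := locallyCompactSpace_rankSet (F := F) (X := X) k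
  have := totallyDisconnectedSpace_rankSet (F := F) (X := X) k
  have := hμ.isFiniteMeasureOnCompacts
  have := FiniteDimensional.proper F (X →L[F] X)
  let e : rankSet F X k ≃ₜ rankSet F X k :=
    { toFun := rankSetAct g h
      invFun := rankSetAct g⁻¹ h⁻¹
      left_inv := fun x => by ext1; simp [rankSetAct, mul_assoc]
      right_inv := fun x => by ext1; simp [rankSetAct, mul_assoc]
      continuous_toFun := continuous_rankSetAct g h
      continuous_invFun := continuous_rankSetAct g⁻¹ h⁻¹ }
  have : IsFiniteMeasureOnCompacts (μ.map (rankSetAct g h)) :=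
    ⟨fun K hK => by
      change μ.map e K < ∞
      rw [Measure.map_apply e.continuous.measurable hK.measurableSet]
      exact (e.isCompact_preimage.2 hK).measure_lt_top⟩
  refine Measure.ext_of_integral_schwartzBruhat fun ψ => ?_
  rw [integral_map (continuous_rankSetAct g h).aemeasurable ψ.2.1.continuous.aestronglyMeasurable,
    hμ.transform g h _ ψ.2.1.continuous ψ.2.2, integral_smul_nnreal_measure, NNReal.smul_def,
    Complex.real_smul]
  rfl

/-- The orbit O_k is a homogeneous space of the locally compact group GL(X) × GL(X), whose Haar
measure serves as the reference measure. -/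
theorem IsOrbitMeasure.unique {μ μ' : Measure (rankSet F X k)} (hμ : IsOrbitMeasure k μ)
    (hμ' : IsOrbitMeasure k μ') : ∃ c : ℝ≥0, c ≠ 0 ∧ μ' = c • μ := by
  have := FiniteDimensional.complete F X
  have := FiniteDimensional.proper F (X →L[F] X)
  have := locallyCompactSpace_rankSet (F := F) (X := X) k
  have := hμ.isFiniteMeasureOnCompacts
  have := hμ'.isFiniteMeasureOnCompacts
  have hu : Topology.IsOpenEmbedding (Units.val : (X →L[F] X)ˣ → (X →L[F] X)) :=
    Units.isOpenEmbedding_val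
  have : LocallyCompactSpace (X →L[F] X)ˣ := hu.locallyCompactSpace
  have : SecondCountableTopology (X →L[F] X)ˣ := hu.isEmbedding.secondCountableTopology
  have : BorelSpace (X →L[F] X)ˣ := ⟨by
    rw [hu.isInducing.eq_induced, borel_comap, ← BorelSpace.measurable_eq]
    rfl⟩
  let lam : Measure ((X →L[F] X)ˣ × (X →L[F] X)ˣ) := Measure.haar
  refine exists_smul_eq_of_transitive (lam := lam) (act := rankSetSMul)
    (δ := fun p => transformFactorNN k p.1⁻¹ p.2⁻¹) (NeZero.ne lam)
    (fun g N hN => (measure_mul_right_null lam g).2 hN)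
    continuous_rankSetSMul.measurable (fun x => ?_) (fun p q x => ?_) rankSetSMul_transitive
    (fun p => transformFactorNN_ne_zero _ _ _) (fun p => hμ.map_rankSetAct _ _) hμ.ne_zero
    (fun p => hμ'.map_rankSetAct _ _) hμ'.ne_zero
  · ext1
    simp [rankSetSMul_val]
  · ext1
    simp [rankSetSMul_val, mul_assoc]

/-- The distribution defined by a measure that is finite on compact sets. -/
def SBDistribution.ofMeasure {V : Type*} [TopologicalSpace V] [MeasurableSpace V]
    [OpensMeasurableSpace V] (M : Measure V) [IsFiniteMeasureOnCompacts M] :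
    SBDistribution V where
  toFun ψ := ∫ x, (ψ : V → ℂ) x ∂M
  map_add' φ ψ := integral_add (SchwartzBruhat.integrable φ) (SchwartzBruhat.integrable ψ)
  map_smul' c _ := integral_const_mul c _

lemma extendByZero_comap {M : Measure (X →L[F] X)} (hM : M (rankSet F X k)ᶜ = 0) :
    extendByZero (M.comap (Subtype.val : rankSet F X k → X →L[F] X)) = M := by
  rw [extendByZero, map_comap_subtype_coe (measurableSet_rankSet k)]
  exact Measure.restrict_eq_self_of_ae_mem hM

/-- A measure on `End(X)` concentrated on the endomorphisms of rank `k` and transforming by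
the right factor restricts to an orbital measure. -/
lemma isOrbitMeasure_comap {M : Measure (X →L[F] X)} [IsFiniteMeasureOnCompacts M]
    (hM : M (rankSet F X k)ᶜ = 0) (hM0 : M ≠ 0)
    (htr : ∀ g h, M.map (actHomeo g h).symm = transformFactorNN k g h • M) :
    IsOrbitMeasure k (M.comap (Subtype.val : rankSet F X k → X →L[F] X)) := by
  have hemb := MeasurableEmbedding.subtype_coe (measurableSet_rankSet (F := F) (X := X) k)
  have hext := extendByZero_comap hM
  refine ⟨fun h0 => hM0 ?_, fun K hK => ?_, fun g h ψ hψ hψ' => ?_⟩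
  · rw [← hext, h0, extendByZero, Measure.map_zero]
  · rw [hemb.comap_apply]
    exact (hK.image continuous_subtype_val).measure_lt_top
  · set μ := M.comap (Subtype.val : rankSet F X k → X →L[F] X) with hμ
    have key : μ.map (rankSetAct g h) = transformFactorNN k g h • μ := by
      have hinj : ∀ ν ν' : Measure (rankSet F X k), extendByZero ν = extendByZero ν' → ν = ν' := by
        intro ν ν' hν
        rw [← hemb.comap_map ν, ← hemb.comap_map ν']
        exact congrArg _ hν
      refine hinj _ _ ?_
      rw [extendByZero, extendByZero, Measure.map_smul,
        Measure.map_map measurable_subtype_coe (continuous_rankSetAct g h).measurable]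
      change _ = transformFactorNN k g h • extendByZero μ
      rw [hext, ← htr g h]
      conv_rhs => rw [← hext]
      rw [extendByZero, Measure.map_map (actHomeo g h).symm.continuous.measurable
        measurable_subtype_coe]
      rfl
    rw [← integral_map (continuous_rankSetAct g h).aemeasurable, key, integral_smul_nnreal_measure,
      NNReal.smul_def, Complex.real_smul]
    · rfl
    · exact hψ.aestronglyMeasurable

lemma extendsToDistribution_of_eq {μ : Measure (rankSet F X k)} {M : Measure (X →L[F] X)}
    [IsFiniteMeasureOnCompacts M] (h : extendByZero μ = M) :
    ExtendsToDistribution μ (SBDistribution.ofMeasure M) := fun _ => by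
  rw [h]
  exact ⟨SchwartzBruhat.integrable _, rfl⟩

lemma ofMeasure_leftRight {M : Measure (X →L[F] X)} [IsFiniteMeasureOnCompacts M]
    {g h : (X →L[F] X)ˣ} (htr : M.map (actHomeo g h).symm = transformFactorNN k g h • M)
    (ψ : SchwartzBruhat (X →L[F] X)) :
    SBDistribution.ofMeasure M (leftRight g h ψ) =
      transformFactor k g h * SBDistribution.ofMeasure M ψ := by
  have h1 : ∫ x, (ψ : (X →L[F] X) → ℂ) ((actHomeo g h).symm x) ∂M =
      transformFactor k g h * ∫ x, (ψ : (X →L[F] X) → ℂ) x ∂M := by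
    rw [← integral_map (actHomeo g h).symm.continuous.aemeasurable
      ψ.2.1.continuous.aestronglyMeasurable, htr, integral_smul_nnreal_measure,
      NNReal.smul_def, Complex.real_smul]
    rfl
  exact h1

/-- All orbital measures define distributions if one of them is the restriction of a measure
that is finite on the compact sets of `End(X)`. -/
lemma IsOrbitMeasure.exists_distribution {M : Measure (X →L[F] X)} [IsFiniteMeasureOnCompacts M]
    (hM : M (rankSet F X k)ᶜ = 0) (hM0 : M ≠ 0)
    (htr : ∀ g h, M.map (actHomeo g h).symm = transformFactorNN k g h • M)
    {μ : Measure (rankSet F X k)} (hμ : IsOrbitMeasure k μ) :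
    ∃ T : SBDistribution (X →L[F] X), ExtendsToDistribution μ T ∧
      ∀ (g h : (X →L[F] X)ˣ) (ψ : SchwartzBruhat (X →L[F] X)),
        T (leftRight g h ψ) = transformFactor k g h * T ψ := by
  obtain ⟨c, -, hc⟩ := (isOrbitMeasure_comap hM hM0 htr).unique hμ
  have hext : extendByZero μ = c • M := by
    rw [hc, extendByZero, Measure.map_smul]
    exact congrArg (c • ·) (extendByZero_comap hM)
  have : IsFiniteMeasureOnCompacts (c • M) := inferInstance
  refine ⟨_, extendsToDistribution_of_eq hext, fun g h ψ => ofMeasure_leftRight ?_ ψ⟩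
  rw [Measure.map_smul, htr, smul_comm]

end OrbitMeasure
end

noncomputable section

/-! ### The multiplicative measure -/

section MultMeasure

variable {F : Type*} [NontriviallyNormedField F] [ProperSpace F]
  [MeasurableSpace F] [BorelSpace F]

lemma range_units_val : Set.range (Units.val : Fˣ → F) = {0}ᶜ := by
  ext x
  simp only [Set.mem_range, Set.mem_compl_iff, Set.mem_singleton_iff]
  exact ⟨fun ⟨a, ha⟩ => ha ▸ a.ne_zero, fun hx => ⟨Units.mk0 x hx, rfl⟩⟩

lemma measurableEmbedding_units_val : MeasurableEmbedding (Units.val : Fˣ → F) where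
  injective := Units.val_injective
  measurable := comap_measurable _
  measurableSet_image' := by
    rintro _ ⟨t, ht, rfl⟩
    rw [Set.image_preimage_eq_inter_range, range_units_val]
    exact ht.inter (MeasurableSet.singleton 0).compl

lemma measurable_units_mul (b : Fˣ) : Measurable fun a : Fˣ => b * a :=
  measurableEmbedding_units_val.measurable_comp_iff.1
    ((measurableEmbedding_units_val.measurable).const_mul (b : F))

lemma measurable_units_inv : Measurable fun a : Fˣ => ((a⁻¹ : Fˣ) : F) := by
  simp only [Units.val_inv_eq_inv_val]
  exact measurableEmbedding_units_val.measurable.inv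

variable (da : Measure F) [da.IsAddHaarMeasure]

lemma map_comap_units : (da.comap (Units.val : Fˣ → F)).map Units.val = da := by
  rw [measurableEmbedding_units_val.map_comap, range_units_val]
  exact Measure.restrict_eq_self_of_ae_mem (by simp [ae_iff])

lemma lintegral_comap_units (f : F → ℝ≥0∞) :
    ∫⁻ a : Fˣ, f a ∂(da.comap Units.val) = ∫⁻ x, f x ∂da := by
  conv_rhs => rw [← map_comap_units da]
  rw [measurableEmbedding_units_val.lintegral_map]

instance : SigmaFinite (da.comap (Units.val : Fˣ → F)) :=
  SigmaFinite.of_map _ measurableEmbedding_units_val.measurable.aemeasurable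
    (by rw [map_comap_units]; infer_instance)

lemma measurable_inv_modulus : Measurable fun a : Fˣ => ((modulus (a : F))⁻¹ : ℝ≥0) :=
  measurable_modulus_units.inv

instance : SigmaFinite (multMeasure da) :=
  SigmaFinite.withDensity fun a : Fˣ => ((modulus (a : F))⁻¹ : ℝ≥0)

lemma lintegral_multMeasure {f : Fˣ → ℝ≥0∞} (hf : Measurable f) :
    ∫⁻ a, f a ∂(multMeasure da) =
      ∫⁻ a : Fˣ, ((modulus (a : F))⁻¹ : ℝ≥0) * f a ∂(da.comap Units.val) := by
  rw [multMeasure, lintegral_withDensity_eq_lintegral_mul _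
    measurable_inv_modulus.coe_nnreal_ennreal hf]
  rfl

/-- The factor |a| cancels the weight of da/|a|, and the point 0 is null. Here |a| will be the
module of the scaling transverse to the orbits. -/
lemma lintegral_modulus_mul_multMeasure {f : F → ℝ≥0∞} (hf : Measurable f) :
    ∫⁻ a : Fˣ, modulus (a : F) * f a ∂(multMeasure da) = ∫⁻ x, f x ∂da := by
  have hm : Measurable fun a : Fˣ => (modulus (a : F) : ℝ≥0∞) * f a :=
    measurable_modulus_units.coe_nnreal_ennreal.mul
      (hf.comp measurableEmbedding_units_val.measurable)
  rw [lintegral_multMeasure da hm, ← lintegral_comap_units da f]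
  congr 1
  ext a
  rw [← mul_assoc, ← ENNReal.coe_mul, inv_mul_cancel₀ (modulus_ne_zero a.ne_zero),
    ENNReal.coe_one, one_mul]

lemma lintegral_comp_mul {b : F} (hb : b ≠ 0) {f : F → ℝ≥0∞} (hf : Measurable f) :
    ∫⁻ x, f (b * x) ∂da = ((modulus b)⁻¹ : ℝ≥0) * ∫⁻ x, f x ∂da := by
  have h := map_smul_addHaar da hb
  rw [finrank_self, pow_one] at h
  rw [← lintegral_map hf (measurable_const_mul b)]
  simp only [smul_eq_mul] at h
  rw [h, lintegral_smul_measure]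
  rfl

lemma lintegral_multMeasure_mul_left (b : Fˣ) {f : Fˣ → ℝ≥0∞} (hf : Measurable f) :
    ∫⁻ a, f (b * a) ∂(multMeasure da) = ∫⁻ a, f a ∂(multMeasure da) := by
  have hb := modulus_ne_zero b.ne_zero
  -- Extending f(a)/|a| by zero to F allows the scaling of the additive Haar measure to be used; its
  -- factor cancels against the weight.
  let g : F → ℝ≥0∞ := Function.extend Units.val
    (fun a : Fˣ => (((modulus (a : F))⁻¹ : ℝ≥0) : ℝ≥0∞) * f a) 0
  have hg : Measurable g := measurableEmbedding_units_val.measurable_extend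
    (measurable_inv_modulus.coe_nnreal_ennreal.mul hf) measurable_zero
  have hgu : ∀ a : Fˣ, g a = ((modulus (a : F))⁻¹ : ℝ≥0) * f a := fun a =>
    Units.val_injective.extend_apply _ _ a
  have h1 : ∀ a : Fˣ, (((modulus (a : F))⁻¹ : ℝ≥0) : ℝ≥0∞) * f (b * a) =
      modulus (b : F) * g (b * a) := by
    intro a
    rw [← Units.val_mul, hgu, Units.val_mul, modulus_mul, mul_inv, ← mul_assoc, ← ENNReal.coe_mul,
      mul_inv_cancel_left₀ hb]
  have hm' : Measurable fun x => g (b * x) := hg.comp (measurable_const_mul _)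
  have hm : Measurable fun a => f (b * a) := hf.comp (measurable_units_mul b)
  rw [lintegral_multMeasure da hm, lintegral_multMeasure da hf]
  simp only [h1, ← hgu]
  rw [lintegral_comap_units da (fun x => (modulus (b : F) : ℝ≥0∞) * g (b * x)),
    lintegral_comap_units da g, lintegral_const_mul _ hm',
    lintegral_comp_mul da b.ne_zero hg, ← mul_assoc, ← ENNReal.coe_mul, mul_inv_cancel₀ hb,
    ENNReal.coe_one, one_mul]

lemma map_mul_left_multMeasure (b : Fˣ) :
    (multMeasure da).map (fun a => b * a) = multMeasure da := by
  ext s hs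
  rw [← lintegral_indicator_one hs, lintegral_map (measurable_one.indicator hs)
    (measurable_units_mul b), lintegral_multMeasure_mul_left da b (measurable_one.indicator hs),
    lintegral_indicator_one hs]

lemma measurableSet_units_annulus (r R : ℝ) :
    MeasurableSet {a : Fˣ | r ≤ ‖(a : F)‖ ∧ ‖(a : F)‖ ≤ R} := by
  have h := measurableEmbedding_units_val.measurable (α := Fˣ) (β := F) |>.norm
  exact (measurableSet_le measurable_const h).inter (measurableSet_le h measurable_const)

/-- Away from 0 the weight 1/|a| is bounded, and a ball has finite additive measure. -/
lemma multMeasure_annulus_lt_top {r : ℝ} (hr : 0 < r) (R : ℝ) :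
    multMeasure da {a : Fˣ | r ≤ ‖(a : F)‖ ∧ ‖(a : F)‖ ≤ R} < ∞ := by
  obtain ⟨f, hf, h⟩ := exists_monotone_modulus (F := F)
  have hs := measurableSet_units_annulus (F := F) r R
  have hle : ∀ a ∈ {a : Fˣ | r ≤ ‖(a : F)‖ ∧ ‖(a : F)‖ ≤ R},
      ((((modulus (a : F))⁻¹ : ℝ≥0) : ℝ≥0∞)) ≤ f r⁻¹ := by
    intro a ha
    rw [← modulus_inv, h _ (inv_ne_zero a.ne_zero), norm_inv]
    exact_mod_cast hf (inv_anti₀ hr ha.1)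
  rw [multMeasure, withDensity_apply _ hs]
  refine (setLIntegral_mono measurable_const hle).trans_lt ?_
  rw [setLIntegral_const]
  refine ENNReal.mul_lt_top ENNReal.coe_lt_top ?_
  rw [measurableEmbedding_units_val.comap_apply]
  refine (measure_mono ?_).trans_lt (measure_closedBall_lt_top (μ := da) (x := 0) (r := R))
  rintro _ ⟨a, ha, rfl⟩
  simpa using ha.2

lemma multMeasure_annulus_pos {r R : ℝ} (hr : r < 1) (hR : 1 < R) :
    0 < multMeasure da {a : Fˣ | r ≤ ‖(a : F)‖ ∧ ‖(a : F)‖ ≤ R} := by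
  rw [pos_iff_ne_zero, multMeasure, Ne, withDensity_apply_eq_zero
    measurable_inv_modulus.coe_nnreal_ennreal]
  have : {a : Fˣ | ((((modulus (a : F))⁻¹ : ℝ≥0) : ℝ≥0∞)) ≠ 0} = Set.univ := by
    ext a
    simpa using modulus_ne_zero a.ne_zero
  rw [this, Set.univ_inter, measurableEmbedding_units_val.comap_apply]
  have ho : IsOpen ({x : F | r < ‖x‖ ∧ ‖x‖ < R} ∩ {0}ᶜ) :=
    ((isOpen_lt continuous_const continuous_norm).inter
      (isOpen_lt continuous_norm continuous_const)).inter isOpen_compl_singleton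
  refine (lt_of_lt_of_le (ho.measure_pos da ⟨1, by simp [hr, hR]⟩) (measure_mono ?_)).ne'
  rintro x ⟨hx, hx0⟩
  exact ⟨Units.mk0 x hx0, ⟨hx.1.le, hx.2.le⟩, rfl⟩

variable {X : Type*} [NormedAddCommGroup X] [NormedSpace F X] [ProperSpace X] [MeasurableSpace X]
  [BorelSpace X]

lemma measurable_units_smul : Measurable fun p : Fˣ × X => (p.1 : F) • p.2 :=
  (measurableEmbedding_units_val.measurable.comp measurable_fst).smul measurable_snd

/-- A weight on `X` whose integral over each orbit of `Fˣ` in `X \ {0}` is one. -/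
lemma exists_orbit_weight : ∃ (ρ : X → ℝ≥0∞) (C : ℝ≥0∞) (r R : ℝ), Measurable ρ ∧
    (∀ x ≠ 0, ∫⁻ a : Fˣ, ρ ((a : F) • x) ∂(multMeasure da) = 1) ∧ C ≠ ∞ ∧ 0 < r ∧
    ∀ x, ρ x ≤ Set.indicator {x | r ≤ ‖x‖ ∧ ‖x‖ ≤ R} (fun _ => C) x := by
  obtain ⟨c, hc⟩ := NormedField.exists_one_lt_norm F
  have hc0 : 0 < ‖c‖ := one_pos.trans hc
  have hci : ‖c‖⁻¹ < 1 := inv_lt_one_of_one_lt₀ hc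
  -- The weight is the indicator of this shell divided by its orbit integral D. Each orbit has a
  -- point of norm in [1, ‖c‖), which every scalar of norm in [‖c‖⁻¹, ‖c‖] keeps inside the shell;
  -- this bounds D below by δ, uniformly in the orbit.
  let S : Set X := {x | ‖c‖⁻¹ ≤ ‖x‖ ∧ ‖x‖ ≤ ‖c‖ ^ 2}
  have hS : MeasurableSet S :=
    (measurableSet_le measurable_const measurable_norm).inter
      (measurableSet_le measurable_norm measurable_const)
  let D : X → ℝ≥0∞ := fun x => ∫⁻ a : Fˣ, S.indicator 1 ((a : F) • x) ∂(multMeasure da)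
  have hind : Measurable (S.indicator (1 : X → ℝ≥0∞)) := measurable_one.indicator hS
  have hDm : Measurable D := by
    have : Measurable fun p : X × Fˣ => S.indicator (1 : X → ℝ≥0∞) ((p.2 : F) • p.1) :=
      hind.comp (measurable_units_smul.comp measurable_swap)
    exact this.lintegral_prod_right
  have hDinv : ∀ (b : Fˣ) (x : X), D ((b : F) • x) = D x := by
    intro b x
    have h := lintegral_multMeasure_mul_left da b
      (f := fun a : Fˣ => S.indicator (1 : X → ℝ≥0∞) ((a : F) • x))
      (hind.comp (measurable_units_smul.comp (measurable_id.prodMk measurable_const)))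
    simp only [D]
    rw [← h]
    congr 1
    ext a
    rw [smul_smul, Units.val_mul, mul_comm]
  have hDS : ∀ x, D x = multMeasure da {a : Fˣ | (a : F) • x ∈ S} := by
    intro x
    have hm : MeasurableSet {a : Fˣ | (a : F) • x ∈ S} :=
      (measurable_units_smul.comp (measurable_id.prodMk measurable_const)) hS
    rw [← lintegral_indicator_one hm]
    rfl
  set δ := multMeasure da {a : Fˣ | ‖c‖⁻¹ ≤ ‖(a : F)‖ ∧ ‖(a : F)‖ ≤ ‖c‖} with hδ
  have hδ0 : 0 < δ := multMeasure_annulus_pos da hci hc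
  have hDbd : ∀ x ≠ 0, δ ≤ D x ∧ D x < ∞ := by
    intro x hx
    obtain ⟨d, hd0, hd1, hd2, -⟩ := rescale_to_shell hc hc0 hx
    rw [div_self hc0.ne'] at hd2
    rw [← hDinv (Units.mk0 d hd0) x, Units.val_mk0, hDS]
    constructor
    · refine measure_mono fun a ha => ⟨?_, ?_⟩
      · rw [norm_smul]
        calc ‖c‖⁻¹ = ‖c‖⁻¹ * 1 := (mul_one _).symm
          _ ≤ _ := mul_le_mul ha.1 hd2 zero_le_one (norm_nonneg _)
      · rw [norm_smul, pow_two]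
        exact mul_le_mul ha.2 hd1.le (norm_nonneg _) hc0.le
    · refine (measure_mono ?_).trans_lt (multMeasure_annulus_lt_top da
        (r := ‖c‖⁻¹ * ‖c‖⁻¹) (by positivity) (‖c‖ ^ 2))
      rintro a ⟨ha1, ha2⟩
      rw [norm_smul] at ha1 ha2
      constructor
      · have : ‖c‖⁻¹ ≤ ‖(a : F)‖ * ‖c‖ :=
          ha1.trans (mul_le_mul_of_nonneg_left hd1.le (norm_nonneg _))
        rwa [← div_eq_mul_inv, div_le_iff₀ hc0]
      · exact (le_mul_of_one_le_right (norm_nonneg _) hd2).trans ha2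
  refine ⟨fun x => S.indicator 1 x / D x, δ⁻¹, ‖c‖⁻¹, ‖c‖ ^ 2, hind.div hDm, fun x hx => ?_,
    ENNReal.inv_ne_top.2 hδ0.ne', by positivity, fun x => ?_⟩
  · simp only [hDinv, div_eq_mul_inv]
    have hm : Measurable fun a : Fˣ => S.indicator (1 : X → ℝ≥0∞) ((a : F) • x) :=
      hind.comp (measurable_units_smul.comp (measurable_id.prodMk measurable_const))
    rw [lintegral_mul_const _ hm]
    exact ENNReal.mul_inv_cancel (hδ0.trans_le (hDbd x hx).1).ne' (hDbd x hx).2.ne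
  · by_cases hx : x ∈ S
    · have hx0 : x ≠ 0 := by
        rintro rfl
        have := hx.1
        rw [norm_zero] at this
        exact (inv_pos.2 hc0).not_ge this
      change S.indicator 1 x / D x ≤ S.indicator (fun _ => δ⁻¹) x
      rw [Set.indicator_of_mem hx, Set.indicator_of_mem hx, Pi.one_apply, one_div]
      exact ENNReal.inv_le_inv.2 (hDbd x hx0).1
    · change S.indicator 1 x / D x ≤ S.indicator (fun _ => δ⁻¹) x
      rw [Set.indicator_of_notMem hx, Set.indicator_of_notMem hx, ENNReal.zero_div]

end MultMeasure

/-! ### An affine chart of the orbit space -/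

section Chart

variable {F : Type*} [NontriviallyNormedField F] [ProperSpace F]
  [MeasurableSpace F] [BorelSpace F]
  {X Y X' : Type*} [NormedAddCommGroup X] [NormedSpace F X] [FiniteDimensional F X]
  [MeasurableSpace X] [BorelSpace X]
  [NormedAddCommGroup Y] [NormedSpace F Y] [FiniteDimensional F Y]
  [MeasurableSpace Y] [BorelSpace Y]
  [NormedAddCommGroup X'] [NormedSpace F X'] [FiniteDimensional F X']
  [MeasurableSpace X'] [BorelSpace X']

/-- The affine section `x' ↦ (1, x')` of the projective space of `X ≃ F × X'`. -/
def chartSection (κ : X ≃L[F] F × X') (x' : X') : X := κ.symm (1, x')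

lemma continuous_chartSection (κ : X ≃L[F] F × X') : Continuous (chartSection κ) :=
  κ.symm.continuous.comp (by fun_prop)

lemma chartSection_ne_zero (κ : X ≃L[F] F × X') (x' : X') : chartSection κ x' ≠ 0 := by
  intro h
  have := congrArg κ h
  rw [chartSection, ContinuousLinearEquiv.apply_symm_apply, map_zero] at this
  exact one_ne_zero (congrArg Prod.fst this)

/-- The map `(a, (x', y)) ↦ (a (1, x'), a⁻¹ y)`. -/
def chartMap (κ : X ≃L[F] F × X') (p : Fˣ × (X' × Y)) : X × Y :=
  ((p.1 : F) • chartSection κ p.2.1, ((p.1⁻¹ : Fˣ) : F) • p.2.2)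

lemma measurable_chartMap (κ : X ≃L[F] F × X') : Measurable (chartMap (Y := Y) κ) := by
  have := FiniteDimensional.proper F X
  have := FiniteDimensional.proper F Y
  have := FiniteDimensional.proper F X'
  refine Measurable.prodMk ?_ ?_
  · exact (measurableEmbedding_units_val.measurable.comp measurable_fst).smul
      ((continuous_chartSection κ).measurable.comp measurable_snd.fst)
  · exact (measurable_units_inv.comp measurable_fst).smul measurable_snd.snd

variable (da : Measure F) [da.IsAddHaarMeasure]

/-- X' has one dimension less than Y, so the determinant of the scaling is a^(n-1) a^(-n) = a⁻¹,
where n = dim Y. -/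
lemma map_chartScale (hd : finrank F Y = finrank F X' + 1) (μX' : Measure X')
    [μX'.IsAddHaarMeasure] (μY : Measure Y) [μY.IsAddHaarMeasure] (a : Fˣ) :
    (μX'.prod μY).map (fun p => ((a : F) • p.1, ((a⁻¹ : Fˣ) : F) • p.2)) =
      modulus (a : F) • μX'.prod μY := by
  have := FiniteDimensional.proper F Y
  have := FiniteDimensional.proper F X'
  let A : X' × Y →ₗ[F] X' × Y :=
    ((a : F) • LinearMap.id).prodMap (((a⁻¹ : Fˣ) : F) • LinearMap.id)
  have hA : LinearMap.det A = (a : F)⁻¹ := by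
    rw [LinearMap.det_prodMap, LinearMap.det_smul, LinearMap.det_smul, LinearMap.det_id,
      LinearMap.det_id, mul_one, mul_one, hd, pow_succ, Units.val_inv_eq_inv_val, ← mul_assoc,
      ← mul_pow, mul_inv_cancel₀ a.ne_zero, one_pow, one_mul]
  have h := map_linearMap_addHaar (μX'.prod μY) (A := A) (by rw [hA]; exact inv_ne_zero a.ne_zero)
  rw [hA, modulus_inv, inv_inv] at h
  exact h

/-- Integration over `X × Y` by first integrating over the orbits of `Fˣ`. -/
theorem exists_map_chartMap_eq (κ : X ≃L[F] F × X') (hd : finrank F Y = finrank F X' + 1)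
    (dw : Measure (X × Y)) [dw.IsAddHaarMeasure] (μY : Measure Y) [μY.IsAddHaarMeasure] :
    ∃ μX' : Measure X', μX'.IsAddHaarMeasure ∧
      ((multMeasure da).prod (μX'.prod μY)).map (chartMap κ) = dw := by
  have := FiniteDimensional.proper F X
  have := FiniteDimensional.proper F Y
  have := FiniteDimensional.proper F X'
  let e : (F × (X' × Y)) ≃L[F] X × Y :=
    (ContinuousLinearEquiv.prodAssoc F F X' Y).symm.trans (κ.symm.prodCongr (.refl F Y))
  have he : ∀ t x' y, e (t, (x', y)) = (κ.symm (t, x'), y) := fun _ _ _ => rfl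
  let μ₀ : Measure X' := Measure.addHaar
  have : (μ₀.prod μY).IsAddHaarMeasure := inferInstance
  have : (da.prod (μ₀.prod μY)).IsAddHaarMeasure := Measure.prod.instIsAddHaarMeasure _ _
  have : ((da.prod (μ₀.prod μY)).map e).IsAddHaarMeasure := e.isAddHaarMeasure_map _
  -- The constant between the two Haar measures is absorbed into the measure on X'.
  obtain ⟨c, hc0, hc⟩ := exists_eq_smul_addHaar dw ((da.prod (μ₀.prod μY)).map e)
  have hinst : (c • μ₀).IsAddHaarMeasure :=
    Measure.IsAddHaarMeasure.nnreal_smul μ₀ hc0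
  refine ⟨c • μ₀, hinst, ?_⟩
  have hdw : dw = (da.prod ((c • μ₀).prod μY)).map e := by
    rw [hc, Measure.prod_smul_left, Measure.prod_smul_right, Measure.map_smul]
  set ν := (c • μ₀).prod μY
  let S : Fˣ × (X' × Y) → F × (X' × Y) :=
    fun p => (p.1, ((p.1 : F) • p.2.1, ((p.1⁻¹ : Fˣ) : F) • p.2.2))
  have hS : Measurable S := by
    refine (measurableEmbedding_units_val.measurable.comp measurable_fst).prodMk
      (Measurable.prodMk ?_ ?_)
    · exact (measurableEmbedding_units_val.measurable.comp measurable_fst).smul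
        measurable_snd.fst
    · exact (measurable_units_inv.comp measurable_fst).smul measurable_snd.snd
  have hchart : chartMap κ = e ∘ S := by
    ext1 p
    simp only [S, Function.comp_apply, he, chartMap, chartSection]
    rw [← map_smul, Prod.smul_mk, smul_eq_mul, mul_one]
  rw [hdw, hchart, ← Measure.map_map e.continuous.measurable hS]
  congr 1
  refine Measure.ext_of_lintegral _ fun f hf => ?_
  have hfS : Measurable fun p => f (S p) := hf.comp hS
  rw [lintegral_map hf hS, lintegral_prod _ hfS.aemeasurable,
    lintegral_prod _ hf.aemeasurable]
  have hinner : ∀ a : Fˣ, ∫⁻ p, f (S (a, p)) ∂ν = modulus (a : F) * ∫⁻ p, f (a, p) ∂ν := by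
    intro a
    have hfa : Measurable fun p => f ((a : F), p) := hf.comp measurable_prodMk_left
    have h1 := congrArg (fun m : Measure (X' × Y) => ∫⁻ p, f ((a : F), p) ∂m)
      (map_chartScale hd (c • μ₀) μY a)
    rw [lintegral_smul_measure, lintegral_map hfa (by fun_prop)] at h1
    exact h1
  simp only [hinner]
  exact lintegral_modulus_mul_multMeasure da hf.lintegral_prod_right'

end Chart
end

noncomputable section

/-! ### The measure on the endomorphisms of rank one -/

section RankOne

variable {F : Type*} [NontriviallyNormedField F] [ProperSpace F] [IsUltrametricDist F]
  {X Y X' : Type*} [NormedAddCommGroup X] [NormedSpace F X] [FiniteDimensional F X]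
  [NormedAddCommGroup Y] [NormedSpace F Y] [FiniteDimensional F Y]
  [NormedAddCommGroup X'] [NormedSpace F X'] [FiniteDimensional F X']

/-- The map `y ↦ B(·, y)` attached to a bilinear form. -/
def pairCLM (B : X →ₗ[F] Y →ₗ[F] F) : Y →L[F] X →L[F] F :=
  LinearMap.toContinuousLinearMap (LinearMap.toContinuousLinearMap.toLinearMap ∘ₗ B.flip)

lemma pairCLM_apply (B : X →ₗ[F] Y →ₗ[F] F) (y : Y) (x : X) : pairCLM B y x = B x y := rfl

/-- The endomorphism `v ↦ -B(v, y) x` of `X`. -/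
def rankOneEnd (B : X →ₗ[F] Y →ₗ[F] F) (x : X) (y : Y) : X →L[F] X :=
  (pairCLM B y).smulRight (-x)

variable (B : X →ₗ[F] Y →ₗ[F] F)

lemma rankOneEnd_apply (x : X) (y : Y) (v : X) : rankOneEnd B x y v = -(B v y • x) := by
  simp [rankOneEnd, pairCLM_apply]

lemma continuous_rankOneEnd : Continuous fun p : X × Y => rankOneEnd B p.1 p.2 := by
  have : (fun p : X × Y => rankOneEnd B p.1 p.2) =
      fun p => ContinuousLinearMap.smulRightL F X X (pairCLM B p.2) (-p.1) := rfl
  rw [this]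
  fun_prop

/-- The factors a and a⁻¹ cancel, so the map (x, y) ↦ R(x, y) descends to the orbit space. -/
lemma rankOneEnd_smul (a : Fˣ) (x : X) (y : Y) :
    rankOneEnd B ((a : F) • x) (((a⁻¹ : Fˣ) : F) • y) = rankOneEnd B x y := by
  ext v
  rw [rankOneEnd_apply, rankOneEnd_apply, map_smul, smul_smul, smul_eq_mul, mul_comm, ← mul_assoc,
    ← Units.val_mul, mul_inv_cancel, Units.val_one, one_mul]

/-- The sign in `rankOneEnd` makes -tr(zR(x, y)), the phase of the Fourier transform, equal to B(zx,
y), the phase of chc. -/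
lemma trace_mul_rankOneEnd (z : X →L[F] X) (x : X) (y : Y) :
    LinearMap.trace F X ((z * rankOneEnd B x y : X →L[F] X) : X →ₗ[F] X) = -B (z x) y := by
  have : ((z * rankOneEnd B x y : X →L[F] X) : X →ₗ[F] X) =
      (B.flip y).smulRight (-(z x)) := by
    ext v
    change z (rankOneEnd B x y v) = B v y • (-(z x))
    rw [rankOneEnd_apply, map_neg, map_smul, smul_neg]
  rw [this, LinearMap.trace_smulRight, map_neg]
  rfl

lemma finrank_range_rankOneEnd (hB : ∀ y, (∀ v, B v y = 0) → y = 0) {x : X} {y : Y} (hx : x ≠ 0)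
    (hy : y ≠ 0) : rankOneEnd B x y ∈ rankSet F X 1 := by
  obtain ⟨v, hv⟩ : ∃ v, B v y ≠ 0 := by
    by_contra! h
    exact hy (hB y h)
  have : LinearMap.range (rankOneEnd B x y : X →ₗ[F] X) = F ∙ x := by
    apply le_antisymm
    · rintro _ ⟨u, rfl⟩
      change rankOneEnd B x y u ∈ _
      rw [rankOneEnd_apply]
      exact Submodule.neg_mem _ (Submodule.smul_mem _ _ (Submodule.mem_span_singleton_self x))
    · rw [Submodule.span_singleton_le_iff_mem]
      refine ⟨-(B v y)⁻¹ • v, ?_⟩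
      change rankOneEnd B x y _ = _
      rw [rankOneEnd_apply, map_smul, LinearMap.smul_apply, smul_eq_mul, neg_mul,
        inv_mul_cancel₀ hv, neg_smul, one_smul, neg_neg]
  rw [rankSet, Set.mem_ofPred_eq, this, finrank_span_singleton hx]

/-- The operator norm of R(x, y) is ‖B(·, y)‖‖x‖, and the injective linear map y ↦ B(·, y) between
finite-dimensional spaces is bounded below. -/
lemma exists_le_norm_rankOneEnd (hB : ∀ y, (∀ v, B v y = 0) → y = 0) :
    ∃ c > 0, ∀ x y, ‖x‖ * ‖y‖ ≤ c * ‖rankOneEnd B x y‖ := by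
  have := FiniteDimensional.complete F Y
  have hinj : Function.Injective (pairCLM B) := by
    refine (injective_iff_map_eq_zero _).2 fun y hy => hB y fun v => ?_
    rw [← pairCLM_apply, hy]
    rfl
  obtain ⟨K, hK, h⟩ := (pairCLM B : Y →ₗ[F] X →L[F] F).exists_antilipschitzWith
    (LinearMap.ker_eq_bot.2 hinj)
  refine ⟨K, by exact_mod_cast hK, fun x y => ?_⟩
  have h1 : ‖y‖ ≤ K * ‖pairCLM B y‖ := by
    have := h.le_mul_dist y 0
    rw [map_zero, dist_zero_right, dist_zero_right] at this
    exact this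
  rw [rankOneEnd, ContinuousLinearMap.norm_smulRight_apply, norm_neg]
  calc ‖x‖ * ‖y‖ ≤ ‖x‖ * (K * ‖pairCLM B y‖) := by gcongr
    _ = _ := by ring

variable [MeasurableSpace F] [BorelSpace F] [MeasurableSpace X] [BorelSpace X]
  [MeasurableSpace Y] [BorelSpace Y] [MeasurableSpace X'] [BorelSpace X']
  (κ : X ≃L[F] F × X') (μX' : Measure X') [μX'.IsAddHaarMeasure]
  (μY : Measure Y) [μY.IsAddHaarMeasure]

/-- The map `(x', y) ↦ (v ↦ -B(v, y) (1, x'))`. -/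
def rankOneChart (p : X' × Y) : X →L[F] X := rankOneEnd B (chartSection κ p.1) p.2

lemma continuous_rankOneChart : Continuous (rankOneChart B κ) :=
  (continuous_rankOneEnd B).comp (f := fun p : X' × Y => (chartSection κ p.1, p.2))
    (((continuous_chartSection κ).comp continuous_fst).prodMk continuous_snd)

/-- The measure on the endomorphisms of rank one. -/
def rankOneMeasure : Measure (X →L[F] X) := (μX'.prod μY).map (rankOneChart B κ)

variable {B κ μX' μY} {da : Measure F} [da.IsAddHaarMeasure] {dw : Measure (X × Y)}
  [dw.IsAddHaarMeasure] (hK : ((multMeasure da).prod (μX'.prod μY)).map (chartMap κ) = dw)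

include hK in
-- In the chart, R does not depend on the orbit variable and ρ integrates to one over it. The left
-- side involves no chart, so finiteness and relative invariance can be read off from dw.
lemma lintegral_weight_mul {ρ : X → ℝ≥0∞} (hρ : Measurable ρ)
    (hρ1 : ∀ x ≠ 0, ∫⁻ a : Fˣ, ρ ((a : F) • x) ∂(multMeasure da) = 1)
    {G : (X →L[F] X) → ℝ≥0∞} (hG : Measurable G) :
    ∫⁻ w, ρ w.1 * G (rankOneEnd B w.1 w.2) ∂dw = ∫⁻ z, G z ∂(rankOneMeasure B κ μX' μY) := by
  have := FiniteDimensional.proper F X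
  have := FiniteDimensional.proper F Y
  have := FiniteDimensional.proper F X'
  have hG' : Measurable fun p : X' × Y => G (rankOneChart B κ p) :=
    hG.comp (continuous_rankOneChart B κ).measurable
  have hm : Measurable fun w : X × Y => ρ w.1 * G (rankOneEnd B w.1 w.2) :=
    (hρ.comp measurable_fst).mul (hG.comp (continuous_rankOneEnd B).measurable)
  rw [← hK, lintegral_map hm (measurable_chartMap κ), rankOneMeasure,
    lintegral_map hG (continuous_rankOneChart B κ).measurable]
  have hm2 : Measurable fun p : Fˣ × (X' × Y) =>
      ρ (chartMap κ p).1 * G (rankOneEnd B (chartMap κ p).1 (chartMap κ p).2) :=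
    hm.comp (measurable_chartMap κ)
  rw [lintegral_prod_symm _ hm2.aemeasurable]
  congr 1
  ext p
  have hs : Measurable fun a : Fˣ => ρ ((a : F) • chartSection κ p.1) :=
    hρ.comp (measurable_units_smul.comp (measurable_id.prodMk measurable_const))
  simp only [chartMap, rankOneEnd_smul]
  rw [lintegral_mul_const _ hs, hρ1 _ (chartSection_ne_zero κ p.1), one_mul]
  rfl

include hK in
-- The weight confines x to a shell away from 0, and R(x, y) in K then bounds y. So the integral
-- runs over a compact subset of X × Y.
lemma isFiniteMeasureOnCompacts_rankOneMeasure (hB : ∀ y, (∀ v, B v y = 0) → y = 0) :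
    IsFiniteMeasureOnCompacts (rankOneMeasure B κ μX' μY) := by
  have := FiniteDimensional.proper F X
  have := FiniteDimensional.proper F Y
  obtain ⟨ρ, C, r, R, hρ, hρ1, hC, hr, hρb⟩ := exists_orbit_weight (X := X) da
  obtain ⟨c, hc, hcb⟩ := exists_le_norm_rankOneEnd B hB
  refine ⟨fun K hK' => ?_⟩
  obtain ⟨S, hS⟩ := hK'.isBounded.exists_norm_le
  rw [← lintegral_indicator_one hK'.measurableSet,
    ← lintegral_weight_mul hK hρ hρ1 (measurable_one.indicator hK'.measurableSet)]
  let T : Set (X × Y) := Metric.closedBall 0 R ×ˢ Metric.closedBall 0 (r⁻¹ * (c * S))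
  have hT : IsCompact T := (isCompact_closedBall _ _).prod (isCompact_closedBall _ _)
  refine (lintegral_mono (g := T.indicator fun _ => C) fun w => ?_).trans_lt ?_
  · by_cases hw : r ≤ ‖w.1‖ ∧ ‖w.1‖ ≤ R
    · have h1 : ρ w.1 ≤ C := by simpa [Set.indicator, hw] using hρb w.1
      by_cases hwK : rankOneEnd B w.1 w.2 ∈ K
      · have hwT : w ∈ T := by
          refine ⟨by simpa using hw.2, ?_⟩
          rw [mem_closedBall_zero_iff, ← div_eq_inv_mul, le_div_iff₀' hr]
          calc r * ‖w.2‖ ≤ ‖w.1‖ * ‖w.2‖ := by gcongr; exact hw.1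
            _ ≤ c * ‖rankOneEnd B w.1 w.2‖ := hcb _ _
            _ ≤ c * S := by gcongr; exact hS _ hwK
        simpa [Set.indicator_of_mem hwK, Set.indicator_of_mem hwT] using h1
      · simp [Set.indicator_of_notMem hwK]
    · have h1 : ρ w.1 = 0 := by
        have := hρb w.1
        rwa [Set.indicator_of_notMem (by exact hw), nonpos_iff_eq_zero] at this
      simp [h1]
  · rw [lintegral_indicator hT.measurableSet, setLIntegral_const]
    exact ENNReal.mul_lt_top hC.lt_top hT.measure_lt_top

/-- The transpose of an endomorphism of `X` with respect to a nondegenerate pairing. -/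
lemma exists_transpose (hB : ∀ y, (∀ v, B v y = 0) → y = 0) (hd : finrank F X = finrank F Y)
    (h : X →ₗ[F] X) : ∃ t : Y →ₗ[F] Y, LinearMap.det t = LinearMap.det h ∧
      ∀ v y, B v (t y) = B (h v) y := by
  have hinj : Function.Injective B.flip := by
    refine (injective_iff_map_eq_zero _).2 fun y hy => hB y fun v => ?_
    exact LinearMap.congr_fun hy v
  let e : Y ≃ₗ[F] Dual F X := B.flip.linearEquivOfInjective hinj
    (by rw [Subspace.dual_finrank_eq, hd])
  refine ⟨e.symm ∘ₗ h.dualMap ∘ₗ e, ?_, fun v y => ?_⟩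
  · have := LinearMap.det_conj h.dualMap e.symm
    rw [LinearEquiv.symm_symm] at this
    rw [this, LinearMap.det_dualMap]
  · have h1 : e ((e.symm ∘ₗ h.dualMap ∘ₗ e) y) = h.dualMap (e y) := by simp
    exact LinearMap.congr_fun h1 v

include hK in
-- Since g⁻¹R(x, y)h = R(g⁻¹x, ty) for the transpose t of h, the factor is the one by which A =
-- (g⁻¹, t) scales dw. The substitution replaces ρ by ρ ∘ g, which is again a weight with orbit
-- integrals one.
lemma map_actHomeo_rankOneMeasure (hB : ∀ y, (∀ v, B v y = 0) → y = 0)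
    (hd : finrank F X = finrank F Y) (g h : (X →L[F] X)ˣ) :
    (rankOneMeasure B κ μX' μY).map (actHomeo g h).symm =
      transformFactorNN 1 g h • rankOneMeasure B κ μX' μY := by
  have := FiniteDimensional.proper F X
  have := FiniteDimensional.proper F Y
  obtain ⟨ρ, C, r, R, hρ, hρ1, -, -, -⟩ := exists_orbit_weight (X := X) da
  obtain ⟨t, ht, ht'⟩ := exists_transpose hB hd ((h : X →L[F] X) : X →ₗ[F] X)
  let A : X × Y →ₗ[F] X × Y := ((g⁻¹ : (X →L[F] X)ˣ) : X →L[F] X).toLinearMap.prodMap t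
  have hA : LinearMap.det A = ((g : X →L[F] X).det)⁻¹ * (h : X →L[F] X).det := by
    rw [LinearMap.det_prodMap, ht, ← det_units_inv]
  have hA0 : LinearMap.det A ≠ 0 := by
    rw [hA]
    exact mul_ne_zero (inv_ne_zero (det_units_ne_zero g)) (det_units_ne_zero h)
  have hmap := map_linearMap_addHaar dw hA0
  have hfac : (modulus (LinearMap.det A))⁻¹ = transformFactorNN 1 g h := by
    rw [hA, modulus_mul, modulus_inv, mul_inv, inv_inv, transformFactorNN, pow_one, pow_one]
  rw [hfac] at hmap
  have hAm : Measurable A := A.continuous_of_finiteDimensional.measurable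
  refine Measure.ext_of_lintegral _ fun G hG => ?_
  have hact : ∀ x y, (actHomeo g h).symm (rankOneEnd B x y) =
      rankOneEnd B (A (x, y)).1 (A (x, y)).2 := by
    intro x y
    ext v
    change ((g⁻¹ : (X →L[F] X)ˣ) : X →L[F] X) (rankOneEnd B x y ((h : X →L[F] X) v)) = _
    rw [rankOneEnd_apply, rankOneEnd_apply, map_neg, map_smul]
    congr 2
    exact (ht' v y).symm
  have hρg : Measurable fun x => ρ ((g : X →L[F] X) x) :=
    hρ.comp (g : X →L[F] X).continuous.measurable
  have hρg1 : ∀ x ≠ 0, ∫⁻ a : Fˣ, ρ ((g : X →L[F] X) ((a : F) • x)) ∂(multMeasure da) = 1 := by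
    intro x hx
    simp only [map_smul]
    refine hρ1 _ fun h0 => hx ?_
    have h1 : ((g⁻¹ : (X →L[F] X)ˣ) * (g : X →L[F] X) : X →L[F] X) x = 0 := by
      change ((g⁻¹ : (X →L[F] X)ˣ) : X →L[F] X) ((g : X →L[F] X) x) = 0
      rw [h0, map_zero]
    rwa [Units.inv_mul] at h1
  have hGg : Measurable fun z => G ((actHomeo g h).symm z) :=
    hG.comp (actHomeo g h).symm.continuous.measurable
  rw [lintegral_map hG (actHomeo g h).symm.continuous.measurable, lintegral_smul_measure,
    ← lintegral_weight_mul hK hρ hρ1 hGg,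
    ← lintegral_weight_mul hK hρg hρg1 hG]
  have hm : Measurable fun w : X × Y => ρ ((g : X →L[F] X) w.1) * G (rankOneEnd B w.1 w.2) :=
    (hρg.comp measurable_fst).mul (hG.comp (continuous_rankOneEnd B).measurable)
  rw [← lintegral_smul_measure, ← hmap, lintegral_map hm hAm]
  refine lintegral_congr fun w => ?_
  rw [hact w.1 w.2]
  congr 2
  change w.1 = ((g : X →L[F] X) * ((g⁻¹ : (X →L[F] X)ˣ) : X →L[F] X)) w.1
  rw [Units.mul_inv]
  rfl

lemma ae_snd_ne_zero (hY : 0 < finrank F Y) : ∀ᵐ p ∂(μX'.prod μY), p.2 ≠ 0 := by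
  have := FiniteDimensional.proper F Y
  have := FiniteDimensional.proper F X'
  have : Nontrivial Y := finrank_pos_iff.1 hY
  have h1 : ∀ᵐ y ∂μY, y ≠ 0 := by
    obtain ⟨v, hv⟩ := exists_ne (0 : Y)
    refine measure_eq_zero_of_countable_lines (F := F) μY (N := {y | ¬ y ≠ 0}) (by simp) v
      fun w => ?_
    refine Set.Subsingleton.countable fun s hs t ht => ?_
    simp only [Set.mem_ofPred_eq, not_not] at hs ht
    have h := add_left_cancel (hs.trans ht.symm)
    exact smul_left_injective F hv h
  exact Measure.quasiMeasurePreserving_snd.ae h1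

lemma rankOneMeasure_compl_rankSet (hY : 0 < finrank F Y)
    (hB : ∀ y, (∀ v, B v y = 0) → y = 0) :
    rankOneMeasure B κ μX' μY (rankSet F X 1)ᶜ = 0 := by
  have := FiniteDimensional.proper F Y
  have := FiniteDimensional.proper F X'
  rw [rankOneMeasure, Measure.map_apply (continuous_rankOneChart B κ).measurable
    (measurableSet_rankSet 1).compl]
  have h := ae_snd_ne_zero (μX' := μX') (μY := μY) hY
  refine measure_mono_null (t := {p | ¬ p.2 ≠ 0}) (fun p hp h0 => ?_) h
  exact hp (finrank_range_rankOneEnd B hB (chartSection_ne_zero κ p.1) h0)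

lemma rankOneMeasure_ne_zero : rankOneMeasure B κ μX' μY ≠ 0 := by
  have := FiniteDimensional.proper F Y
  have := FiniteDimensional.proper F X'
  rw [rankOneMeasure, Ne, Measure.map_eq_zero_iff (continuous_rankOneChart B κ).aemeasurable]
  exact NeZero.ne _

end RankOne
end

noncomputable section

/-! ### The trace form on endomorphisms -/

section TraceForm

variable {F : Type*} [NontriviallyNormedField F] [ProperSpace F] [IsUltrametricDist F]
  {X : Type*} [NormedAddCommGroup X] [NormedSpace F X] [FiniteDimensional F X]

variable (F X) in
/-- The pairing `(z, y) ↦ -tr(z y)` on `End(X)`. -/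
def negTraceForm : (X →L[F] X) →ₗ[F] (X →L[F] X) →ₗ[F] F :=
  LinearMap.mk₂ F (fun z y => -LinearMap.trace F X ((z * y : X →L[F] X) : X →ₗ[F] X))
    (fun z z' y => by
      rw [add_mul, ContinuousLinearMap.toLinearMap_add, map_add, neg_add])
    (fun c z y => by
      rw [smul_mul_assoc, ContinuousLinearMap.toLinearMap_smul, map_smul, smul_neg])
    (fun z y y' => by
      rw [mul_add, ContinuousLinearMap.toLinearMap_add, map_add, neg_add])
    (fun c z y => by
      rw [mul_smul_comm, ContinuousLinearMap.toLinearMap_smul, map_smul, smul_neg])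

lemma negTraceForm_apply (z y : X →L[F] X) :
    negTraceForm F X z y = -LinearMap.trace F X ((z * y : X →L[F] X) : X →ₗ[F] X) := rfl

/-- Pairing y with the rank one endomorphism attached to a functional f and a vector v gives -f(yv).
-/
lemma negTraceForm_separating (y : X →L[F] X) (h : ∀ z, negTraceForm F X z y = 0) : y = 0 := by
  ext v
  refine (forall_dual_apply_eq_zero_iff F _).1 fun f => ?_
  have h1 := h ((LinearMap.toContinuousLinearMap f).smulRight v)
  rw [negTraceForm_apply, neg_eq_zero] at h1
  have h2 : (((LinearMap.toContinuousLinearMap f).smulRight v * y : X →L[F] X) : X →ₗ[F] X) =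
      (f ∘ₗ (y : X →ₗ[F] X)).smulRight v := rfl
  rw [h2, LinearMap.trace_smulRight] at h1
  exact h1

variable [MeasurableSpace F] [BorelSpace F]

lemma endFourier_eq_pairFourier (χ : AddChar F Circle) (dz : Measure (X →L[F] X))
    (ψ : (X →L[F] X) → ℂ) :
    endFourier χ dz ψ = pairFourier χ (negTraceForm F X) dz ψ := rfl

lemma endFourier_mem {χ : AddChar F Circle}
    (hχc : ∀ x : F, (∀ a : F, ‖a‖ ≤ 1 → χ (a * x) = 1) ↔ ‖x‖ ≤ 1) (dz : Measure (X →L[F] X))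
    [dz.IsAddHaarMeasure] (ψ : SchwartzBruhat (X →L[F] X)) :
    endFourier χ dz (ψ : (X →L[F] X) → ℂ) ∈ SchwartzBruhat (X →L[F] X) := by
  obtain ⟨e, e', he⟩ := exists_coordinates_of_pairing (negTraceForm F X) negTraceForm_separating rfl
  exact pairFourier_mem hχc dz he ψ

/-- Recording the values on a basis identifies End(X) with a power of X, on which left
multiplication acts componentwise. -/
lemma det_mulLeft_clm (g : X →L[F] X) :
    LinearMap.det (LinearMap.mulLeft F g) = g.det ^ finrank F X := by
  let b := Module.finBasis F X
  let e : (X →L[F] X) ≃ₗ[F] (Fin (finrank F X) → X) :=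
    LinearMap.toContinuousLinearMap.symm ≪≫ₗ (b.constr F).symm
  have h := LinearMap.det_conj (LinearMap.mulLeft F g) e
  have h2 : e.toLinearMap ∘ₗ LinearMap.mulLeft F g ∘ₗ e.symm.toLinearMap =
      LinearMap.pi fun i => (g : X →ₗ[F] X) ∘ₗ LinearMap.proj i := by
    refine LinearMap.ext fun f => ?_
    obtain ⟨z, rfl⟩ := e.surjective f
    simp only [LinearMap.comp_apply, LinearEquiv.coe_coe, LinearEquiv.symm_apply_apply]
    ext1 i
    rfl
  rw [← h, h2, LinearMap.det_pi, Finset.prod_const, Finset.card_univ, Fintype.card_fin]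

/-- Under the trace form, right multiplication by h is adjoint to left multiplication by h. -/
lemma det_mulRight_clm (h : X →L[F] X) :
    LinearMap.det (LinearMap.mulRight F h) = h.det ^ finrank F X := by
  obtain ⟨t, ht, ht'⟩ := exists_transpose (B := negTraceForm F X) negTraceForm_separating rfl
    (LinearMap.mulRight F h)
  have : t = LinearMap.mulLeft F h := by
    ext1 y
    rw [← sub_eq_zero]
    refine negTraceForm_separating _ fun z => ?_
    rw [map_sub, ht', sub_eq_zero, negTraceForm_apply, negTraceForm_apply,
      LinearMap.mulLeft_apply, LinearMap.mulRight_apply, mul_assoc]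
  rw [← ht, this, det_mulLeft_clm]

lemma map_actHomeo_addHaar (dz : Measure (X →L[F] X)) [dz.IsAddHaarMeasure]
    (g h : (X →L[F] X)ˣ) :
    dz.map (actHomeo g h) = transformFactorNN (finrank F X) h g • dz := by
  let A : (X →L[F] X) →ₗ[F] (X →L[F] X) :=
    LinearMap.mulRight F ((h⁻¹ : (X →L[F] X)ˣ) : X →L[F] X) ∘ₗ LinearMap.mulLeft F (g : X →L[F] X)
  have hA : LinearMap.det A = ((h : X →L[F] X).det)⁻¹ ^ finrank F X *
      (g : X →L[F] X).det ^ finrank F X := by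
    rw [LinearMap.det_comp, det_mulRight_clm, det_mulLeft_clm, det_units_inv]
  have hA0 : LinearMap.det A ≠ 0 := by
    rw [hA]
    exact mul_ne_zero (pow_ne_zero _ (inv_ne_zero (det_units_ne_zero h)))
      (pow_ne_zero _ (det_units_ne_zero g))
  have := map_linearMap_addHaar dz hA0
  have hfac : (modulus (LinearMap.det A))⁻¹ = transformFactorNN (finrank F X) h g := by
    rw [hA, modulus_mul, modulus_pow, modulus_pow, modulus_inv, mul_inv, ← inv_pow, inv_inv,
      transformFactorNN]
  rw [hfac] at this
  exact this

/-- The substitution z ↦ gzh⁻¹ scales dz with exponent n, and the cyclicity of the trace moves g and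
h to the other variable with their roles exchanged. -/
lemma endFourier_leftRight (χ : AddChar F Circle) (dz : Measure (X →L[F] X))
    [dz.IsAddHaarMeasure] (g h : (X →L[F] X)ˣ) (ψ : SchwartzBruhat (X →L[F] X))
    (y : X →L[F] X) :
    endFourier χ dz (leftRight g h ψ : SchwartzBruhat (X →L[F] X)) y =
      ((transformFactorNN (finrank F X) g h : ℝ≥0) : ℂ) *
        endFourier χ dz (ψ : (X →L[F] X) → ℂ) ((actHomeo h g).symm y) := by
  have h1 : dz = transformFactorNN (finrank F X) g h • dz.map (actHomeo g h) := by
    rw [map_actHomeo_addHaar, smul_smul]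
    have : transformFactorNN (finrank F X) g h * transformFactorNN (finrank F X) h g = 1 := by
      have hg := pow_ne_zero (finrank F X) (modulus_ne_zero (det_units_ne_zero g))
      have hh := pow_ne_zero (finrank F X) (modulus_ne_zero (det_units_ne_zero h))
      rw [transformFactorNN, transformFactorNN]
      field_simp
    rw [this, one_smul]
  unfold endFourier
  conv_lhs => rw [h1]
  rw [integral_smul_nnreal_measure, NNReal.smul_def, Complex.real_smul,
    (actHomeo g h).isClosedEmbedding.measurableEmbedding.integral_map]
  congr 2
  ext z
  have h2 : (leftRight g h ψ : (X →L[F] X) → ℂ) (actHomeo g h z) = (ψ : (X →L[F] X) → ℂ) z :=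
    congrArg (ψ : (X →L[F] X) → ℂ) ((actHomeo g h).symm_apply_apply z)
  have h3 : LinearMap.trace F X ((actHomeo g h z * y : X →L[F] X) : X →ₗ[F] X) =
      LinearMap.trace F X ((z * (actHomeo h g).symm y : X →L[F] X) : X →ₗ[F] X) := by
    have e1 : ((actHomeo g h z * y : X →L[F] X) : X →ₗ[F] X) =
        ((g : X →L[F] X) : X →ₗ[F] X) * ((z * ((h⁻¹ : (X →L[F] X)ˣ) : X →L[F] X) * y : X →L[F] X) :
          X →ₗ[F] X) := rfl
    rw [e1, LinearMap.trace_mul_comm]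
    rfl
  rw [h2, h3]

end TraceForm
end

noncomputable section

/-! ### Partial integrals of Schwartz-Bruhat functions -/

lemma SchwartzBruhat.comp_homeomorph_mem {U V : Type*} [TopologicalSpace U] [TopologicalSpace V]
    (e : U ≃ₜ V) (ψ : SchwartzBruhat V) : (fun u => (ψ : V → ℂ) (e u)) ∈ SchwartzBruhat U :=
  ⟨ψ.2.1.comp_continuous e.continuous, ψ.2.2.comp_homeomorph e⟩

/-- Integrating out a variable maps Schwartz-Bruhat functions to Schwartz-Bruhat functions. -/
lemma SchwartzBruhat.integral_fst_mem {U V : Type*} [NormedAddCommGroup U] [NormedAddCommGroup V]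
    [MeasurableSpace U] (μ : Measure U) (ψ : SchwartzBruhat (U × V)) :
    (fun v => ∫ u, (ψ : U × V → ℂ) (u, v) ∂μ) ∈ SchwartzBruhat V := by
  obtain ⟨ε, hε, h⟩ := SchwartzBruhat.exists_forall_add_eq ψ
  constructor
  · refine (IsLocallyConstant.iff_eventually_eq _).2 fun v => ?_
    filter_upwards [Metric.ball_mem_nhds v hε] with v' hv'
    congr 1
    ext u
    have := h (u, v) (0, v' - v) (by
      rw [Prod.norm_mk, norm_zero, max_eq_right (norm_nonneg _), ← dist_eq_norm]
      exact hv')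
    rwa [Prod.mk_add_mk, add_zero, add_sub_cancel] at this
  · refine HasCompactSupport.intro (ψ.2.2.isCompact.image continuous_snd) fun v hv => ?_
    have : ∀ u, (ψ : U × V → ℂ) (u, v) = 0 := fun u =>
      image_eq_zero_of_notMem_tsupport fun hu => hv ⟨(u, v), hu, rfl⟩
    simp [this]

/-! ### The measure on the endomorphisms of corank one -/

section Corank

variable {F : Type*} [NontriviallyNormedField F] [ProperSpace F] [IsUltrametricDist F]
  {X Y X' : Type*} [NormedAddCommGroup X] [NormedSpace F X] [FiniteDimensional F X]
  [NormedAddCommGroup Y] [NormedSpace F Y] [FiniteDimensional F Y]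
  [NormedAddCommGroup X'] [NormedSpace F X'] [FiniteDimensional F X']

/-- The isomorphism `Hom(X', X) × X ≃ End(X)` given by a splitting `X ≃ F × X'`. -/
def splitEnd (κ : X ≃L[F] F × X') : ((X' →L[F] X) × X) ≃L[F] (X →L[F] X) :=
  LinearEquiv.toContinuousLinearEquiv
    { toFun := fun p => (p.1.comp (ContinuousLinearMap.snd F F X') +
        (ContinuousLinearMap.fst F F X').smulRight p.2).comp (κ : X →L[F] F × X')
      map_add' := fun p q => by ext v; simp; abel
      map_smul' := fun c p => by ext v; simp [smul_comm c]
      invFun := fun z => (z.comp ((κ.symm : F × X' →L[F] X).comp (ContinuousLinearMap.inr F F X')),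
        z (κ.symm (1, 0)))
      left_inv := fun p => by
        ext1
        · ext v; simp
        · simp
      right_inv := fun z => by
        ext v
        simp only [ContinuousLinearMap.comp_apply, add_apply,
          ContinuousLinearMap.smulRight_apply, ContinuousLinearMap.inr_apply,
          ContinuousLinearMap.coe_fst', ContinuousLinearMap.coe_snd', ContinuousLinearEquiv.coe_coe]
        rw [← map_smul, ← map_smul, ← map_add, ← map_add, Prod.smul_mk, Prod.mk_add_mk,
          smul_eq_mul, mul_one, smul_zero, zero_add, add_zero]
        exact congrArg z (κ.symm_apply_apply v) }

lemma splitEnd_apply (κ : X ≃L[F] F × X') (p : (X' →L[F] X) × X) (v : X) :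
    splitEnd κ p v = p.1 (κ v).2 + (κ v).1 • p.2 := rfl

lemma splitEnd_chartSection (κ : X ≃L[F] F × X') (p : (X' →L[F] X) × X) (x' : X') :
    splitEnd κ p (chartSection κ x') = p.1 x' + p.2 := by
  rw [splitEnd_apply, chartSection, ContinuousLinearEquiv.apply_symm_apply, one_smul]

/-- The endomorphisms `z` with `z (1, x') = u`, parametrized by their restriction to `X'`. -/
def shearEnd (κ : X ≃L[F] F × X') (x' : X') : ((X' →L[F] X) × X) ≃ₜ (X →L[F] X) :=
  Homeomorph.trans
    { toFun := fun p => (p.1, p.2 - p.1 x')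
      invFun := fun p => (p.1, p.2 + p.1 x')
      left_inv := fun p => by simp
      right_inv := fun p => by simp
      continuous_toFun := by fun_prop
      continuous_invFun := by fun_prop }
    (splitEnd κ).toHomeomorph

lemma shearEnd_apply (κ : X ≃L[F] F × X') (x' : X') (p : (X' →L[F] X) × X) :
    shearEnd κ x' p = splitEnd κ (p.1, p.2 - p.1 x') := rfl

lemma shearEnd_chartSection (κ : X ≃L[F] F × X') (x' : X') (p : (X' →L[F] X) × X) :
    shearEnd κ x' p (chartSection κ x') = p.2 := by
  rw [shearEnd_apply, splitEnd_chartSection, add_sub_cancel]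

/-- The map sending `(x', z')` to the endomorphism that kills `(1, x')` and is `z'` on `X'`. -/
def corankChart (κ : X ≃L[F] F × X') (p : X' × (X' →L[F] X)) : X →L[F] X :=
  shearEnd κ p.1 (p.2, 0)

lemma continuous_corankChart (κ : X ≃L[F] F × X') : Continuous (corankChart κ) :=
  (splitEnd κ).continuous.comp
    (f := fun p : X' × (X' →L[F] X) => (p.2, 0 - p.2 p.1)) (by fun_prop)

lemma range_corankChart (κ : X ≃L[F] F × X') (p : X' × (X' →L[F] X)) :
    LinearMap.range (corankChart κ p : X →ₗ[F] X) = LinearMap.range (p.2 : X' →ₗ[F] X) := by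
  have key : ∀ v, corankChart κ p v = p.2 ((κ v).2 - (κ v).1 • p.1) := fun v => by
    rw [corankChart, shearEnd_apply, splitEnd_apply]
    simp [sub_eq_add_neg]
  apply le_antisymm
  · rintro _ ⟨v, rfl⟩
    exact ⟨_, (key v).symm⟩
  · rintro _ ⟨v, rfl⟩
    refine ⟨κ.symm (0, v), (key _).trans ?_⟩
    simp

variable [MeasurableSpace F] [BorelSpace F] [MeasurableSpace X] [BorelSpace X]
  [MeasurableSpace Y] [BorelSpace Y] [MeasurableSpace X'] [BorelSpace X']

/-- For each fixed z' the shear is a translation in u. So one normalization of the measures serves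
all x' at once. -/
lemma measurePreserving_shearEnd (κ : X ≃L[F] F × X') (x' : X') {dz : Measure (X →L[F] X)}
    {μH : Measure (X' →L[F] X)} [μH.IsAddHaarMeasure] {μX : Measure X} [μX.IsAddHaarMeasure]
    (hdz : (μH.prod μX).map (splitEnd κ) = dz) :
    MeasurePreserving (shearEnd κ x') (μH.prod μX) dz := by
  have := FiniteDimensional.proper F X
  have := FiniteDimensional.proper F (X' →L[F] X)
  have h1 : MeasurePreserving (fun p : (X' →L[F] X) × X => (p.1, p.2 - p.1 x')) (μH.prod μX)
      (μH.prod μX) := by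
    refine (MeasurePreserving.id μH).skew_product (g := fun z' u => u - z' x') ?_
      (.of_forall fun z' => map_sub_right_eq_self μX _)
    exact (Continuous.measurable (f := fun p : (X' →L[F] X) × X => p.2 - p.1 x') (by fun_prop))
  have h2 : MeasurePreserving (splitEnd κ) (μH.prod μX) dz :=
    ⟨(splitEnd κ).continuous.measurable, hdz⟩
  exact h2.comp h1

lemma exists_map_splitEnd_eq (κ : X ≃L[F] F × X') (dz : Measure (X →L[F] X))
    [dz.IsAddHaarMeasure] (μX : Measure X) [μX.IsAddHaarMeasure] :
    ∃ μH : Measure (X' →L[F] X), μH.IsAddHaarMeasure ∧ (μH.prod μX).map (splitEnd κ) = dz := by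
  have := FiniteDimensional.proper F X
  have := FiniteDimensional.proper F (X' →L[F] X)
  have := FiniteDimensional.proper F (X →L[F] X)
  let μ₀ : Measure (X' →L[F] X) := Measure.addHaar
  have : (μ₀.prod μX).IsAddHaarMeasure := Measure.prod.instIsAddHaarMeasure _ _
  have : ((μ₀.prod μX).map (splitEnd κ)).IsAddHaarMeasure := (splitEnd κ).isAddHaarMeasure_map _
  obtain ⟨c, hc0, hc⟩ := exists_eq_smul_addHaar dz ((μ₀.prod μX).map (splitEnd κ))
  refine ⟨c • μ₀, Measure.IsAddHaarMeasure.nnreal_smul μ₀ hc0, ?_⟩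
  rw [hc, Measure.prod_smul_left, Measure.map_smul]

variable {B : X →ₗ[F] Y →ₗ[F] F} (κ : X ≃L[F] F × X') {χ : AddChar F Circle}

/-- Along the rank one endomorphisms with a given image, the Fourier transform is the Fourier
transform of a partial integral. -/
lemma endFourier_rankOneChart (hχ : Continuous χ) {dz : Measure (X →L[F] X)}
    {μH : Measure (X' →L[F] X)} [μH.IsAddHaarMeasure] {μX : Measure X} [μX.IsAddHaarMeasure]
    (hdz : (μH.prod μX).map (splitEnd κ) = dz) (ψ : SchwartzBruhat (X →L[F] X)) (x' : X') (y : Y) :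
    endFourier χ dz (ψ : (X →L[F] X) → ℂ) (rankOneChart B κ (x', y)) =
      pairFourier χ B μX
        (fun u => ∫ z', (ψ : (X →L[F] X) → ℂ) (shearEnd κ x' (z', u)) ∂μH) y := by
  have := FiniteDimensional.proper F X
  have := FiniteDimensional.proper F (X' →L[F] X)
  have hmp := measurePreserving_shearEnd κ x' hdz
  unfold endFourier pairFourier rankOneChart
  simp only [trace_mul_rankOneEnd, neg_neg]
  rw [← hmp.integral_comp (shearEnd κ x').isClosedEmbedding.measurableEmbedding]
  simp only [shearEnd_chartSection]
  let ψ' : SchwartzBruhat ((X' →L[F] X) × X) :=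
    ⟨_, SchwartzBruhat.comp_homeomorph_mem (shearEnd κ x') ψ⟩
  have hint : Integrable (fun p : (X' →L[F] X) × X =>
      (χ (B p.2 y) : ℂ) * (ψ : (X →L[F] X) → ℂ) (shearEnd κ x' p)) (μH.prod μX) := by
    refine integrable_addChar_mul hχ (SchwartzBruhat.integrable ψ') ?_
    exact (continuous_pairing B).comp (f := fun p : (X' →L[F] X) × X => (p.2, y)) (by fun_prop)
  rw [integral_prod_symm _ hint]
  congr 1
  ext u
  exact integral_const_mul (χ (B u y) : ℂ)
    fun z' => (ψ : (X →L[F] X) → ℂ) (shearEnd κ x' (z', u))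

/-- Fourier inversion at the origin for the pairing B, applied to the partial integral of ψ over the
z with z(1, x') = u. The value at u = 0 is the integral over the endomorphisms killing (1, x'), and
the constant does not depend on x'. -/
lemma exists_integral_endFourier_rankOneChart
    (hχ : Continuous χ) (hχc : ∀ x : F, (∀ a : F, ‖a‖ ≤ 1 → χ (a * x) = 1) ↔ ‖x‖ ≤ 1)
    (hB : ∀ y, (∀ v, B v y = 0) → y = 0) (hd : finrank F X = finrank F Y)
    (dz : Measure (X →L[F] X)) [dz.IsAddHaarMeasure] (μY : Measure Y) [μY.IsAddHaarMeasure] :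
    ∃ (c : ℝ≥0) (μH : Measure (X' →L[F] X)), c ≠ 0 ∧ μH.IsAddHaarMeasure ∧
      ∀ (ψ : SchwartzBruhat (X →L[F] X)) (x' : X'),
        ∫ y, endFourier χ dz (ψ : (X →L[F] X) → ℂ) (rankOneChart B κ (x', y)) ∂μY =
          (c : ℂ) * ∫ z', (ψ : (X →L[F] X) → ℂ) (corankChart κ (x', z')) ∂μH := by
  have := FiniteDimensional.proper F X
  obtain ⟨μH, hμH, hdz⟩ := exists_map_splitEnd_eq κ dz Measure.addHaar
  obtain ⟨c, hc0, hc⟩ := exists_integral_pairFourier (χ := χ) (B := B) (Measure.addHaar : Measure X)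
    hχc hχ hB hd μY
  refine ⟨c, μH, hc0, hμH, fun ψ x' => ?_⟩
  simp only [endFourier_rankOneChart κ hχ hdz]
  exact hc ⟨_, SchwartzBruhat.integral_fst_mem μH ⟨_, SchwartzBruhat.comp_homeomorph_mem (shearEnd κ x') ψ⟩⟩

include κ in
/-- Almost all linear maps from a hyperplane are injective. -/
lemma ae_finrank_range_eq (μH : Measure (X' →L[F] X)) [μH.IsAddHaarMeasure] :
    ∀ᵐ z' : X' →L[F] X ∂μH, finrank F (LinearMap.range (z' : X' →ₗ[F] X)) = finrank F X' := by
  let ι : X' →L[F] X := (κ.symm : F × X' →L[F] X).comp (ContinuousLinearMap.inr F F X')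
  let N : Set (X' →L[F] X) := {z' | finrank F X' ≤ finrank F (LinearMap.range (z' : X' →ₗ[F] X))}ᶜ
  have hN : MeasurableSet N := by
    have h := isOpen_setOfPred_nat_le_rank (𝕜 := F) (E := X') (F := X) (finrank F X')
    have : IsOpen {z' : X' →L[F] X |
        finrank F X' ≤ finrank F (LinearMap.range (z' : X' →ₗ[F] X))} := by
      convert h using 2
      ext x
      rw [LinearMap.rank, ← finrank_eq_rank]
      norm_cast
    exact this.measurableSet.compl
  have h0 : μH N = 0 := by
    refine measure_eq_zero_of_countable_lines (F := F) μH hN ι fun w => ?_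
    -- On the line through w in the direction of the inclusion ι, injectivity can fail at t only if
    -- -t is an eigenvalue of A, that is, for finitely many t.
    let A : X' →ₗ[F] X' := LinearMap.snd F F X' ∘ₗ (κ : X →ₗ[F] F × X') ∘ₗ (w : X' →ₗ[F] X)
    have hfin := (Module.End.finite_hasEigenvalue A).image fun μ => -μ
    refine hfin.countable.mono fun t ht => (Set.mem_image _ _ _).2 ⟨-t, ?_, neg_neg t⟩
    have hker : LinearMap.ker ((w + t • ι : X' →L[F] X) : X' →ₗ[F] X) ≠ ⊥ := by
      intro h
      refine ht (show finrank F X' ≤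
        finrank F (LinearMap.range ((w + t • ι : X' →L[F] X) : X' →ₗ[F] X)) from le_of_eq ?_)
      rw [LinearMap.finrank_range_of_inj (LinearMap.ker_eq_bot.1 h)]
    obtain ⟨v, hv, hv0⟩ := Submodule.exists_mem_ne_zero_of_ne_bot hker
    refine Module.End.hasEigenvalue_of_hasEigenvector (x := v)
      (Module.End.hasEigenvector_iff.2 ⟨Module.End.mem_eigenspace_iff.2 ?_, hv0⟩)
    have h1 : w v + t • ι v = 0 := hv
    have h2 := congrArg (fun x => (κ x).2) h1
    simp only [map_add, map_smul, ι, ContinuousLinearMap.comp_apply, ContinuousLinearEquiv.coe_coe,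
      ContinuousLinearEquiv.apply_symm_apply, ContinuousLinearMap.inr_apply, Prod.snd_add,
      Prod.smul_snd, map_zero, Prod.snd_zero] at h2
    rw [neg_smul]
    exact eq_neg_of_add_eq_zero_left h2
  refine measure_mono_null (t := N) (fun z' hz' hz => hz' ?_) h0
  exact le_antisymm (LinearMap.finrank_range_le _) hz

variable (B) in
/-- The Fourier transform of the measure on the endomorphisms of rank one is a measure on the
endomorphisms of corank one. -/
theorem exists_corankMeasure
    (hχ : Continuous χ) (hχc : ∀ x : F, (∀ a : F, ‖a‖ ≤ 1 → χ (a * x) = 1) ↔ ‖x‖ ≤ 1)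
    (hB : ∀ y, (∀ v, B v y = 0) → y = 0) (hd : finrank F X = finrank F Y)
    (dz : Measure (X →L[F] X)) [dz.IsAddHaarMeasure] (μX' : Measure X') [μX'.IsAddHaarMeasure]
    (μY : Measure Y) [μY.IsAddHaarMeasure]
    [IsFiniteMeasureOnCompacts (rankOneMeasure B κ μX' μY)] :
    ∃ M : Measure (X →L[F] X), IsFiniteMeasureOnCompacts M ∧ M ≠ 0 ∧
      M (rankSet F X (finrank F X'))ᶜ = 0 ∧
      ∀ ψ : SchwartzBruhat (X →L[F] X), ∫ z, (ψ : (X →L[F] X) → ℂ) z ∂M =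
        ∫ z, endFourier χ dz (ψ : (X →L[F] X) → ℂ) z ∂(rankOneMeasure B κ μX' μY) := by
  have := FiniteDimensional.proper F X
  have := FiniteDimensional.proper F Y
  have := FiniteDimensional.proper F X'
  have := FiniteDimensional.proper F (X' →L[F] X)
  have := FiniteDimensional.proper F (X →L[F] X)
  have := totallyDisconnectedSpace_of_finiteDimensional F (X →L[F] X)
  obtain ⟨c, μH, hc0, hμH, key⟩ :=
    exists_integral_endFourier_rankOneChart κ hχ hχc hB hd dz μY
  have hcm : Measurable (corankChart κ) := (continuous_corankChart κ).measurable
  have hcr : Measurable (rankOneChart B κ) := (continuous_rankOneChart B κ).measurable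
  set ν := (μX'.prod μH).map (corankChart κ) with hν
  have hφint : ∀ ψ : SchwartzBruhat (X →L[F] X), Integrable
      (fun p => endFourier χ dz (ψ : (X →L[F] X) → ℂ) (rankOneChart B κ p)) (μX'.prod μY) := by
    intro ψ
    have h1 : Integrable (endFourier χ dz (ψ : (X →L[F] X) → ℂ)) (rankOneMeasure B κ μX' μY) :=
      SchwartzBruhat.integrable ⟨_, endFourier_mem hχc dz ψ⟩
    exact h1.comp_measurable hcr
  -- The indicator of K is nonnegative, so the measure of each fibre equals an integral of the
  -- transform up to c and is bounded by the integral of its absolute value. The transform is a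
  -- Schwartz-Bruhat function, and M₁ is finite on compact sets.
  have hfin : ∀ K : Set (X →L[F] X), IsCompact K → IsOpen K → ν K < ∞ := by
    intro K hK hKo
    let ψ := SchwartzBruhat.indicator hK hKo
    have hKm : MeasurableSet (corankChart κ ⁻¹' K) := hcm hK.measurableSet
    rw [hν, Measure.map_apply hcm hK.measurableSet, Measure.prod_apply hKm]
    have hfib : ∀ x', μH (Prod.mk x' ⁻¹' (corankChart κ ⁻¹' K)) ≤
        (c⁻¹ : ℝ≥0) * ∫⁻ y, ‖endFourier χ dz (ψ : (X →L[F] X) → ℂ)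
          (rankOneChart B κ (x', y))‖ₑ ∂μY := by
      intro x'
      have hm : MeasurableSet (Prod.mk x' ⁻¹' (corankChart κ ⁻¹' K)) :=
        measurable_prodMk_left hKm
      have hft : μH (Prod.mk x' ⁻¹' (corankChart κ ⁻¹' K)) ≠ ∞ := by
        have hcomp : IsCompact (Prod.fst '' (shearEnd κ x' ⁻¹' K)) :=
          ((shearEnd κ x').isCompact_preimage.2 hK).image continuous_fst
        exact ((measure_mono fun z' hz' => (Set.mem_image _ _ _).2 ⟨(z', 0), hz', rfl⟩).trans_lt
          hcomp.measure_lt_top).ne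
      have h1 : ∫ z', (ψ : (X →L[F] X) → ℂ) (corankChart κ (x', z')) ∂μH =
          ((μH.real (Prod.mk x' ⁻¹' (corankChart κ ⁻¹' K)) : ℝ) : ℂ) := by
        rw [← integral_indicator_one hm, ← integral_complex_ofReal]
        congr 1
        ext z'
        by_cases hz : corankChart κ (x', z') ∈ K <;> simp [ψ, SchwartzBruhat.indicator, hz]
      have h2 := key ψ x'
      rw [h1] at h2
      have h3 := enorm_integral_le_lintegral_enorm (μ := μY)
        (fun y => endFourier χ dz (ψ : (X →L[F] X) → ℂ) (rankOneChart B κ (x', y)))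
      rw [h2] at h3
      have h4 : ‖(c : ℂ) * ((μH.real (Prod.mk x' ⁻¹' (corankChart κ ⁻¹' K)) : ℝ) : ℂ)‖ₑ =
          c * μH (Prod.mk x' ⁻¹' (corankChart κ ⁻¹' K)) := by
        rw [enorm_mul, ← ofReal_norm, ← ofReal_norm, Complex.norm_real,
          Complex.norm_real, Real.norm_of_nonneg NNReal.zero_le_coe,
          Real.norm_of_nonneg measureReal_nonneg, ENNReal.ofReal_coe_nnreal, ofReal_measureReal hft]
      rw [h4] at h3
      calc μH (Prod.mk x' ⁻¹' (corankChart κ ⁻¹' K))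
          = (c⁻¹ : ℝ≥0) * (c * μH (Prod.mk x' ⁻¹' (corankChart κ ⁻¹' K))) := by
            rw [← mul_assoc, ← ENNReal.coe_mul, inv_mul_cancel₀ hc0, ENNReal.coe_one, one_mul]
        _ ≤ _ := by gcongr
    refine (lintegral_mono hfib).trans_lt ?_
    rw [lintegral_const_mul' _ _ ENNReal.coe_ne_top]
    refine ENNReal.mul_lt_top ENNReal.coe_lt_top ?_
    have h5 := (hφint ψ).2
    rw [HasFiniteIntegral, lintegral_prod _ (hφint ψ).1.enorm] at h5
    exact h5
  have hνloc : IsLocallyFiniteMeasure ν := ⟨fun z => by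
    obtain ⟨K, hK, hzK, -⟩ := isTopologicalBasis_isCompact_isOpen.exists_subset_of_mem_open
      (Set.mem_univ z) isOpen_univ
    exact ⟨K, hK.2.mem_nhds hzK, hfin K hK.1 hK.2⟩⟩
  refine ⟨c • ν, inferInstance, ?_, ?_, fun ψ => ?_⟩
  · refine smul_ne_zero hc0 ?_
    rw [hν, Ne, Measure.map_eq_zero_iff hcm.aemeasurable]
    exact NeZero.ne _
  · rw [Measure.smul_apply, hν, Measure.map_apply hcm (measurableSet_rankSet _).compl]
    have h1 : ∀ᵐ p ∂(μX'.prod μH),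
        finrank F (LinearMap.range (p.2 : X' →ₗ[F] X)) = finrank F X' :=
      Measure.quasiMeasurePreserving_snd.ae (ae_finrank_range_eq κ μH)
    have h2 : (μX'.prod μH) (corankChart κ ⁻¹' (rankSet F X (finrank F X'))ᶜ) = 0 := by
      refine measure_mono_null (t := {p | ¬ finrank F (LinearMap.range (p.2 : X' →ₗ[F] X)) =
        finrank F X'}) (fun p hp h0 => hp ?_) h1
      change finrank F (LinearMap.range (corankChart κ p : X →ₗ[F] X)) = _
      rw [range_corankChart, h0]
    rw [h2, smul_zero]
  · have hψ : Integrable (fun p => (ψ : (X →L[F] X) → ℂ) (corankChart κ p)) (μX'.prod μH) :=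
      (SchwartzBruhat.integrable (μ := ν) ψ).comp_measurable hcm
    rw [integral_smul_nnreal_measure, hν, rankOneMeasure, integral_map hcm.aemeasurable
      ψ.2.1.continuous.aestronglyMeasurable, integral_map hcr.aemeasurable
      (endFourier_mem hχc dz ψ).1.continuous.aestronglyMeasurable, integral_prod _ hψ,
      integral_prod _ (hφint ψ), NNReal.smul_def, Complex.real_smul, ← integral_const_mul]
    refine integral_congr_ae (.of_forall fun x' => ?_)
    exact (key ψ x').symm

/-- The Fourier transform of a relatively invariant measure of rank one transforms in the same way
as the measures of corank one. -/
lemma map_actHomeo_of_integral_endFourier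
    (hχc : ∀ x : F, (∀ a : F, ‖a‖ ≤ 1 → χ (a * x) = 1) ↔ ‖x‖ ≤ 1)
    (hn : 1 ≤ finrank F X) (dz : Measure (X →L[F] X)) [dz.IsAddHaarMeasure]
    {M₁ M₂ : Measure (X →L[F] X)} [IsFiniteMeasureOnCompacts M₁] [IsFiniteMeasureOnCompacts M₂]
    (htr : ∀ g h, M₁.map (actHomeo g h).symm = transformFactorNN 1 g h • M₁)
    (hM : ∀ ψ : SchwartzBruhat (X →L[F] X), ∫ z, (ψ : (X →L[F] X) → ℂ) z ∂M₂ =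
        ∫ z, endFourier χ dz (ψ : (X →L[F] X) → ℂ) z ∂M₁) (g h : (X →L[F] X)ˣ) :
    M₂.map (actHomeo g h).symm = transformFactorNN (finrank F X - 1) g h • M₂ := by
  have := FiniteDimensional.proper F (X →L[F] X)
  have := totallyDisconnectedSpace_of_finiteDimensional F (X →L[F] X)
  have : IsFiniteMeasureOnCompacts (M₂.map (actHomeo g h).symm) := ⟨fun K hK => by
    rw [Measure.map_apply (actHomeo g h).symm.continuous.measurable hK.measurableSet]
    exact ((actHomeo g h).symm.isCompact_preimage.2 hK).measure_lt_top⟩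
  refine Measure.ext_of_integral_schwartzBruhat fun ψ => ?_
  have h1 : ∫ z, (ψ : (X →L[F] X) → ℂ) z ∂(M₂.map (actHomeo g h).symm) =
      ∫ z, (leftRight g h ψ : (X →L[F] X) → ℂ) z ∂M₂ :=
    integral_map (actHomeo g h).symm.continuous.aemeasurable
      ψ.2.1.continuous.aestronglyMeasurable
  have h2 : ∫ y, endFourier χ dz (ψ : (X →L[F] X) → ℂ) ((actHomeo h g).symm y) ∂M₁ =
      ((transformFactorNN 1 h g : ℝ≥0) : ℂ) * ∫ y, endFourier χ dz (ψ : (X →L[F] X) → ℂ) y ∂M₁ := by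
    rw [← integral_map (actHomeo h g).symm.continuous.aemeasurable
      (endFourier_mem hχc dz ψ).1.continuous.aestronglyMeasurable, htr,
      integral_smul_nnreal_measure, NNReal.smul_def, Complex.real_smul]
  -- The scaling of dz contributes exponent n, and the rank one measure, with g and h exchanged,
  -- lowers it to n - 1.
  have h3 : transformFactorNN (finrank F X) g h * transformFactorNN 1 h g =
      transformFactorNN (finrank F X - 1) g h := by
    obtain ⟨m, hm⟩ := Nat.exists_eq_add_of_le' hn
    have hg := modulus_ne_zero (det_units_ne_zero g)
    have hh := modulus_ne_zero (det_units_ne_zero h)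
    rw [hm, transformFactorNN, transformFactorNN, transformFactorNN, Nat.add_sub_cancel]
    field_simp
    ring
  rw [h1, hM, integral_smul_nnreal_measure, hM, NNReal.smul_def, Complex.real_smul, ← h3]
  simp only [endFourier_leftRight]
  rw [integral_const_mul, h2, NNReal.coe_mul, Complex.ofReal_mul, mul_assoc]

end Corank
end

noncomputable section

/-! ### The orbit space -/

namespace PolarizedSymplectic

section Orbits

variable {F : Type*} [NontriviallyNormedField F] [ProperSpace F] [IsUltrametricDist F]
  [MeasurableSpace F] [BorelSpace F]
  {W : Type*} [NormedAddCommGroup W] [NormedSpace F W] [FiniteDimensional F W]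
  [MeasurableSpace W] [BorelSpace W] (P : PolarizedSymplectic F W)

lemma continuous_prX : Continuous P.prX := P.prX.continuous_of_finiteDimensional

lemma continuous_prY : Continuous P.prY := P.prY.continuous_of_finiteDimensional

lemma isOpen_punctured : IsOpen P.punctured :=
  (isOpen_compl_singleton.preimage P.continuous_prX).inter
    (isOpen_compl_singleton.preimage P.continuous_prY)

lemma measurableSet_punctured : MeasurableSet P.punctured := P.isOpen_punctured.measurableSet

lemma measurable_scale : Measurable fun p : Fˣ × W => P.scale p.1 p.2 := by
  have := FiniteDimensional.proper F W
  have h1 : Measurable fun p : Fˣ × W => (p.1 : F) :=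
    measurableEmbedding_units_val.measurable.comp measurable_fst
  exact (h1.smul (P.continuous_prX.measurable.comp measurable_snd)).add
    (h1.inv.smul (P.continuous_prY.measurable.comp measurable_snd))

lemma measurable_scale_left (w : W) : Measurable fun a : Fˣ => P.scale a w :=
  P.measurable_scale.comp measurable_prodMk_right

omit [FiniteDimensional F W] [BorelSpace W] in
lemma measurable_orbit : Measurable P.orbit := fun _ h => h

lemma measurable_of_comp_orbit {β : Type*} [MeasurableSpace β] {f : P.OrbitSpace → β}
    (h : Measurable fun w : P.punctured => f (P.orbit w)) : Measurable f := fun _ ht => h ht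

variable (da : Measure F) [da.IsAddHaarMeasure]

/-- The measure on an orbit of `Fˣ` in `W` given by the measure on `Fˣ`. -/
def orbitFiber : P.OrbitSpace → Measure W :=
  Quotient.lift (fun w : P.punctured => (multMeasure da).map fun a => P.scale a (w : W)) (by
    rintro w w' ⟨b, hb⟩
    -- Another representative of the orbit only translates the parameter, and da/|a| is invariant.
    have h1 : (fun a => P.scale a (w' : W)) = (fun a => P.scale a (w : W)) ∘ fun a => b * a := by
      ext1 a
      rw [← hb, scale_scale, mul_comm]
      rfl
    simp only [h1]
    rw [← Measure.map_map (P.measurable_scale_left _) (measurable_units_mul b),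
      map_mul_left_multMeasure])

lemma orbitFiber_orbit (w : P.punctured) :
    P.orbitFiber da (P.orbit w) = (multMeasure da).map fun a => P.scale a (w : W) := rfl

lemma lintegral_orbitFiber (w : P.punctured) {f : W → ℝ≥0∞} (hf : Measurable f) :
    ∫⁻ v, f v ∂(P.orbitFiber da (P.orbit w)) =
      ∫⁻ a : Fˣ, f (P.scale a w) ∂(multMeasure da) :=
  lintegral_map hf (P.measurable_scale_left _)

lemma measurable_orbitFiber : Measurable (P.orbitFiber da) := by
  refine Measure.measurable_of_measurable_coe _ fun s hs => P.measurable_of_comp_orbit ?_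
  have h1 : ∀ w : P.punctured, P.orbitFiber da (P.orbit w) s =
      ∫⁻ a : Fˣ, s.indicator 1 (P.scale a w) ∂(multMeasure da) := fun w => by
    rw [← P.lintegral_orbitFiber da w (measurable_one.indicator hs), lintegral_indicator_one hs]
  simp only [h1]
  have h2 : Measurable fun p : P.punctured × Fˣ => s.indicator (1 : W → ℝ≥0∞) (P.scale p.2 p.1) :=
    (measurable_one.indicator hs).comp (P.measurable_scale.comp
      (measurable_snd.prodMk (measurable_subtype_coe.comp measurable_fst)))
  exact h2.lintegral_prod_right

/-- A measure on the orbit space is determined by the measure on `W` which it induces. -/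
lemma bind_orbitFiber_injective {m m' : Measure P.OrbitSpace}
    (h : m.bind (P.orbitFiber da) = m'.bind (P.orbitFiber da)) : m = m' := by
  have := FiniteDimensional.proper F W
  obtain ⟨ρ, -, -, -, hρ, hρ1, -⟩ := exists_orbit_weight (X := W) da
  ext A hA
  have hA' : MeasurableSet (Subtype.val '' (P.orbit ⁻¹' A)) :=
    (MeasurableEmbedding.subtype_coe P.measurableSet_punctured).measurableSet_image.2 hA
  -- The saturated set over A is cut down by the weight, so the integral of f over each orbit is the
  -- indicator of A at that orbit.
  let f : W → ℝ≥0∞ := fun w =>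
    ρ (P.prX w) * (Subtype.val '' (P.orbit ⁻¹' A)).indicator 1 w
  have hf : Measurable f := (hρ.comp P.continuous_prX.measurable).mul
    (measurable_one.indicator hA')
  have key : ∀ m : Measure P.OrbitSpace, ∫⁻ v, f v ∂(m.bind (P.orbitFiber da)) = m A := by
    intro m
    rw [Measure.lintegral_bind (P.measurable_orbitFiber da).aemeasurable hf.aemeasurable,
      ← lintegral_indicator_one hA]
    refine lintegral_congr fun q => ?_
    induction q using Quotient.inductionOn with | _ w =>
    change ∫⁻ v, f v ∂(P.orbitFiber da (P.orbit w)) = A.indicator 1 (P.orbit w)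
    rw [P.lintegral_orbitFiber da w hf]
    have h1 : ∀ a : Fˣ, (Subtype.val '' (P.orbit ⁻¹' A)).indicator (1 : W → ℝ≥0∞) (P.scale a w) =
        A.indicator 1 (P.orbit w) := by
      intro a
      have h2 : P.orbit ⟨P.scale a w, P.scale_mem_punctured a w.2⟩ = P.orbit w :=
        (Quotient.sound ⟨a, rfl⟩ : P.orbit w = _).symm
      have h3 : P.scale a w ∈ Subtype.val '' (P.orbit ⁻¹' A) ↔ P.orbit w ∈ A := by
        constructor
        · rintro ⟨v, hv, hva⟩
          have : v = ⟨P.scale a w, P.scale_mem_punctured a w.2⟩ := Subtype.ext hva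
          rw [← h2, ← this]
          exact hv
        · intro hw
          exact ⟨⟨P.scale a w, P.scale_mem_punctured a w.2⟩, by rwa [Set.mem_preimage, h2], rfl⟩
      by_cases hw : P.orbit w ∈ A
      · rw [Set.indicator_of_mem hw, Set.indicator_of_mem (h3.2 hw)]; rfl
      · rw [Set.indicator_of_notMem hw, Set.indicator_of_notMem (fun h => hw (h3.1 h))]
    simp only [f, h1, prX_scale]
    have h4 : Measurable fun a : Fˣ => ρ ((a : F) • P.prX (w : W)) :=
      hρ.comp (measurable_units_smul.comp measurable_prodMk_right)
    rw [lintegral_mul_const _ h4, hρ1 _ w.2.1, one_mul]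
  rw [← key m, h, key]

/-- The defining property of the measure on the orbit space, in terms of measures on `W`. -/
lemma IsOrbitSpaceMeasure.bind_orbitFiber {dw : Measure W} [dw.IsAddHaarMeasure]
    {m : Measure P.OrbitSpace} (hm : P.IsOrbitSpaceMeasure da dw m) :
    m.bind (P.orbitFiber da) = dw.restrict P.punctured := by
  have := FiniteDimensional.proper F W
  have := totallyDisconnectedSpace_of_finiteDimensional F W
  have key : ∀ K : Set W, IsCompact K → IsOpen K →
      m.bind (P.orbitFiber da) K = dw.restrict P.punctured K := by
    intro K hK hKo
    have hKm := hK.measurableSet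
    -- For the indicator of K, the function Φ is the fibre measure of K. Its integrability gives the
    -- finiteness needed to compare extended nonnegative measures through complex integrals.
    obtain ⟨Φ, hΦ, hΦi, hΦe⟩ := hm (SchwartzBruhat.indicator hK hKo)
    have hcoe : ((SchwartzBruhat.indicator hK hKo : SchwartzBruhat W) : W → ℂ) =
      K.indicator 1 := rfl
    rw [hcoe] at hΦ hΦe
    have h1 : ∀ q, P.orbitFiber da q K < ∞ ∧ Φ q = ((P.orbitFiber da q K).toReal : ℂ) := by
      intro q
      induction q using Quotient.inductionOn with | _ w =>
      change P.orbitFiber da (P.orbit w) K < ∞ ∧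
        Φ (P.orbit w) = ((P.orbitFiber da (P.orbit w) K).toReal : ℂ)
      obtain ⟨hi, he⟩ := hΦ w
      have hS : MeasurableSet ((fun a => P.scale a (w : W)) ⁻¹' K) :=
        P.measurable_scale_left w hKm
      have h2 : (fun a => K.indicator (1 : W → ℂ) (P.scale a w)) =
        ((fun a => P.scale a (w : W)) ⁻¹' K).indicator (fun _ => (1 : ℂ)) := rfl
      rw [orbitFiber_orbit, Measure.map_apply (P.measurable_scale_left w) hKm, he]
      rw [h2] at hi ⊢
      rw [integrable_indicator_iff hS, integrableOn_const_iff (by simp)] at hi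
      refine ⟨hi.resolve_left (by simp), ?_⟩
      rw [integral_indicator_const _ hS, Measure.real, Complex.real_smul, mul_one]
    have hmeas : Measurable fun q => P.orbitFiber da q K :=
      (Measure.measurable_coe hKm).comp (P.measurable_orbitFiber da)
    have h2 : m.bind (P.orbitFiber da) K = ∫⁻ q, P.orbitFiber da q K ∂m :=
      Measure.bind_apply hKm (P.measurable_orbitFiber da).aemeasurable
    have h3 : ∫⁻ q, P.orbitFiber da q K ∂m < ∞ := by
      refine (lintegral_congr fun q => ?_).trans_lt hΦi.2
      rw [(h1 q).2, ← ofReal_norm, Complex.norm_real, Real.norm_of_nonneg ENNReal.toReal_nonneg,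
        ENNReal.ofReal_toReal (h1 q).1.ne]
    have h4 : ((dw.restrict P.punctured K).toReal : ℂ) =
        ((∫⁻ q, P.orbitFiber da q K ∂m).toReal : ℂ) := by
      rw [← integral_toReal hmeas.aemeasurable (.of_forall fun q => (h1 q).1),
        ← integral_complex_ofReal]
      simp only [← (h1 _).2]
      rw [← hΦe]
      change _ = ∫ w, K.indicator (fun _ => (1 : ℂ)) w ∂(dw.restrict P.punctured)
      rw [integral_indicator_const _ hKm, Measure.real, Complex.real_smul, mul_one]
    rw [h2]
    have h5 : dw.restrict P.punctured K ≠ ∞ :=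
      ((Measure.restrict_apply_le _ _).trans_lt hK.measure_lt_top).ne
    exact ((ENNReal.toReal_eq_toReal_iff' h5 h3.ne).1 (Complex.ofReal_injective h4)).symm
  refine Measure.ext_of_isCompact_isOpen (fun K hK hKo => ?_) key
  rw [key K hK hKo]
  exact ((Measure.restrict_apply_le _ _).trans_lt hK.measure_lt_top).ne

/-- There is at most one invariant measure on the orbit space. -/
lemma IsOrbitSpaceMeasure.eq {dw : Measure W} [dw.IsAddHaarMeasure]
    {m m' : Measure P.OrbitSpace} (hm : P.IsOrbitSpaceMeasure da dw m)
    (hm' : P.IsOrbitSpaceMeasure da dw m') : m = m' :=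
  P.bind_orbitFiber_injective da ((hm.bind_orbitFiber P da).trans (hm'.bind_orbitFiber P da).symm)

end Orbits

/-! ### A section of the orbit space and the measure it carries -/

section Chart

variable {F : Type*} [NontriviallyNormedField F] [ProperSpace F] [IsUltrametricDist F]
  [MeasurableSpace F] [BorelSpace F]
  {W : Type*} [NormedAddCommGroup W] [NormedSpace F W] [FiniteDimensional F W]
  [MeasurableSpace W] [BorelSpace W] (P : PolarizedSymplectic F W)
  {X' : Type*} [NormedAddCommGroup X'] [NormedSpace F X'] [FiniteDimensional F X']
  [MeasurableSpace X'] [BorelSpace X'] (κ : P.X ≃L[F] F × X')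

/-- The section `(x', y) ↦ (1, x') + y` of the orbit space. -/
def orbitSection (p : X' × P.Y) : W := chartSection κ p.1 + p.2

lemma prX_orbitSection (p : X' × P.Y) : P.prX (P.orbitSection κ p) = chartSection κ p.1 := by
  rw [orbitSection, map_add, P.prX_of_mem (chartSection κ p.1).2, P.prX_of_mem_Y p.2.2, add_zero]

lemma prY_orbitSection (p : X' × P.Y) : P.prY (P.orbitSection κ p) = p.2 := by
  rw [orbitSection, map_add, P.prY_of_mem_X (chartSection κ p.1).2, P.prY_of_mem p.2.2, zero_add]

lemma continuous_orbitSection : Continuous (P.orbitSection κ) :=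
  (continuous_subtype_val.comp ((continuous_chartSection κ).comp continuous_fst)).add
    (continuous_subtype_val.comp continuous_snd)

lemma orbitSection_mem_punctured {p : X' × P.Y} : P.orbitSection κ p ∈ P.punctured ↔ p.2 ≠ 0 := by
  rw [punctured, Set.mem_ofPred_eq, prX_orbitSection, prY_orbitSection, Ne, Ne,
    ZeroMemClass.coe_eq_zero, ZeroMemClass.coe_eq_zero]
  exact and_iff_right (chartSection_ne_zero κ p.1)

variable (μX' : Measure X') (μY : Measure P.Y)

/-- The measure on the orbit space given by the section `orbitSection`. -/
def sectionMeasure : Measure P.OrbitSpace :=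
  (((μX'.prod μY).map (P.orbitSection κ)).comap Subtype.val).map P.orbit

variable [μX'.IsAddHaarMeasure] [μY.IsAddHaarMeasure]

lemma ae_orbitSection_mem_punctured (hY : 0 < finrank F P.Y) :
    ∀ᵐ p ∂(μX'.prod μY), P.orbitSection κ p ∈ P.punctured := by
  filter_upwards [ae_snd_ne_zero (F := F) (μX' := μX') (μY := μY) hY] with p hp
  exact (P.orbitSection_mem_punctured κ).2 hp

/-- The section leaves the punctured space only where y = 0, a null set. So passing to the subtype
in `sectionMeasure` loses no mass. -/
lemma restrict_map_orbitSection (hY : 0 < finrank F P.Y) :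
    ((μX'.prod μY).map (P.orbitSection κ)).restrict P.punctured =
      (μX'.prod μY).map (P.orbitSection κ) := by
  have := FiniteDimensional.proper F X'
  have := FiniteDimensional.proper F P.Y
  refine Measure.restrict_eq_self_of_ae_mem ?_
  refine (ae_map_iff (p := fun w => w ∈ P.punctured)
    (P.continuous_orbitSection κ).measurable.aemeasurable P.measurableSet_punctured).2 ?_
  exact P.ae_orbitSection_mem_punctured κ μX' μY hY

lemma integrable_sectionMeasure (hY : 0 < finrank F P.Y) {Φ : P.OrbitSpace → ℂ} {Ψ : W → ℂ}
    (hΨ : Measurable Ψ) (h : ∀ w : P.punctured, Φ (P.orbit w) = Ψ w)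
    (hi : Integrable (fun p => Ψ (P.orbitSection κ p)) (μX'.prod μY)) :
    Integrable Φ (P.sectionMeasure κ μX' μY) := by
  have := FiniteDimensional.proper F X'
  have := FiniteDimensional.proper F P.Y
  have hΦ : Measurable Φ := P.measurable_of_comp_orbit (by
    simp only [h]; exact hΨ.comp measurable_subtype_coe)
  rw [sectionMeasure, integrable_map_measure hΦ.aestronglyMeasurable P.measurable_orbit.aemeasurable]
  have h1 : Φ ∘ P.orbit = Ψ ∘ Subtype.val := funext h
  rw [h1, ← integrable_map_measure hΨ.aestronglyMeasurable measurable_subtype_coe.aemeasurable,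
    map_comap_subtype_coe P.measurableSet_punctured, P.restrict_map_orbitSection κ μX' μY hY,
    integrable_map_measure hΨ.aestronglyMeasurable
      (P.continuous_orbitSection κ).measurable.aemeasurable]
  exact hi

lemma integral_sectionMeasure (hY : 0 < finrank F P.Y) {Φ : P.OrbitSpace → ℂ} {Ψ : W → ℂ}
    (hΨ : Measurable Ψ) (h : ∀ w : P.punctured, Φ (P.orbit w) = Ψ w) :
    ∫ q, Φ q ∂(P.sectionMeasure κ μX' μY) =
      ∫ p, Ψ (P.orbitSection κ p) ∂(μX'.prod μY) := by
  have := FiniteDimensional.proper F X'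
  have := FiniteDimensional.proper F P.Y
  have hΦ : Measurable Φ := P.measurable_of_comp_orbit (by
    simp only [h]; exact hΨ.comp measurable_subtype_coe)
  rw [sectionMeasure, integral_map P.measurable_orbit.aemeasurable hΦ.aestronglyMeasurable]
  simp only [h]
  rw [← integral_map measurable_subtype_coe.aemeasurable hΨ.aestronglyMeasurable,
    map_comap_subtype_coe P.measurableSet_punctured, P.restrict_map_orbitSection κ μX' μY hY,
    integral_map (P.continuous_orbitSection κ).measurable.aemeasurable hΨ.aestronglyMeasurable]

variable (da : Measure F) [da.IsAddHaarMeasure] (dw : Measure W) [dw.IsAddHaarMeasure]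

/-- The isomorphism `X × Y ≃ W`. -/
def prodEquiv : (P.X × P.Y) ≃L[F] W :=
  (Submodule.prodEquivOfIsCompl P.X P.Y P.compl).toContinuousLinearEquiv

lemma map_scale_orbitSection
    (h : ((multMeasure da).prod (μX'.prod μY)).map (chartMap κ) = dw.map P.prodEquiv.symm) :
    ((multMeasure da).prod (μX'.prod μY)).map
      (fun p => P.scale p.1 (P.orbitSection κ p.2)) = dw := by
  have := FiniteDimensional.proper F P.Y
  have := FiniteDimensional.proper F P.X
  have h1 : (fun p : Fˣ × (X' × P.Y) => P.scale p.1 (P.orbitSection κ p.2)) =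
      P.prodEquiv ∘ chartMap κ := by
    ext p
    have : P.prodEquiv (chartMap κ p) = ((chartMap κ p).1 : W) + (chartMap κ p).2 := rfl
    rw [Function.comp_apply, this, scale, prX_orbitSection, prY_orbitSection]
    simp [chartMap]
  rw [h1, ← Measure.map_map P.prodEquiv.continuous.measurable (measurable_chartMap κ), h,
    Measure.map_map P.prodEquiv.continuous.measurable P.prodEquiv.symm.continuous.measurable]
  have : (P.prodEquiv : P.X × P.Y → W) ∘ P.prodEquiv.symm = id := by ext; simp
  rw [this, Measure.map_id]

/-- The section measure satisfies the defining property of the measure on the orbit space. -/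
lemma isOrbitSpaceMeasure_sectionMeasure (hY : 0 < finrank F P.Y)
    (h : ((multMeasure da).prod (μX'.prod μY)).map
        (fun p => P.scale p.1 (P.orbitSection κ p.2)) = dw) :
    P.IsOrbitSpaceMeasure da dw (P.sectionMeasure κ μX' μY) := by
  have := FiniteDimensional.proper F X'
  have := FiniteDimensional.proper F P.Y
  have := FiniteDimensional.proper F W
  have hS : Measurable fun p : Fˣ × (X' × P.Y) => P.scale p.1 (P.orbitSection κ p.2) :=
    P.measurable_scale.comp
      (measurable_fst.prodMk ((P.continuous_orbitSection κ).measurable.comp measurable_snd))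
  intro φ
  have hφm : Measurable (φ : W → ℂ) := φ.2.1.continuous.measurable
  let Ψ : W → ℂ := fun w => ∫ a : Fˣ, (φ : W → ℂ) (P.scale a w) ∂(multMeasure da)
  have hΨ : Measurable Ψ := by
    have h2 : StronglyMeasurable fun p : W × Fˣ => (φ : W → ℂ) (P.scale p.2 p.1) :=
      (hφm.comp (P.measurable_scale.comp measurable_swap)).stronglyMeasurable
    exact h2.integral_prod_right.measurable
  have hΨs : ∀ w w' : P.punctured, P.orbitSetoid w w' → Ψ w = Ψ w' := by
    rintro w w' ⟨b, hb⟩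
    have h2 : ∀ a, P.scale a (w' : W) = P.scale (b * a) (w : W) := fun a => by
      rw [← hb, scale_scale, mul_comm]
    simp only [Ψ, h2]
    have h3 := integral_map (μ := multMeasure da) (measurable_units_mul b).aemeasurable
      (f := fun a => (φ : W → ℂ) (P.scale a w))
      (hφm.comp (P.measurable_scale_left w)).aestronglyMeasurable
    rw [map_mul_left_multMeasure] at h3
    exact h3
  let Φ : P.OrbitSpace → ℂ := Quotient.lift (fun w : P.punctured => Ψ w) hΨs
  have hΦ : ∀ w : P.punctured, Φ (P.orbit w) = Ψ w := fun w => rfl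
  have hφi : Integrable (φ : W → ℂ) dw := SchwartzBruhat.integrable φ
  have hφi' : Integrable (fun p : Fˣ × (X' × P.Y) =>
      (φ : W → ℂ) (P.scale p.1 (P.orbitSection κ p.2)))
      ((multMeasure da).prod (μX'.prod μY)) := by
    rw [← h] at hφi
    exact hφi.comp_measurable hS
  have hae : ∀ᵐ w ∂dw, w ∈ P.punctured := by
    rw [← h]
    refine (ae_map_iff (p := fun w => w ∈ P.punctured) hS.aemeasurable
      P.measurableSet_punctured).2 ?_
    filter_upwards [Measure.quasiMeasurePreserving_snd.ae
      (P.ae_orbitSection_mem_punctured κ μX' μY hY)] with p hp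
    exact P.scale_mem_punctured _ hp
  refine ⟨Φ, fun w => ⟨?_, rfl⟩, P.integrable_sectionMeasure κ μX' μY hY hΨ hΦ
    hφi'.integral_prod_right, ?_⟩
  · obtain ⟨R, hR⟩ := φ.2.2.isBounded.subset_closedBall 0
    have hx : 0 < ‖P.prX (w : W)‖ := norm_pos_iff.2 w.2.1
    have hy : 0 < ‖P.prY (w : W)‖ := norm_pos_iff.2 w.2.2
    let pX : W →L[F] W := ⟨P.prX, P.continuous_prX⟩
    let pY : W →L[F] W := ⟨P.prY, P.continuous_prY⟩
    obtain ⟨C, hC⟩ := φ.2.1.continuous.bounded_above_of_compact_support φ.2.2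
    -- On the support of φ the bound on ax limits ‖a‖ from above and the bound on a⁻¹y limits it
    -- from below, because neither component of w vanishes.
    have hs : (Function.support fun a : Fˣ => (φ : W → ℂ) (P.scale a w)) ⊆
        {a : Fˣ | ‖P.prY (w : W)‖ / (‖pY‖ * R + 1) ≤ ‖(a : F)‖ ∧
          ‖(a : F)‖ ≤ ‖pX‖ * R / ‖P.prX (w : W)‖} := by
      intro a ha
      have h1 : ‖P.scale a (w : W)‖ ≤ R := by
        simpa using hR (subset_tsupport _ ha)
      have ha0 : 0 < ‖(a : F)‖ := norm_pos_iff.2 a.ne_zero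
      have h2 : ‖(a : F)‖ * ‖P.prX (w : W)‖ ≤ ‖pX‖ * R := by
        rw [← norm_smul, ← prX_scale]
        exact (pX.le_opNorm _).trans (by gcongr)
      have h3 : ‖(a : F)‖⁻¹ * ‖P.prY (w : W)‖ ≤ ‖pY‖ * R := by
        rw [← norm_inv, ← norm_smul, ← prY_scale]
        exact (pY.le_opNorm _).trans (by gcongr)
      have h4 : 0 ≤ ‖pY‖ * R := (by positivity : 0 ≤ ‖(a : F)‖⁻¹ * ‖P.prY (w : W)‖).trans h3
      refine ⟨?_, (le_div_iff₀ hx).2 h2⟩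
      rw [div_le_iff₀ (by positivity)]
      rw [inv_mul_le_iff₀ ha0] at h3
      exact h3.trans (by gcongr; linarith)
    -- The radius R may be negative if φ vanishes; max R 0 keeps the denominator positive. For R < 0
    -- the upper bound on ‖a‖ is not positive, and the annulus is empty.
    have h4 : 0 < ‖P.prY (w : W)‖ / (‖pY‖ * max R 0 + 1) := by positivity
    refine (integrableOn_iff_integrable_of_support_subset (hs.trans fun a ha => ?_)).1
      (Measure.integrableOn_of_bounded (M := C) (s := {a : Fˣ |
        ‖P.prY (w : W)‖ / (‖pY‖ * max R 0 + 1) ≤ ‖(a : F)‖ ∧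
          ‖(a : F)‖ ≤ ‖pX‖ * R / ‖P.prX (w : W)‖}) (multMeasure_annulus_lt_top da h4 _).ne
        (hφm.comp (P.measurable_scale_left w)).aestronglyMeasurable (.of_forall fun a => hC _))
    have hR0 : R = max R 0 ∨ R < 0 := by
      rcases le_or_gt 0 R with h | h
      · exact .inl (max_eq_left h).symm
      · exact .inr h
    rcases hR0 with h | h
    · rwa [← h]
    · have h5 := ha.2
      have : ‖pX‖ * R / ‖P.prX (w : W)‖ ≤ 0 := div_nonpos_of_nonpos_of_nonneg
        (mul_nonpos_of_nonneg_of_nonpos (norm_nonneg _) h.le) hx.le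
      exact absurd (h5.trans this) (not_le.2 (norm_pos_iff.2 a.ne_zero))
  · rw [P.integral_sectionMeasure κ μX' μY hY hΨ hΦ, Measure.restrict_eq_self_of_ae_mem hae]
    conv_lhs => rw [← h]
    rw [integral_map hS.aemeasurable hφm.aestronglyMeasurable, integral_prod_symm _ hφi']

/-! ### The Cauchy-Harish-Chandra integral -/

variable (χ : AddChar F Circle) [CharZero F]

/-- The pairing `2⟨x, y⟩` of `X` and `Y`. -/
def pairing : P.X →ₗ[F] P.Y →ₗ[F] F :=
  (2 : F) • (P.form.compl₁₂ P.X.subtype P.Y.subtype)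

lemma pairing_apply (x : P.X) (y : P.Y) : P.pairing x y = 2 * P.form x y := rfl

lemma pairing_separating_left (x : P.X) (h : ∀ y, P.pairing x y = 0) : x = 0 := by
  refine Subtype.ext (P.nondeg.1 _ fun w => ?_)
  rw [← P.prX_add_prY w, map_add, P.isotropic_X _ x.2 _ (P.prX_mem w), zero_add]
  have := h ⟨P.prY w, P.prY_mem w⟩
  rw [pairing_apply] at this
  exact (mul_eq_zero.1 this).resolve_left two_ne_zero

lemma pairing_separating_right (y : P.Y) (h : ∀ x, P.pairing x y = 0) : y = 0 := by
  refine Subtype.ext (P.nondeg.2 _ fun w => ?_)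
  rw [← P.prX_add_prY w, map_add, LinearMap.add_apply, P.isotropic_Y _ (P.prY_mem w) _ y.2,
    add_zero]
  have := h ⟨P.prX w, P.prX_mem w⟩
  rw [pairing_apply] at this
  exact (mul_eq_zero.1 this).resolve_left two_ne_zero

/-- Each of the two spaces embeds into the dual of the other. -/
lemma finrank_X_eq_finrank_Y : finrank F P.X = finrank F P.Y := by
  refine le_antisymm ?_ ?_
  · have : Function.Injective P.pairing := by
      refine (injective_iff_map_eq_zero _).2 fun x hx => P.pairing_separating_left x fun y => ?_
      rw [hx, LinearMap.zero_apply]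
    exact (LinearMap.finrank_le_finrank_of_injective this).trans (Subspace.dual_finrank_eq).le
  · have : Function.Injective P.pairing.flip := by
      refine (injective_iff_map_eq_zero _).2 fun y hy => P.pairing_separating_right y fun x => ?_
      rw [← LinearMap.flip_apply, hy, LinearMap.zero_apply]
    exact (LinearMap.finrank_le_finrank_of_injective this).trans (Subspace.dual_finrank_eq).le

lemma quad_eq_pairing (z : P.X →L[F] P.X) (w : W) :
    P.quad (z : P.X →ₗ[F] P.X) w =
      P.pairing (z ⟨P.prX w, P.prX_mem w⟩) ⟨P.prY w, P.prY_mem w⟩ := by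
  have h : P.inflate (z : P.X →ₗ[F] P.X) (P.prX w) = z ⟨P.prX w, P.prX_mem w⟩ := by
    rw [inflate, LinearMap.comp_apply, LinearMap.comp_apply,
      show P.X.projectionOnto P.Y P.compl (P.prX w) = ⟨P.prX w, P.prX_mem w⟩ from
        Submodule.projectionOnto_apply_left P.compl ⟨P.prX w, P.prX_mem w⟩]
    rfl
  rw [quad_eq, h, pairing_apply]

/-- For w = x + y the phase ⟨zw, w⟩ is B(zx, y) = -tr(zR(x, y)). This identity is the bridge between
chc and the Fourier transform. -/
lemma chcInner_orbit (dz : Measure (P.X →L[F] P.X)) (ψ : SchwartzBruhat (P.X →L[F] P.X))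
    (w : P.punctured) :
    P.chcInner χ dz ψ (P.orbit w) = endFourier χ dz (ψ : (P.X →L[F] P.X) → ℂ)
      (rankOneEnd P.pairing ⟨P.prX w, P.prX_mem w⟩ ⟨P.prY w, P.prY_mem w⟩) := by
  change ∫ z, P.chcIntegrand χ ψ w z ∂dz = _
  simp only [chcIntegrand, endFourier, quad_eq_pairing, trace_mul_rankOneEnd, neg_neg]

lemma integrable_chcIntegrand (hχ : Continuous χ) (dz : Measure (P.X →L[F] P.X))
    [dz.IsAddHaarMeasure] (ψ : SchwartzBruhat (P.X →L[F] P.X)) (w : W) :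
    Integrable (P.chcIntegrand χ ψ w) dz := by
  have := FiniteDimensional.proper F (P.X →L[F] P.X)
  refine integrable_addChar_mul hχ (SchwartzBruhat.integrable ψ) ?_
  simp only [quad_eq_pairing]
  have h1 : Continuous fun z : P.X →L[F] P.X => z ⟨P.prX w, P.prX_mem w⟩ := by fun_prop
  exact (pairCLM P.pairing ⟨P.prY w, P.prY_mem w⟩).continuous.comp h1

variable (hχc : ∀ x : F, (∀ a : F, ‖a‖ ≤ 1 → χ (a * x) = 1) ↔ ‖x‖ ≤ 1)
include hχc

/-- Along the section, R is the chart that defines the rank one measure. Convergence of the outer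
integral is the integrability of the Schwartz-Bruhat function ψ̂ against that measure. -/
lemma chc_sectionMeasure [IsFiniteMeasureOnCompacts (rankOneMeasure P.pairing κ μX' μY)]
    (hY : 0 < finrank F P.Y) (dz : Measure (P.X →L[F] P.X)) [dz.IsAddHaarMeasure]
    (ψ : SchwartzBruhat (P.X →L[F] P.X)) :
    Integrable (P.chcInner χ dz ψ) (P.sectionMeasure κ μX' μY) ∧
      P.chc χ dz (P.sectionMeasure κ μX' μY) ψ =
        ∫ z, endFourier χ dz (ψ : (P.X →L[F] P.X) → ℂ) z ∂(rankOneMeasure P.pairing κ μX' μY) := by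
  have := FiniteDimensional.proper F X'
  have := FiniteDimensional.proper F P.Y
  have := FiniteDimensional.proper F P.X
  have := FiniteDimensional.proper F (P.X →L[F] P.X)
  have hc := (endFourier_mem hχc dz ψ).1.continuous
  have hcr := continuous_rankOneChart P.pairing κ
  let Ψ : W → ℂ := fun w => endFourier χ dz (ψ : (P.X →L[F] P.X) → ℂ)
      (rankOneEnd P.pairing ⟨P.prX w, P.prX_mem w⟩ ⟨P.prY w, P.prY_mem w⟩)
  have hΨ : Measurable Ψ := by
    have h1 : Continuous fun w : W => ((⟨P.prX w, P.prX_mem w⟩, ⟨P.prY w, P.prY_mem w⟩) :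
        P.X × P.Y) :=
      (P.continuous_prX.subtype_mk _).prodMk (P.continuous_prY.subtype_mk _)
    exact (hc.comp ((continuous_rankOneEnd P.pairing).comp h1)).measurable
  have hs : ∀ p, Ψ (P.orbitSection κ p) =
      endFourier χ dz (ψ : (P.X →L[F] P.X) → ℂ) (rankOneChart P.pairing κ p) := by
    intro p
    simp only [Ψ, prX_orbitSection, prY_orbitSection]
    rfl
  have hi : Integrable (endFourier χ dz (ψ : (P.X →L[F] P.X) → ℂ))
      (rankOneMeasure P.pairing κ μX' μY) :=
    SchwartzBruhat.integrable ⟨_, endFourier_mem hχc dz ψ⟩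
  refine ⟨P.integrable_sectionMeasure κ μX' μY hY hΨ (P.chcInner_orbit χ dz ψ) ?_, ?_⟩
  · simp only [hs]
    exact hi.comp_measurable hcr.measurable
  · rw [chc, P.integral_sectionMeasure κ μX' μY hY hΨ (P.chcInner_orbit χ dz ψ), rankOneMeasure,
      integral_map hcr.measurable.aemeasurable hc.aestronglyMeasurable]
    simp only [hs]

end Chart

end PolarizedSymplectic

end

noncomputable section

/-! ### Lattices -/

section Lattice

variable {F : Type*} [NontriviallyNormedField F] [ProperSpace F] [IsUltrametricDist F]
  {X : Type*} [NormedAddCommGroup X] [NormedSpace F X] [FiniteDimensional F X]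

/-- A lattice is free over the ring of integers. -/
lemma exists_basis_of_isCompact_isOpen {S : AddSubgroup X} (hS : IsCompact (S : Set X))
    (hSo : IsOpen (S : Set X)) (hSm : ∀ a : F, ‖a‖ ≤ 1 → ∀ x ∈ S, a • x ∈ S) :
    ∃ b : Basis (Fin (finrank F X)) F X, ∀ x, x ∈ S ↔ ∀ i, ‖b.repr x i‖ ≤ 1 := by
  have := FiniteDimensional.proper F X
  let e := finBasis F X
  have hdet : Continuous fun v : Fin (finrank F X) → X => e.det v := by
    simp only [Basis.det_apply]
    refine Continuous.matrix_det (continuous_matrix fun i j => ?_)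
    exact (e.coord i).continuous_of_finiteDimensional.comp (continuous_apply j)
  -- A tuple in S of maximal |det| is the required basis. The maximum is nonzero because S contains
  -- a small multiple of every basis. By Cramer's rule the i-th coordinate of x is the quotient of
  -- the determinant with x in place i by the maximal one, hence integral for x in S.
  obtain ⟨v, hv, hmax⟩ := (isCompact_univ_pi (fun _ : Fin (finrank F X) => hS)).exists_isMaxOn
    ⟨0, fun i _ => S.zero_mem⟩ hdet.norm.continuousOn
  have hv' : ∀ i, v i ∈ S := fun i => hv i trivial
  have hdv : e.det v ≠ 0 := by
    obtain ⟨c, hc0, hc⟩ : ∃ c : F, c ≠ 0 ∧ ∀ i, c • e i ∈ S := by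
      have h1 : ∀ i, ∀ᶠ c : F in nhds 0, c • e i ∈ S := fun i => by
        have h2 : Continuous fun c : F => c • e i := by fun_prop
        exact h2.continuousAt.eventually_mem (hSo.mem_nhds (by simp))
      have h3 := (Filter.eventually_all.2 h1).filter_mono (nhdsWithin_le_nhds (s := {0}ᶜ))
      obtain ⟨c, hc, hc'⟩ := (h3.and self_mem_nhdsWithin).exists
      exact ⟨c, hc', hc⟩
    intro h0
    have h1 := hmax (a := fun i => c • e i) fun i _ => hc i
    have h2 : e.det (fun i => c • e i) = c ^ finrank F X := by
      have := e.det.map_smul_univ (fun _ => c) e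
      simpa [e.det_self] using this
    simp only [h0, h2, norm_zero, Set.mem_ofPred_eq, norm_le_zero_iff] at h1
    exact hc0 (eq_zero_of_pow_eq_zero h1)
  have hb := e.is_basis_iff_det.2 (isUnit_iff_ne_zero.2 hdv)
  refine ⟨Basis.mk hb.1 hb.2.ge, fun x => ⟨fun hx i => ?_, fun hx => ?_⟩⟩
  · have h1 := LinearMap.congr_fun (e.det_smul_mk_coord_eq_det_update hb.1 hb.2.ge i) x
    have h2 : e.det v * (Basis.mk hb.1 hb.2.ge).repr x i = e.det (Function.update v i x) := h1
    have h3 := hmax (a := Function.update v i x) fun j _ => by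
      by_cases hj : j = i
      · subst hj; simpa using hx
      · simpa [hj] using hv' j
    simp only [Set.mem_ofPred_eq, ← h2, norm_mul] at h3
    exact (mul_le_iff_le_one_right (norm_pos_iff.2 hdv)).1 h3
  · rw [← (Basis.mk hb.1 hb.2.ge).sum_repr x]
    refine S.sum_mem fun i _ => hSm _ (hx i) _ ?_
    rw [Basis.mk_apply]
    exact hv' i

variable {S : AddSubgroup X} {b : Basis (Fin (finrank F X)) F X}
  (hb : ∀ x, x ∈ S ↔ ∀ i, ‖b.repr x i‖ ≤ 1)
include hb

lemma basis_mem_lattice (i : Fin (finrank F X)) : b i ∈ S := by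
  rw [hb]
  intro j
  rw [b.repr_self, Finsupp.single_apply]
  split_ifs <;> simp

lemma mapsTo_lattice_iff {z : X →L[F] X} :
    (∀ x ∈ S, z x ∈ S) ↔ ∀ i j, ‖b.repr (z (b j)) i‖ ≤ 1 := by
  refine ⟨fun h i j => (hb _).1 (h _ (basis_mem_lattice hb j)) i, fun h x hx => ?_⟩
  rw [hb] at hx ⊢
  intro i
  rw [← b.sum_repr x, map_sum, map_sum, Finsupp.finsetSum_apply]
  refine IsUltrametricDist.norm_sum_le_of_forall_le_of_nonneg zero_le_one fun j _ => ?_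
  rw [map_smul, map_smul, Finsupp.smul_apply, smul_eq_mul, norm_mul]
  exact mul_le_one₀ (hx j) (norm_nonneg _) (h i j)

lemma isCompact_isOpen_mapsTo_lattice :
    IsCompact {z : X →L[F] X | ∀ x ∈ S, z x ∈ S} ∧ IsOpen {z : X →L[F] X | ∀ x ∈ S, z x ∈ S} := by
  let T : (X →L[F] X) ≃L[F] (Fin (finrank F X) → Fin (finrank F X) → F) :=
    (LinearMap.toContinuousLinearMap.symm.trans
      ((LinearMap.toMatrix b b).trans (Matrix.ofLinearEquiv F).symm)).toContinuousLinearEquiv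
  let D : Set (Fin (finrank F X) → Fin (finrank F X) → F) :=
    Set.pi Set.univ fun _ => Set.pi Set.univ fun _ => Metric.closedBall 0 1
  have hD : {z : X →L[F] X | ∀ x ∈ S, z x ∈ S} = T ⁻¹' D := by
    ext z
    have hT : ∀ i j, T z i j = b.repr (z (b j)) i := fun i j => LinearMap.toMatrix_apply b b _ i j
    simp only [D, Set.mem_preimage, Set.mem_pi, Set.mem_univ, true_implies,
      mem_closedBall_zero_iff]
    simp only [hT]
    exact mapsTo_lattice_iff hb
  rw [hD]
  constructor
  · exact T.toHomeomorph.isCompact_preimage.2 (isCompact_univ_pi fun _ => isCompact_univ_pi fun _ =>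
      isCompact_closedBall _ _)
  · exact (isOpen_set_pi Set.finite_univ fun _ _ => isOpen_set_pi Set.finite_univ fun _ _ =>
      IsUltrametricDist.isOpen_closedBall _ one_ne_zero).preimage T.continuous

/-- An endomorphism preserves a lattice if and only if its trace pairing with all endomorphisms
preserving the lattice is integral. -/
lemma mapsTo_lattice_iff_trace {y : X →L[F] X} :
    (∀ x ∈ S, y x ∈ S) ↔ ∀ z : X →L[F] X, (∀ x ∈ S, z x ∈ S) →
      ‖LinearMap.trace F X ((z * y : X →L[F] X) : X →ₗ[F] X)‖ ≤ 1 := by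
  constructor
  · intro hy z hz
    rw [LinearMap.trace_eq_matrix_trace F b, Matrix.trace]
    refine IsUltrametricDist.norm_sum_le_of_forall_le_of_nonneg zero_le_one fun j _ => ?_
    rw [Matrix.diag_apply, LinearMap.toMatrix_apply]
    exact (mapsTo_lattice_iff hb (z := z * y)).1 (fun x hx => hz _ (hy _ hx)) j j
  · intro h
    rw [mapsTo_lattice_iff hb]
    intro i j
    -- An elementary matrix, whose trace pairing with y is the (i, j) entry of y.
    let z : X →L[F] X := (LinearMap.toContinuousLinearMap (b.coord i)).smulRight (b j)
    have hz : ∀ x ∈ S, z x ∈ S := by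
      intro x hx
      rw [hb]
      intro k
      have h1 : z x = b.repr x i • b j := rfl
      rw [h1, map_smul, b.repr_self, Finsupp.smul_apply, smul_eq_mul, norm_mul]
      refine mul_le_one₀ ((hb x).1 hx i) (norm_nonneg _) ?_
      rw [Finsupp.single_apply]
      split_ifs <;> simp
    have h2 : ((z * y : X →L[F] X) : X →ₗ[F] X) = (b.coord i ∘ₗ (y : X →ₗ[F] X)).smulRight (b j) :=
      rfl
    have h3 := h z hz
    rw [h2, LinearMap.trace_smulRight] at h3
    exact h3

/-- The indicator function of the endomorphisms preserving a lattice is its own Fourier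
transform. -/
lemma endFourier_indicator [MeasurableSpace F] [BorelSpace F] {χ : AddChar F Circle}
    (hχc : ∀ x : F, (∀ a : F, ‖a‖ ≤ 1 → χ (a * x) = 1) ↔ ‖x‖ ≤ 1)
    (hSm : ∀ a : F, ‖a‖ ≤ 1 → ∀ x ∈ S, a • x ∈ S)
    (dz : Measure (X →L[F] X)) [dz.IsAddHaarMeasure]
    (hdz : dz {z : X →L[F] X | ∀ x ∈ S, z x ∈ S} = 1) :
    endFourier χ dz ({z : X →L[F] X | ∀ x ∈ S, z x ∈ S}.indicator 1) =
      {z : X →L[F] X | ∀ x ∈ S, z x ∈ S}.indicator 1 := by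
  set E := {z : X →L[F] X | ∀ x ∈ S, z x ∈ S} with hE
  have hEm : MeasurableSet E := (isCompact_isOpen_mapsTo_lattice hb).2.measurableSet
  ext y
  by_cases hy : y ∈ E
  · have h1 : ∀ z, (χ (-(LinearMap.trace F X ((z * y : X →L[F] X) : X →ₗ[F] X))) : ℂ) *
        E.indicator 1 z = E.indicator (fun _ => 1) z := by
      intro z
      by_cases hz : z ∈ E
      · rw [addChar_eq_one hχc]
        · simp [hz]
        · rw [norm_neg]
          exact (mapsTo_lattice_iff_trace hb).1 hy z hz
      · simp [hz]
    rw [endFourier, integral_congr_ae (.of_forall h1), integral_indicator_const _ hEm, Measure.real,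
      hdz, Set.indicator_of_mem hy]
    simp
  · rw [Set.indicator_of_notMem hy, endFourier_eq_pairFourier]
    by_contra h0
    -- Each -az in E is a period of the indicator. If the transform is nonzero at y, the character
    -- of y is trivial on these periods, so tr(zy) is integral for every z in E.
    refine hy ((mapsTo_lattice_iff_trace hb).2 fun z hz => (hχc _).1 fun a ha => ?_)
    have hz' : -(a • z) ∈ E := fun x hx => S.neg_mem (hSm a ha _ (hz x hx))
    have h1 := integral_addChar_translate (χ := χ) (B := negTraceForm F X) dz
      (E.indicator (1 : (X →L[F] X) → ℂ)) (-(a • z)) y fun z' => by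
        have h2 : z' + -(a • z) ∈ E ↔ z' ∈ E := by
          constructor
          · intro h x hx
            have := S.sub_mem (h x hx) (hz' x hx)
            simpa using this
          · intro h x hx
            exact S.add_mem (h x hx) (hz' x hx)
        by_cases h3 : z' ∈ E
        · rw [Set.indicator_of_mem h3, Set.indicator_of_mem (h2.2 h3)]; rfl
        · rw [Set.indicator_of_notMem h3, Set.indicator_of_notMem (fun h => h3 (h2.1 h))]
    have h2 : (χ (negTraceForm F X (-(a • z)) y) : ℂ) = 1 := by
      rwa [eq_comm, mul_eq_right₀ h0] at h1
    have h3 : negTraceForm F X (-(a • z)) y =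
        a * LinearMap.trace F X ((z * y : X →L[F] X) : X →ₗ[F] X) := by
      rw [map_neg, map_smul, LinearMap.neg_apply, LinearMap.smul_apply, negTraceForm_apply,
        smul_eq_mul, mul_neg, neg_neg]
    rw [← h3]
    exact Circle.ext (h2.trans Circle.coe_one.symm)

end Lattice

/-! ### Lattices adapted to the polarization -/

namespace PolarizedSymplectic

variable {F : Type*} [NontriviallyNormedField F] [ProperSpace F] [IsUltrametricDist F]
  {W : Type*} [NormedAddCommGroup W] [NormedSpace F W] [FiniteDimensional F W]
  (P : PolarizedSymplectic F W)

/-- For a lattice adapted to the polarization, an endomorphism of `X` preserves the lattice if and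
only if it preserves its intersection with `X`. -/
lemma endLattice_eq {L : AddSubgroup W} (hL : P.IsSelfDualLattice L)
    (h : ∀ w ∈ L, P.prX w ∈ L) :
    P.endLattice L = {z | ∀ x ∈ L.comap P.X.subtype.toAddMonoidHom,
      z x ∈ L.comap P.X.subtype.toAddMonoidHom} := by
  ext z
  have hzX : ∀ x : P.X, P.toSp (z : P.X →ₗ[F] P.X) x = z x := P.toSp_of_mem_X _
  constructor
  · intro hz x hx
    have := hz x hx
    rwa [hzX] at this
  · intro hz w hw
    have hi : ∀ w ∈ L, P.inflate (z : P.X →ₗ[F] P.X) w ∈ L := by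
      intro w hw
      rw [P.inflate_eq_inflate_prX]
      have h1 := hz ⟨P.prX w, P.prX_mem w⟩ (h w hw)
      have h2 : P.inflate (z : P.X →ₗ[F] P.X) (P.prX w) = z ⟨P.prX w, P.prX_mem w⟩ := by
        rw [inflate, LinearMap.comp_apply, LinearMap.comp_apply,
          show P.X.projectionOnto P.Y P.compl (P.prX w) = ⟨P.prX w, P.prX_mem w⟩ from
            Submodule.projectionOnto_apply_left P.compl ⟨P.prX w, P.prX_mem w⟩]
        rfl
      rw [h2]
      exact h1
    -- The extension of z by zero preserves L because the projection to X does. Self-duality turns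
    -- this into integrality of both terms of the form, including the one from the adjoint.
    refine (hL.self_dual _).1 fun w' hw' => ?_
    rw [form_toSp]
    have h1 := (hL.self_dual _).2 (hi w hw) w' hw'
    have h2 := (hL.self_dual _).2 hw _ (hi w' hw')
    rw [sub_eq_add_neg]
    exact (IsUltrametricDist.norm_add_le_max _ _).trans (max_le h1 ((norm_neg _).trans_le h2))

end PolarizedSymplectic

end

/-- A measure and its Fourier transform agree as soon as they are
proportional and some compact open set of positive measure has a self-dual indicator function. -/
lemma measure_eq_of_smul_of_endFourier {F : Type*} [NontriviallyNormedField F] [ProperSpace F]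
    [IsUltrametricDist F] [MeasurableSpace F] [BorelSpace F]
    {X : Type*} [NormedAddCommGroup X] [NormedSpace F X] [FiniteDimensional F X]
    {χ : AddChar F Circle} {dz : Measure (X →L[F] X)}
    {M₁ M₂ : Measure (X →L[F] X)} [IsFiniteMeasureOnCompacts M₁] {c : ℝ≥0} (hc : M₂ = c • M₁)
    (hM : ∀ ψ : SchwartzBruhat (X →L[F] X), ∫ z, (ψ : (X →L[F] X) → ℂ) z ∂M₂ =
        ∫ z, endFourier χ dz (ψ : (X →L[F] X) → ℂ) z ∂M₁)
    {E : Set (X →L[F] X)} (hE : IsCompact E) (hEo : IsOpen E)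
    (hEF : endFourier χ dz (E.indicator 1) = E.indicator 1) (h0 : M₁ E ≠ 0) : M₂ = M₁ := by
  have h1 := hM (SchwartzBruhat.indicator hE hEo)
  have h2 : ((SchwartzBruhat.indicator hE hEo : SchwartzBruhat (X →L[F] X)) : _ → ℂ) =
    E.indicator (fun _ => 1) := rfl
  have h3 : E.indicator (1 : (X →L[F] X) → ℂ) = E.indicator (fun _ => 1) := rfl
  rw [h3] at hEF
  rw [h2, hEF, hc, integral_smul_nnreal_measure, integral_indicator_const _ hE.measurableSet,
    NNReal.smul_def, Complex.real_smul, Complex.real_smul, mul_one] at h1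
  have h4 : ((M₁.real E : ℝ) : ℂ) ≠ 0 := by
    rw [Complex.ofReal_ne_zero]
    exact (ENNReal.toReal_pos h0 hE.measure_lt_top.ne).ne'
  have h5 : c = 1 := by
    have := mul_eq_right₀ h4 |>.1 h1
    exact_mod_cast this
  rw [hc, h5, one_smul]

theorem mainTheorem4 {F : Type*} [NontriviallyNormedField F] [IsUltrametricDist F]
    [LocallyCompactSpace F] [CharZero F] [MeasurableSpace F] [BorelSpace F]
    {W : Type*} [NormedAddCommGroup W] [NormedSpace F W] [FiniteDimensional F W]
    [MeasurableSpace W] [BorelSpace W]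
    (P : PolarizedSymplectic F W) (hn : 1 ≤ Module.finrank F P.X)
    -- a self-dual lattice
    (L : AddSubgroup W) (hL : P.IsSelfDualLattice L)
    -- an additive character, trivial on the ring of integers and on no larger fractional ideal
    (χ : AddChar F Circle) (hχ : Continuous χ)
    (hχ_cond : ∀ x : F, (∀ a : F, ‖a‖ ≤ 1 → χ (a * x) = 1) ↔ ‖x‖ ≤ 1)
    -- the normalized Haar measures
    (da : MeasureTheory.Measure F) [da.IsAddHaarMeasure] (hda : da (Metric.closedBall 0 1) = 1)
    (dw : MeasureTheory.Measure W) [dw.IsAddHaarMeasure] (hdw : dw (L : Set W) = 1)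
    (dz : MeasureTheory.Measure (P.X →L[F] P.X)) [dz.IsAddHaarMeasure]
    (hdz : dz (P.endLattice L) = 1) :
    -- part (i)
    (∀ k : ℕ, k = 1 ∨ k = Module.finrank F P.X - 1 →
      (∃ μ : MeasureTheory.Measure (rankSet F P.X k), IsOrbitMeasure k μ) ∧
      (∀ μ μ' : MeasureTheory.Measure (rankSet F P.X k),
        IsOrbitMeasure k μ → IsOrbitMeasure k μ' → ∃ c : NNReal, c ≠ 0 ∧ μ' = c • μ) ∧
      (∀ μ : MeasureTheory.Measure (rankSet F P.X k), IsOrbitMeasure k μ →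
        ∃ T : SBDistribution (P.X →L[F] P.X), ExtendsToDistribution μ T ∧
          ∀ (g h : (P.X →L[F] P.X)ˣ) (ψ : SchwartzBruhat (P.X →L[F] P.X)),
            T (leftRight g h ψ) = transformFactor k g h * T ψ)) ∧
    -- the measure on the orbit space is well defined
    (∃! m : MeasureTheory.Measure P.OrbitSpace, P.IsOrbitSpaceMeasure da dw m) ∧
    -- part (ii)
    (∀ m : MeasureTheory.Measure P.OrbitSpace, P.IsOrbitSpaceMeasure da dw m →
      (∀ (ψ : SchwartzBruhat (P.X →L[F] P.X)) (w : P.punctured),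
        MeasureTheory.Integrable (P.chcIntegrand χ ψ w) dz) ∧
      (∀ ψ : SchwartzBruhat (P.X →L[F] P.X), MeasureTheory.Integrable (P.chcInner χ dz ψ) m) ∧
      ∃ (μ₁ : MeasureTheory.Measure (rankSet F P.X 1))
        (μ₂ : MeasureTheory.Measure (rankSet F P.X (Module.finrank F P.X - 1)))
        (T₁ T₂ : SBDistribution (P.X →L[F] P.X)),
        IsOrbitMeasure 1 μ₁ ∧ IsOrbitMeasure (Module.finrank F P.X - 1) μ₂ ∧
        ExtendsToDistribution μ₁ T₁ ∧ ExtendsToDistribution μ₂ T₂ ∧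
        IsFourierTransform χ dz T₁ T₂ ∧
        (∀ ψ : SchwartzBruhat (P.X →L[F] P.X), T₂ ψ = P.chc χ dz m ψ) ∧
        -- for `n = 2` both orbits coincide, and if `L` is adapted to the polarization,
        -- then the two normalizations agree
        (Module.finrank F P.X = 2 → (∀ w ∈ L, P.prX w ∈ L) → T₁ = T₂)) := by
  have : ProperSpace F := .of_locallyCompactSpace F
  have := FiniteDimensional.proper F W
  have := FiniteDimensional.proper F P.X
  have := FiniteDimensional.proper F P.Y
  have := FiniteDimensional.proper F (P.X →L[F] P.X)
  -- For n = 1 the complement X' is zero and O_{n-1} is the origin; the argument needs no separate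
  -- case.
  obtain ⟨κ⟩ : Nonempty (P.X ≃L[F] F × (Fin (finrank F P.X - 1) → F)) :=
    FiniteDimensional.nonempty_continuousLinearEquiv_of_finrank_eq (by
      rw [finrank_prod, finrank_self, finrank_fin_fun]; omega)
  have hB := P.pairing_separating_right
  have hd := P.finrank_X_eq_finrank_Y
  have hX' : finrank F (Fin (finrank F P.X - 1) → F) = finrank F P.X - 1 := finrank_fin_fun F
  have hY : 0 < finrank F P.Y := by omega
  let μY : Measure P.Y := Measure.addHaar
  obtain ⟨μX', _, hK⟩ :=
    exists_map_chartMap_eq da κ (by rw [hX']; omega) (dw.map P.prodEquiv.symm) μY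
  have := isFiniteMeasureOnCompacts_rankOneMeasure hK hB
  set M₁ := rankOneMeasure P.pairing κ μX' μY with hM₁
  have hM₁r : M₁ (rankSet F P.X 1)ᶜ = 0 := rankOneMeasure_compl_rankSet hY hB
  have hM₁0 : M₁ ≠ 0 := rankOneMeasure_ne_zero
  have htr₁ : ∀ g h : (P.X →L[F] P.X)ˣ, M₁.map (actHomeo g h).symm = transformFactorNN 1 g h • M₁ :=
    map_actHomeo_rankOneMeasure hK hB hd
  obtain ⟨M₂, _, hM₂0, hM₂r, hM₂⟩ := exists_corankMeasure P.pairing κ hχ hχ_cond hB hd dz μX' μY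
  rw [hX'] at hM₂r
  have htr₂ := map_actHomeo_of_integral_endFourier hχ_cond hn dz htr₁ hM₂
  have ho₁ := isOrbitMeasure_comap hM₁r hM₁0 htr₁
  have ho₂ := isOrbitMeasure_comap hM₂r hM₂0 htr₂
  have hm := P.isOrbitSpaceMeasure_sectionMeasure κ μX' μY da dw hY
    (P.map_scale_orbitSection κ μX' μY da dw hK)
  refine ⟨?_, ⟨_, hm, fun m hm' => hm'.eq P da hm⟩, fun m hm' => ?_⟩
  · rintro k (rfl | rfl)
    · exact ⟨⟨_, ho₁⟩, fun _ _ h h' => h.unique h',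
        fun _ h => h.exists_distribution hM₁r hM₁0 htr₁⟩
    · exact ⟨⟨_, ho₂⟩, fun _ _ h h' => h.unique h',
        fun _ h => h.exists_distribution hM₂r hM₂0 htr₂⟩
  · obtain rfl := hm'.eq P da hm
    have hchc := P.chc_sectionMeasure κ μX' μY χ hχ_cond hY dz
    refine ⟨fun ψ w => P.integrable_chcIntegrand χ hχ dz ψ w, fun ψ => (hchc ψ).1,
      _, _, SBDistribution.ofMeasure M₁, SBDistribution.ofMeasure M₂, ho₁, ho₂,
      extendsToDistribution_of_eq (extendByZero_comap hM₁r),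
      extendsToDistribution_of_eq (extendByZero_comap hM₂r),
      fun ψ => ⟨⟨_, endFourier_mem hχ_cond dz ψ⟩, rfl, hM₂ ψ⟩,
      fun ψ => (hM₂ ψ).trans (hchc ψ).2.symm, fun hn2 hLX => ?_⟩
    have hk : finrank F P.X - 1 = 1 := by omega
    rw [hk] at hM₂r htr₂
    -- For n = 2 both measures live on O_1 with the same factor, so they are proportional. The
    -- constant is found by testing on the endomorphisms preserving L ∩ X.
    obtain ⟨c, -, hc⟩ := ho₁.unique (isOrbitMeasure_comap hM₂r hM₂0 htr₂)
    have hc' : M₂ = c • M₁ := by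
      rw [← extendByZero_comap hM₂r, hc, extendByZero, Measure.map_smul]
      exact congrArg (c • ·) (extendByZero_comap hM₁r)
    have hsub : Topology.IsClosedEmbedding (P.X.subtype : P.X → W) :=
      (Submodule.closed_of_finiteDimensional P.X).isClosedEmbedding_subtypeVal
    obtain ⟨b, hb⟩ := exists_basis_of_isCompact_isOpen (F := F)
      (S := L.comap P.X.subtype.toAddMonoidHom) (hsub.isCompact_preimage hL.isCompact)
      (hL.isOpen.preimage hsub.continuous) fun a ha x hx => hL.smul_mem a ha x hx
    have hE := isCompact_isOpen_mapsTo_lattice hb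
    rw [P.endLattice_eq hL hLX] at hdz
    have hpos : M₁ {z | ∀ x ∈ L.comap P.X.subtype.toAddMonoidHom,
        z x ∈ L.comap P.X.subtype.toAddMonoidHom} ≠ 0 := by
      have hcr := continuous_rankOneChart P.pairing κ
      rw [hM₁, rankOneMeasure, Measure.map_apply hcr.measurable hE.2.measurableSet]
      -- The preimage under the chart is open and contains the origin, where y = 0 gives the zero
      -- endomorphism; Haar measure is positive on it.
      refine ((hE.2.preimage hcr).measure_pos _ ⟨(0, 0), fun x _ => ?_⟩).ne'
      rw [rankOneChart, rankOneEnd_apply, map_zero, zero_smul, neg_zero]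
      exact zero_mem _
    have h12 : M₂ = M₁ := measure_eq_of_smul_of_endFourier hc' hM₂ hE.1 hE.2
      (endFourier_indicator hb hχ_cond (fun a ha x hx => hL.smul_mem a ha x hx) dz hdz) hpos
    subst h12
    rfl
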